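/- Let $k$ be a perfect field of characteristic different from $3$, with algebraic closure $\overline{k}$ and absolute Galois group $\Gamma_k=\mathrm{Gal}(\overline{k}/k)$. Let $q\subset\overline{k}$ be a quadratic extension of $k$, let $N_1$ be the group of elements of $q^*$ of norm $1$ over $k$, and let $q^*/(q^*)^3\to k^*/(k^*)^3$ be the homomorphism induced by the norm. Let $\zeta_3\in\overline{k}$ be a primitive cube root of unity, and let $r$ be the extension complementary to $q$ and $k(\zeta_3)$ over $k$: $r=q$ if $\zeta_3\in k$, $r=k$ if $q=k(\zeta_3)\neq k$, and otherwise $r$ is the third quadratic subfield of the biquadratic extension $q(\zeta_3)/k$. Let $(\mathbb{Z}/3\mathbb{Z})_r$ be the $\Gamma_k$-module $\mathbb{Z}/3\mathbb{Z}$ on which $\sigma$ acts trivially if it is trivial on $r$ and by $-1$ otherwise. (1) There are canonical isomorphisms $$H^1(\Gamma_k,(\mathbb{Z}/3\mathbb{Z})_r)\;\cong\;\ker\bigl(q^*/(q^*)^3\to k^*/(k^*)^3\bigr)\;\cong\;N_1/N_1^3 .$$ The second is induced by the inclusion $N_1\subset q^*$. The first depends only on the choice of $\zeta_3$, and is as follows: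 the class of a continuous cocycle $a$ corresponds to the class of $c$ if and only if there are $\gamma\in\overline{k}$ and $d\in k$ with $\gamma^3=c$ and $\mathrm{Nm}^q_k(c)=d^3$ such that $\sigma(\gamma)=\zeta_3^{a_\sigma}\gamma$ for all $\sigma\in\Gamma_k$ that are trivial on $q$, and $\sigma(\gamma)=\zeta_3^{-a_\sigma}d\,\gamma^{-1}$ for all other $\sigma$. Moreover, if $s$ is the non-trivial automorphism of $q/k$, then $u\mapsto s(u)/u$ induces an isomorphism $q^*/k^*\cong N_1$. (2) Let $K$ be a function field in one variable over $k$ in which $k$ is algebraically closed. A cubic extension of $K$ is a separable extension of degree $3$ not of the form $K\ell$ with $\ell/k$ of degree $3$; it is called purely cubic if it has a generator with minimal polynomial $X^3-\beta$ (the same term is used over other base fields). The purely cubic closure of a cubic extension $L/K$ is the smallest extension $M/K$ such that $LM/M$ is purely cubic. Put $K'=qK$. A descent of a purely cubic extension $L'/K'$ is a cubic extension $L/K$ with purely cubic closure $K'$ such that $LK'$ is $K'$-isomorphic to $L'$. A twist of a cubic extension $L/K$ is a cubic extension $M/K$ such that $L\overline{k}$ and $M\overline{k}$ are isomorphic over $K\overline{k}$.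 Let $f\in K'$ be such that the purely cubic extension $y^3=f$ of $K'$ has a descent $L/K$. Then for every $c\in N_1$ the extension $y^3=cf$ of $K'$ has a descent, this descent is unique up to $K$-isomorphism and is a twist of $L/K$, and sending the class of $c$ to it defines a bijection from $N_1/N_1^3$ to the set of $K$-isomorphism classes of twists of $L/K$. -/

import Mathlib

open Polynomial IntermediateField

noncomputable section

/-! ### Groups attached to a quadratic extension of the base field -/

/-- The subgroup of cubes of a commutative group. -/
def cubes (G : Type*) [CommGroup G] : Subgroup G := (powMonoidHom 3 : G →* G).range

/-- The norm homomorphism on unit groups. -/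
def normUnits (k q : Type*) [Field k] [Field q] [Algebra k q] : qˣ →* kˣ :=
  Units.map (Algebra.norm k : q →* k)

/-- The group of elements of norm `1`. -/
def normOne (k q : Type*) [Field k] [Field q] [Algebra k q] : Subgroup qˣ := (normUnits k q).ker

/-- A homomorphism maps cubes to cubes. -/
theorem cubes_le_comap {G H : Type*} [CommGroup G] [CommGroup H] (φ : G →* H) :
    cubes G ≤ (cubes H).comap φ := by
  rintro _ ⟨x, rfl⟩
  exact ⟨φ x, by simp⟩

/-- The map `q* / (q*)³ → k* / (k*)³` induced by the norm. -/
def normModCubes (k q : Type*) [Field k] [Field q] [Algebra k q] :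
    qˣ ⧸ cubes qˣ →* kˣ ⧸ cubes kˣ :=
  QuotientGroup.map (cubes qˣ) (cubes kˣ) (normUnits k q) (cubes_le_comap _)

/-- The subgroup `k*` of `q*`. -/
def baseUnits (k q : Type*) [Field k] [Field q] [Algebra k q] : Subgroup qˣ :=
  (Units.map (algebraMap k q : k →* q)).range

/-! ### The twisted form of `ℤ/3` and its first Galois cohomology group -/

open Classical in
/-- The extension complementary to two extensions of degree at most two: the remaining entry of
the (possibly degenerate) lattice of subfields that they generate. -/
def complementaryExtension {F E : Type*} [Field F] [Field E] [Algebra F E]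
    (Q₁ Q₂ : IntermediateField F E) : IntermediateField F E :=
  if Q₁ = ⊥ then Q₂
  else if Q₂ = ⊥ then Q₁
  else if Q₁ = Q₂ then ⊥
  else sSup {Q₃ | Q₃ ≤ Q₁ ⊔ Q₂ ∧ Module.finrank F Q₃ = 2 ∧ Q₃ ≠ Q₁ ∧ Q₃ ≠ Q₂}

section Cohomology

variable {k kbar : Type*} [Field k] [Field kbar] [Algebra k kbar]

open Classical in
/-- The scalar by which an automorphism `σ` acts on the module `(ℤ/3)_r`, for an extension `r` of
degree at most two: `1` if `σ` is trivial on `r`, and `-1` otherwise. -/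
def galSign (r : IntermediateField k kbar) (σ : Gal(kbar/k)) : ZMod 3 :=
  if ∀ x ∈ r, σ x = x then 1 else -1

/-- Continuous (that is, locally constant) 1-cocycles of the Galois group in `(ℤ/3)_r`. -/
def cocycles (r : IntermediateField k kbar) : AddSubgroup (Gal(kbar/k) → ZMod 3) where
  carrier := {a | IsLocallyConstant a ∧ ∀ σ τ, a (σ * τ) = a σ + galSign r σ * a τ}
  zero_mem' := ⟨IsLocallyConstant.const 0, by simp⟩
  add_mem' := by
    rintro a b ⟨ha, ha'⟩ ⟨hb, hb'⟩
    refine ⟨ha.add hb, fun σ τ => ?_⟩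
    simp only [Pi.add_apply, ha', hb']
    ring
  neg_mem' := by
    rintro a ⟨ha, ha'⟩
    refine ⟨ha.neg, fun σ τ => ?_⟩
    simp only [Pi.neg_apply, ha']
    ring

/-- The 1-coboundaries `σ ↦ σ • b - b` with values in `(ℤ/3)_r`. -/
def coboundaries (r : IntermediateField k kbar) : AddSubgroup (Gal(kbar/k) → ZMod 3) where
  carrier := {a | ∃ b : ZMod 3, ∀ σ, a σ = galSign r σ * b - b}
  zero_mem' := ⟨0, by simp⟩
  add_mem' := by
    rintro a a' ⟨b, hb⟩ ⟨b', hb'⟩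
    refine ⟨b + b', fun σ => ?_⟩
    simp only [Pi.add_apply, hb, hb']
    ring
  neg_mem' := by
    rintro a ⟨b, hb⟩
    refine ⟨-b, fun σ => ?_⟩
    simp only [Pi.neg_apply, hb]
    ring

/-- The first continuous cohomology group of the Galois group with coefficients in `(ℤ/3)_r`. -/
abbrev galH1 (r : IntermediateField k kbar) : Type _ :=
  cocycles r ⧸ (coboundaries r).addSubgroupOf (cocycles r)

end Cohomology

/-! ### Cubic extensions of function fields -/

/-- `K` is a function field (in one variable) with exact field of constants `k`. -/
structure IsFunctionFieldOver (k K : Type*) [Field k] [Field K] [Algebra k K] : Prop where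
  fg : (⊤ : IntermediateField k K).FG
  trdeg_eq_one : Algebra.trdeg k K = 1
  isAlgebraic_mem : ∀ x : K, IsAlgebraic k x → x ∈ (algebraMap k K).range

/-- `L / K` is generated by an element `y` with minimal polynomial `X³ - β`; in other words `L` is
the cubic extension of `K` with equation `y³ = β`. -/
def IsDefinedByCubeRoot (K L : Type*) [Field K] [Field L] [Algebra K L] (β : K) : Prop :=
  ∃ y : L, K⟮y⟯ = ⊤ ∧ minpoly K y = X ^ 3 - C β

/-- `L / K` has a generator whose minimal polynomial has the form `X³ - β`. -/
def IsPurelyCubic (K L : Type*) [Field K] [Field L] [Algebra K L] : Prop :=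
  ∃ β : K, IsDefinedByCubeRoot K L β

/-- The compositum `L M` inside the ambient field `Ω`, as an extension of `M`. -/
def compositum {K Ω : Type*} [Field K] [Field Ω] [Algebra K Ω] (L M : IntermediateField K Ω) :
    IntermediateField M Ω :=
  extendScalars (le_sup_right : M ≤ L ⊔ M)

section Extensions

variable {k kbar : Type*} (K Ω : Type*) [Field k] [Field kbar] [Algebra k kbar]
  [Field K] [Algebra k K] [Field Ω] [Algebra K Ω] [Algebra kbar Ω]

/-- The constant extension `K ℓ` of `K`, inside `Ω`. -/
def constExt (l : IntermediateField k kbar) : IntermediateField K Ω :=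
  IntermediateField.adjoin K (algebraMap kbar Ω '' (l : Set kbar))

/-- An element of `ℓ` as an element of `K ℓ`. -/
def constElt (l : IntermediateField k kbar) (x : l) : constExt K Ω l :=
  ⟨algebraMap kbar Ω x, IntermediateField.subset_adjoin K _ ⟨x, x.2, rfl⟩⟩

end Extensions

section Cubic

variable (k kbar : Type*) {K Ω : Type*} [Field k] [Field kbar] [Algebra k kbar]
  [Field K] [Algebra k K] [Field Ω] [Algebra K Ω] [Algebra kbar Ω]

/-- `L` is a cubic extension of `K`: separable of degree three, and geometric, that is, not of the
form `K ℓ` with `ℓ` an extension of degree three of the base field `k`. -/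
structure IsCubicExt (L : IntermediateField K Ω) : Prop where
  finrank_eq : Module.finrank K L = 3
  isSeparable : Algebra.IsSeparable K L
  geometric : ∀ l : IntermediateField k kbar, Module.finrank k l = 3 → L ≠ constExt K Ω l

/-- `K'` is the purely cubic closure of `L / K`: the smallest extension `M` of `K` such that
`L M / M` is purely cubic. -/
def IsPurelyCubicClosure (L K' : IntermediateField K Ω) : Prop :=
  IsLeast {M : IntermediateField K Ω | IsPurelyCubic M (compositum L M)} K'

/-- `L / K` is a (purely cubic) descent of the extension `L' / K'`. -/
structure IsDescent {K' : IntermediateField K Ω} (L' : IntermediateField K' Ω)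
    (L : IntermediateField K Ω) : Prop where
  isCubicExt : IsCubicExt k kbar L
  closure : IsPurelyCubicClosure L K'
  iso : Nonempty (compositum L K' ≃ₐ[K'] L')

/-- `L / K` is a descent of the extension of `K'` with equation `y³ = g`. -/
def IsDescentOfCubeRoot {K' : IntermediateField K Ω} (g : K') (L : IntermediateField K Ω) : Prop :=
  ∃ L' : IntermediateField K' Ω, IsDefinedByCubeRoot K' L' g ∧ IsDescent k kbar L' L

/-- The cubic extension `M / K` is a twist of `L / K`: the extensions `L k̄` and `M k̄` of `K k̄`
are isomorphic. -/
structure IsTwist (L M : IntermediateField K Ω) : Prop where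
  isCubicExt : IsCubicExt k kbar M
  iso : Nonempty (compositum L (constExt K Ω (⊤ : IntermediateField k kbar))
    ≃ₐ[constExt K Ω (⊤ : IntermediateField k kbar)]
      compositum M (constExt K Ω (⊤ : IntermediateField k kbar)))

/-- Isomorphism over `K`, as an equivalence relation on the set of twists of `L / K`. -/
def twistSetoid (L : IntermediateField K Ω) :
    Setoid {M : IntermediateField K Ω // IsTwist k kbar L M} where
  r M N := Nonempty (M.1 ≃ₐ[K] N.1)
  iseqv :=
    { refl := fun _ => ⟨AlgEquiv.refl⟩
      symm := fun ⟨e⟩ => ⟨e.symm⟩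
      trans := fun ⟨e⟩ ⟨e'⟩ => ⟨e.trans e'⟩ }

/-- The set of `K`-isomorphism classes of twists of `L / K`. -/
def TwistClasses (L : IntermediateField K Ω) : Type _ := Quotient (twistSetoid k kbar L)

/-- The isomorphism class of a twist. -/
def twistClass (L M : IntermediateField K Ω) (h : IsTwist k kbar L M) : TwistClasses k kbar L :=
  Quotient.mk (twistSetoid k kbar L) ⟨M, h⟩

end Cubic

end

/-!
The first cohomology group is computed by Kummer theory. The scalar by which `σ` acts on `(ℤ/3)_r`
is the product of its scalars for `q` and for `k(ζ)`
(`mem_fixingSubgroup_complementaryExtension`). Hence the restriction of a cocycle `a` to the Galois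
group of `q` takes values in the cube roots of unity, and Hilbert's Theorem 90 writes it as
`σ(γ) / γ`. The cocycle relation for the automorphisms `τ` that are not trivial on `q` shows that
`ζ ^ a(τ) τ(γ) γ` is an element `d` of `k` that does not depend on `τ`, and then `γ³` has norm `d³`
(`exists_kummerAt_of_cocycle`). Conversely, a cube root of an element whose norm is a cube gives a
cocycle (`exists_cocycle_of_pow_three`). Changing `c` by the cube of `d / c`, where `d³` is the norm
of `c`, makes the norm equal to `1` (`normOne_quotient_equiv_ker`).

For the second part, let `α` be a generator of `q` and let `s` be an automorphism of `Ω / K` that is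
not trivial on `q`. The descents of `y³ = g` are the extensions of `K` generated by `y + h / y`,
where `h ∈ K` is a solution of the descent equation `g s(g) = h³`, provided that `g` is not a cube
in `K k̄` (`isDescentOfCubeRoot_iff_exists`). If `M` is a descent, then the conjugation over `M`
maps `y` to `h / y` (`exists_eq_adjoin_add_div`); conversely, every extension of `K` over which
`y + h / y` generates a purely cubic extension contains `q` (`adjoin_le_of_purelyCubic`). The
minimal polynomial `X³ - 3hX - (g + s(g))` of `y + h / y` shows that the descent is unique
(`IsDescentBy.nonempty_algEquiv`). If `c` has norm `1`, then `c f` satisfies the descent equation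
with the same `h` as `f`, and over `K k̄` the elements `c f` and `f` differ by a cube, so that the
descents are twists of each other.

It remains to see that every twist `M` of `L` arises in this way, from a unique class of `c`. Over
`K k̄`, a generator of `M` of trace zero has the form `b y + c y²`, where `y³ = f`. Automorphisms
over `K` permute the cubes of the two summands, and as `f` is not a cube in `K k̄`, these are fixed
by the automorphisms over `K q` and exchanged by `s` (`map_summands_of_descentEquation`). So an
automorphism over `K q` multiplies `b` by a constant, and `b = γ w` with `γ ∈ k̄` and `w ∈ K q`
(`exists_const_mul_of_forall_map`, which rests on the linear disjointness of `K` and `k̄` over `k`).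
The constant `γ³` lies in `q`, its norm is a cube, and `M` is a descent of `y³ = γ³ w³ f`
(`IsTwist.exists_isDescentOfCubeRoot`).
-/

noncomputable section

/-! ### Norms in a quadratic extension -/

section Quadratic

variable {k q : Type*} [Field k] [Field q] [Algebra k q]

theorem eq_one_or_eq_of_finrank_two [IsGalois k q] (hq : Module.finrank k q = 2)
    {s : q ≃ₐ[k] q} (hs : s ≠ AlgEquiv.refl) (t : q ≃ₐ[k] q) : t = AlgEquiv.refl ∨ t = s := by
  have : FiniteDimensional k q := Module.finite_of_finrank_pos (by omega)
  have hc : Nat.card (q ≃ₐ[k] q) = 2 := by rw [IsGalois.card_aut_eq_finrank, hq]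
  obtain ⟨x, y, hxy, hu⟩ := Nat.card_eq_two_iff.1 hc
  have h : ∀ u : q ≃ₐ[k] q, u = x ∨ u = y := fun u => by
    have : u ∈ ({x, y} : Set (q ≃ₐ[k] q)) := hu ▸ Set.mem_univ u
    simpa using this
  rcases h s with rfl | rfl <;> rcases h t with rfl | rfl <;>
    rcases h AlgEquiv.refl with h' | h' <;> simp_all

theorem apply_apply_of_finrank_two [IsGalois k q] (hq : Module.finrank k q = 2)
    {s : q ≃ₐ[k] q} (hs : s ≠ AlgEquiv.refl) (x : q) : s (s x) = x := by
  rcases eq_one_or_eq_of_finrank_two hq hs (s * s) with h | h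
  · exact congr($h x)
  · exact absurd (mul_eq_left.1 h) hs

theorem algebraMap_norm_of_finrank_two [IsGalois k q] (hq : Module.finrank k q = 2)
    {s : q ≃ₐ[k] q} (hs : s ≠ AlgEquiv.refl) (x : q) :
    algebraMap k q (Algebra.norm k x) = x * s x := by
  classical
  have : FiniteDimensional k q := Module.finite_of_finrank_pos (by omega)
  rw [Algebra.norm_eq_prod_automorphisms]
  have : (Finset.univ : Finset (Gal(q/k))) = {AlgEquiv.refl, s} := by
    ext t
    simpa using eq_one_or_eq_of_finrank_two hq hs t
  rw [this, Finset.prod_pair hs.symm]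
  rfl

theorem mem_range_of_fixed_of_finrank_two [IsGalois k q] (hq : Module.finrank k q = 2)
    {s : q ≃ₐ[k] q} (hs : s ≠ AlgEquiv.refl) {x : q} (hx : s x = x) :
    ∃ y, algebraMap k q y = x := by
  have : FiniteDimensional k q := Module.finite_of_finrank_pos (by omega)
  refine (IsGalois.mem_range_algebraMap_iff_fixed x).2 fun t => ?_
  rcases eq_one_or_eq_of_finrank_two hq hs t with rfl | rfl
  · rfl
  · exact hx

theorem coe_normUnits (u : qˣ) : (normUnits k q u : k) = Algebra.norm k (u : q) := rfl

theorem mem_normOne {n : qˣ} : n ∈ normOne k q ↔ Algebra.norm k (n : q) = 1 := by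
  rw [normOne, MonoidHom.mem_ker, Units.ext_iff]
  rfl

theorem mk_mem_ker_normModCubes {c : qˣ} :
    (QuotientGroup.mk c : qˣ ⧸ cubes qˣ) ∈ (normModCubes k q).ker ↔
      ∃ d : kˣ, Algebra.norm k (c : q) = (d : k) ^ 3 := by
  rw [MonoidHom.mem_ker, normModCubes, QuotientGroup.map_mk, QuotientGroup.eq_one_iff]
  constructor
  · rintro ⟨d, hd⟩
    exact ⟨d, by simpa [coe_normUnits] using (congrArg Units.val hd).symm⟩
  · rintro ⟨d, hd⟩
    exact ⟨d, Units.ext (by simpa [coe_normUnits] using hd.symm)⟩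

/-- Multiplying a cube root by its norm, a cube root of unity, makes the norm of the cube root
equal to `1`. -/
theorem exists_normOne_pow_three_eq (hq : Module.finrank k q = 2) {n x : qˣ}
    (hn : n ∈ normOne k q) (hx : x ^ 3 = n) : ∃ y ∈ normOne k q, y ^ 3 = n := by
  set w : kˣ := normUnits k q x with hw
  have hw3 : w ^ 3 = 1 := by rw [hw, ← map_pow, hx]; exact hn
  refine ⟨x * Units.map (algebraMap k q : k →* q) w, ?_, ?_⟩
  · have h2 : normUnits k q (Units.map (algebraMap k q : k →* q) w) = w ^ 2 := by
      ext
      simp [normUnits, Algebra.norm_algebraMap, hq]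
    rw [normOne, MonoidHom.mem_ker, map_mul, h2, ← hw, ← pow_succ', hw3]
  · rw [mul_pow, hx, ← map_pow, hw3, map_one, mul_one]

/-- An element whose norm is the cube of `d` becomes of norm `1` when multiplied by the cube of
`d / c`. -/
theorem exists_mul_pow_three_mem_normOne (hq : Module.finrank k q = 2) {c : qˣ} {d : kˣ}
    (hd : Algebra.norm k (c : q) = (d : k) ^ 3) :
    c * (Units.map (algebraMap k q : k →* q) d * c⁻¹) ^ 3 ∈ normOne k q := by
  have h1 : normUnits k q c = d ^ 3 := Units.ext (by simpa [normUnits] using hd)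
  have h2 : normUnits k q (Units.map (algebraMap k q : k →* q) d) = d ^ 2 := by
    ext
    simp [normUnits, Algebra.norm_algebraMap, hq]
  rw [normOne, MonoidHom.mem_ker, map_mul, map_pow, map_mul, map_inv, h1, h2]
  ext
  simp
  field_simp

/-- The inclusion of `N₁` in `q*` identifies `N₁ / N₁³` with the group of classes modulo cubes whose
norm is a cube. -/
theorem normOne_quotient_equiv_ker (hq : Module.finrank k q = 2) :
    ∃ e : (normOne k q ⧸ cubes (normOne k q)) ≃* (normModCubes k q).ker,
      ∀ n : normOne k q,
        (e (QuotientGroup.mk n) : qˣ ⧸ cubes qˣ) = QuotientGroup.mk (n : qˣ) := by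
  let φ : normOne k q →* (normModCubes k q).ker :=
    ((QuotientGroup.mk' (cubes qˣ)).comp (normOne k q).subtype).codRestrict _ fun n =>
      mk_mem_ker_normModCubes.2 ⟨1, by simpa using mem_normOne.1 n.2⟩
  have hφ : ∀ n, (φ n : qˣ ⧸ cubes qˣ) = QuotientGroup.mk (n : qˣ) := fun n => rfl
  have hker : φ.ker = cubes (normOne k q) := by
    ext n
    rw [MonoidHom.mem_ker, ← Subtype.val_inj, hφ, OneMemClass.coe_one, QuotientGroup.eq_one_iff]
    constructor
    · rintro ⟨x, hx⟩
      obtain ⟨y, hy, hyn⟩ := exists_normOne_pow_three_eq hq n.2 hx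
      exact ⟨⟨y, hy⟩, Subtype.ext hyn⟩
    · rintro ⟨y, rfl⟩
      exact ⟨y, rfl⟩
  have hsurj : Function.Surjective φ := by
    rintro ⟨x, hx⟩
    obtain ⟨c, rfl⟩ := QuotientGroup.mk_surjective x
    obtain ⟨d, hd⟩ := mk_mem_ker_normModCubes.1 hx
    refine ⟨⟨_, exists_mul_pow_three_mem_normOne hq hd⟩, Subtype.ext ?_⟩
    rw [hφ]
    exact QuotientGroup.mk_mul_of_mem c ⟨_, rfl⟩
  refine ⟨(QuotientGroup.quotientMulEquivOfEq hker.symm).trans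
    (QuotientGroup.quotientKerEquivOfSurjective φ hsurj), fun n => rfl⟩

/-- Hilbert's Theorem 90 for a quadratic extension. -/
theorem quotient_baseUnits_equiv_normOne [IsGalois k q] (hq : Module.finrank k q = 2)
    {s : q ≃ₐ[k] q} (hs : s ≠ AlgEquiv.refl) :
    ∃ e : (qˣ ⧸ baseUnits k q) ≃* normOne k q,
      ∀ u : qˣ, (((e (QuotientGroup.mk u) : normOne k q) : qˣ) : q) = s (u : q) / (u : q) := by
  have hN := algebraMap_norm_of_finrank_two hq hs
  have hss := apply_apply_of_finrank_two hq hs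
  have hmem : ∀ n : qˣ, n ∈ normOne k q ↔ (n : q) * s n = 1 := fun n => by
    rw [mem_normOne, ← hN, ← map_one (algebraMap k q), (algebraMap k q).injective.eq_iff]
  let φ : qˣ →* normOne k q :=
    (Units.map (s : q →* q) / MonoidHom.id qˣ).codRestrict _ fun u => (hmem _).2 (by
      simp [hss])
  have hφ : ∀ u : qˣ, ((φ u : qˣ) : q) = s (u : q) / (u : q) := fun u => by
    simp [φ]
  have hker : φ.ker = baseUnits k q := by
    ext u
    rw [MonoidHom.mem_ker, ← Subtype.val_inj, Units.ext_iff, hφ, OneMemClass.coe_one, Units.val_one,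
      div_eq_one_iff_eq u.ne_zero]
    constructor
    · intro h
      obtain ⟨y, hy⟩ := mem_range_of_fixed_of_finrank_two hq hs h
      have hy0 : y ≠ 0 := by rintro rfl; exact u.ne_zero (by rw [← hy, map_zero])
      exact ⟨Units.mk0 y hy0, Units.ext (by simpa using hy)⟩
    · rintro ⟨y, rfl⟩
      simp
  have hsurj : Function.Surjective φ := by
    rintro ⟨n, hn⟩
    rw [hmem] at hn
    -- `y + n⁻¹ s(y)` is a preimage of `n` as soon as it does not vanish
    have key : ∃ y : q, y + s n * s y ≠ 0 := by
      by_contra! h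
      have h1 : s n = -1 := by
        have := h 1
        rw [map_one, mul_one] at this
        linear_combination this
      refine hs (AlgEquiv.ext fun y => ?_)
      have := h y
      rw [h1] at this
      change s y = y
      linear_combination -this
    obtain ⟨y, hy⟩ := key
    refine ⟨Units.mk0 _ hy, Subtype.ext (Units.ext ?_)⟩
    rw [hφ, Units.val_mk0, div_eq_iff hy, map_add, map_mul, hss, hss]
    linear_combination -(s y) * hn
  exact ⟨(QuotientGroup.quotientMulEquivOfEq hker.symm).trans
    (QuotientGroup.quotientKerEquivOfSurjective φ hsurj), hφ⟩

end Quadratic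

/-! ### Automorphisms of the algebraic closure and quadratic subfields -/

section Galois

variable {k kbar : Type*} [Field k] [Field kbar] [Algebra k kbar]

theorem mul_mem_fixingSubgroup_iff [IsGalois k kbar] {Q : IntermediateField k kbar}
    (hQ : Module.finrank k Q = 2) (σ τ : Gal(kbar/k)) :
    σ * τ ∈ Q.fixingSubgroup ↔ (σ ∈ Q.fixingSubgroup ↔ τ ∈ Q.fixingSubgroup) :=
  Subgroup.mul_mem_iff_of_index_two (by rw [← finrank_eq_fixingSubgroup_index, hQ])

theorem exists_mem_fixingSubgroup_notMem [IsGalois k kbar] {P Q : IntermediateField k kbar}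
    (hP : Module.finrank k P = 2) (hQ : Module.finrank k Q = 2) (hPQ : P ≠ Q) :
    ∃ σ ∈ P.fixingSubgroup, σ ∉ Q.fixingSubgroup := by
  by_contra! h
  have hle : Q ≤ P := by
    rw [← InfiniteGalois.fixedField_fixingSubgroup P, IntermediateField.le_iff_le]
    exact h
  have : FiniteDimensional k P := Module.finite_of_finrank_pos (by omega)
  exact hPQ (eq_of_le_of_finrank_eq hle (by rw [hP, hQ])).symm

open Classical in
/-- An automorphism is trivial on the complementary extension if and only if it is trivial on both
or on none of the two given extensions: the characters of the three quadratic subfields of a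
biquadratic extension have product `1`. -/
theorem mem_fixingSubgroup_complementaryExtension [IsGalois k kbar]
    {P Q : IntermediateField k kbar}
    (hP : Module.finrank k P = 2) (hQ : Q = ⊥ ∨ Module.finrank k Q = 2) (σ : Gal(kbar/k)) :
    σ ∈ (complementaryExtension P Q).fixingSubgroup ↔
      (σ ∈ P.fixingSubgroup ↔ σ ∈ Q.fixingSubgroup) := by
  have hP0 : P ≠ ⊥ := by rintro rfl; simp at hP
  rw [complementaryExtension, if_neg hP0]
  by_cases hQ0 : Q = ⊥
  · subst hQ0
    simp
  rw [if_neg hQ0]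
  by_cases hPQ : P = Q
  · subst hPQ
    simp
  rw [if_neg hPQ]
  replace hQ := hQ.resolve_left hQ0
  have : FiniteDimensional k P := Module.finite_of_finrank_pos (by omega)
  have : FiniteDimensional k Q := Module.finite_of_finrank_pos (by omega)
  -- the subgroup cut out by the product of the two characters
  let H : Subgroup Gal(kbar/k) :=
    { carrier := {τ | τ ∈ P.fixingSubgroup ↔ τ ∈ Q.fixingSubgroup}
      one_mem' := by simp
      mul_mem' := by
        intro a b ha hb
        simp only [Set.mem_ofPred_eq, mul_mem_fixingSubgroup_iff hP,
          mul_mem_fixingSubgroup_iff hQ] at ha hb ⊢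
        tauto
      inv_mem' := fun h => by simpa only [Set.mem_ofPred_eq, inv_mem_iff] using h }
  have hH : ∀ τ, τ ∈ H ↔ (τ ∈ P.fixingSubgroup ↔ τ ∈ Q.fixingSubgroup) := fun τ => Iff.rfl
  have hle : (P ⊔ Q).fixingSubgroup ≤ H := by
    intro τ hτ
    rw [fixingSubgroup_sup, Subgroup.mem_inf] at hτ
    exact (hH τ).2 (iff_of_true hτ.1 hτ.2)
  have hclosed : IsClosed (H : Set Gal(kbar/k)) :=
    Subgroup.isClosed_of_isOpen _ (Subgroup.isOpen_mono hle (fixingSubgroup_isOpen _))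
  have hfix : (fixedField H).fixingSubgroup = H :=
    InfiniteGalois.fixingSubgroup_fixedField ⟨H, hclosed⟩
  obtain ⟨ρ, hρP, hρQ⟩ := exists_mem_fixingSubgroup_notMem hP hQ hPQ
  obtain ⟨ρ', hρQ', hρP'⟩ := exists_mem_fixingSubgroup_notMem hQ hP (Ne.symm hPQ)
  have hmem : fixedField H ∈ {Q₃ : IntermediateField k kbar |
      Q₃ ≤ P ⊔ Q ∧ Module.finrank k Q₃ = 2 ∧ Q₃ ≠ P ∧ Q₃ ≠ Q} := by
    refine ⟨?_, ?_, ?_, ?_⟩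
    · rw [← InfiniteGalois.fixedField_fixingSubgroup (P ⊔ Q), IntermediateField.le_iff_le, hfix]
      exact hle
    · rw [finrank_eq_fixingSubgroup_index, hfix, Subgroup.index_eq_two_iff]
      refine ⟨ρ, fun τ => ?_⟩
      rw [hH, hH, mul_mem_fixingSubgroup_iff hP, mul_mem_fixingSubgroup_iff hQ]
      tauto
    · intro h
      exact hρQ (((hH ρ).1 (by rwa [← hfix, h])).1 hρP)
    · intro h
      exact hρP' (((hH ρ').1 (by rwa [← hfix, h])).2 hρQ')
  have hsSup : sSup {Q₃ : IntermediateField k kbar |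
      Q₃ ≤ P ⊔ Q ∧ Module.finrank k Q₃ = 2 ∧ Q₃ ≠ P ∧ Q₃ ≠ Q} = fixedField H := by
    refine le_antisymm (sSup_le ?_) (le_sSup hmem)
    rintro Q₃ ⟨hQ₃, h2, hne, hne'⟩
    rw [IntermediateField.le_iff_le]
    intro τ hτ
    rw [hH] at hτ
    have hsup : ∀ g, g ∈ P.fixingSubgroup → g ∈ Q.fixingSubgroup → g ∈ Q₃.fixingSubgroup :=
      fun g h h' => fixingSubgroup_antitone hQ₃ (by
        rw [fixingSubgroup_sup]; exact ⟨h, h'⟩)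
    obtain ⟨g, hg, hg'⟩ := exists_mem_fixingSubgroup_notMem hP h2 hne.symm
    obtain ⟨g', hg2, hg2'⟩ := exists_mem_fixingSubgroup_notMem hQ h2 hne'.symm
    -- otherwise the product `τ g g'` is trivial on both extensions but not on the third
    by_contra hτ'
    have hτP : τ ∉ P.fixingSubgroup := fun h => hτ' (hsup τ h (hτ.1 h))
    have hτQ : τ ∉ Q.fixingSubgroup := fun h => hτP (hτ.2 h)
    have hgQ : g ∉ Q.fixingSubgroup := fun h => hg' (hsup g hg h)
    have hgP : g' ∉ P.fixingSubgroup := fun h => hg2' (hsup g' h hg2)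
    have h1 := hsup (τ * g * g')
    rw [mul_mem_fixingSubgroup_iff hP, mul_mem_fixingSubgroup_iff hP,
      mul_mem_fixingSubgroup_iff hQ, mul_mem_fixingSubgroup_iff hQ,
      mul_mem_fixingSubgroup_iff h2, mul_mem_fixingSubgroup_iff h2] at h1
    simp only [hτP, hτQ, hgQ, hgP, hg, hg', hg2, hg2', hτ', iff_true, iff_false,
      not_true_eq_false, forall_const] at h1
  rw [hsSup, hfix, hH]

theorem galSign_eq_ite (r : IntermediateField k kbar) (σ : Gal(kbar/k))
    [Decidable (σ ∈ r.fixingSubgroup)] :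
    galSign r σ = if σ ∈ r.fixingSubgroup then 1 else -1 := by
  unfold galSign
  congr 1
  rw [IntermediateField.mem_fixingSubgroup_iff]

theorem galSign_complementaryExtension [IsGalois k kbar]
    {P Q : IntermediateField k kbar}
    (hP : Module.finrank k P = 2) (hQ : Q = ⊥ ∨ Module.finrank k Q = 2) (σ : Gal(kbar/k)) :
    galSign (complementaryExtension P Q) σ = galSign P σ * galSign Q σ := by
  classical
  simp only [galSign_eq_ite, mem_fixingSubgroup_complementaryExtension hP hQ]
  split_ifs <;> first | rfl | tauto

theorem adjoin_primitiveRoot_eq_bot_or_finrank {ζ : kbar} (hζ : IsPrimitiveRoot ζ 3) :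
    k⟮ζ⟯ = ⊥ ∨ Module.finrank k k⟮ζ⟯ = 2 := by
  have hroot : aeval ζ (X ^ 2 + X + 1 : k[X]) = 0 := by
    have := hζ.geom_sum_eq_zero (by norm_num)
    simp [Finset.sum_range_succ] at this
    simp
    linear_combination this
  have hmon : (X ^ 2 + X + 1 : k[X]).Monic := by monicity!
  have hint : IsIntegral k ζ := ⟨_, hmon, hroot⟩
  have hdeg : (minpoly k ζ).natDegree ≤ 2 := by
    refine (natDegree_le_of_dvd (minpoly.dvd _ _ hroot) hmon.ne_zero).trans ?_
    compute_degree
  have hpos := minpoly.natDegree_pos hint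
  rw [← IntermediateField.finrank_eq_one_iff, adjoin.finrank hint]
  omega

/-- Hilbert's Theorem 90 for a multiplicative cocycle that is trivial on an open subgroup. -/
theorem exists_apply_eq_mul_of_cocycle [IsAlgClosed kbar] [Algebra.IsAlgebraic k kbar]
    (φ : Gal(kbar/k) → kbar) (hφ0 : ∀ σ, φ σ ≠ 0) (hφ : ∀ σ τ, φ (σ * τ) = φ σ * σ (φ τ))
    (E : IntermediateField k kbar) [FiniteDimensional k E]
    (hE : ∀ σ ∈ E.fixingSubgroup, φ σ = 1) :
    ∃ γ : kbar, γ ≠ 0 ∧ ∀ σ, σ γ = φ σ * γ := by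
  classical
  -- `φ` descends to the embeddings of `E`
  have hext : ∀ j : E →ₐ[k] kbar, ∃ σ : Gal(kbar/k), ∀ x : E, σ x = j x := fun j => by
    obtain ⟨ψ, hψ⟩ := exists_algHom_of_splits (L := E) (K := kbar) (fun s : kbar =>
      ⟨Algebra.IsIntegral.isIntegral (R := k) s, IsAlgClosed.splits _⟩) j
    exact ⟨AlgEquiv.ofBijective ψ (Algebra.IsAlgebraic.algHom_bijective ψ),
      fun x => congr($hψ x)⟩
  choose ext hext using hext
  have hwd : ∀ (σ : Gal(kbar/k)) (j : E →ₐ[k] kbar), (∀ x : E, σ x = j x) → φ σ = φ (ext j) := by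
    intro σ j h
    have h1 : (ext j)⁻¹ * σ ∈ E.fixingSubgroup := by
      rw [IntermediateField.mem_fixingSubgroup_iff]
      intro x hx
      rw [AlgEquiv.mul_apply, h ⟨x, hx⟩, ← hext j]
      exact (ext j).symm_apply_apply x
    have h2 := hφ (ext j) ((ext j)⁻¹ * σ)
    rwa [hE _ h1, map_one, mul_one, mul_inv_cancel_left] at h2
  obtain ⟨x, hx⟩ : ∃ x : E, ∑ j : E →ₐ[k] kbar, φ (ext j) * j x ≠ 0 := by
    by_contra! h
    have hli : LinearIndependent kbar (fun j : E →ₐ[k] kbar => (j : E → kbar)) :=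
      (linearIndependent_monoidHom E kbar).comp (fun j : E →ₐ[k] kbar => (j : E →* kbar))
        (fun i j h => AlgHom.ext fun x => congr($h x))
    exact hφ0 _ (Fintype.linearIndependent_iff.1 hli (fun j => φ (ext j))
      (funext fun x => by simpa using h x) (E.val))
  refine ⟨_, inv_ne_zero hx, fun σ => ?_⟩
  have key : φ σ * σ (∑ j : E →ₐ[k] kbar, φ (ext j) * j x) =
      ∑ j : E →ₐ[k] kbar, φ (ext j) * j x := by
    rw [map_sum, Finset.mul_sum]
    refine Fintype.sum_equiv (AlgEquiv.arrowCongr AlgEquiv.refl σ) _ _ fun j => ?_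
    have h1 : φ (ext (AlgEquiv.arrowCongr AlgEquiv.refl σ j)) = φ (σ * ext j) :=
      (hwd (σ * ext j) _ fun y => by rw [AlgEquiv.mul_apply, hext]; rfl).symm
    rw [h1, hφ, map_mul, ← mul_assoc]
    rfl
  have hσ : σ (∑ j : E →ₐ[k] kbar, φ (ext j) * j x) ≠ 0 := (map_ne_zero σ).2 hx
  rw [map_inv₀, inv_eq_iff_eq_inv, mul_inv, inv_inv, eq_inv_mul_iff_mul_eq₀ (hφ0 σ), key]

end Galois

/-! ### Kummer theory for the twisted module -/

/-- A multiplicative relation between `A` and `C` which is total on `A`, whose image in `C ⧸ D` is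
`N`, and which relates the elements of `B` exactly to those of `D`, is the graph of an
isomorphism from `A ⧸ B` to `N`. -/
theorem exists_mulEquiv_of_relation {A C : Type*} [AddCommGroup A] [CommGroup C]
    (B : AddSubgroup A) (D : Subgroup C) (N : Subgroup (C ⧸ D)) (P : A → C → Prop)
    (hmul : ∀ a a' c c', P a c → P a' c' → P (a + a') (c * c'))
    (hinv : ∀ a c, P a c → P (-a) c⁻¹)
    (hA : ∀ a, ∃ c, P a c) (hN : ∀ c : C, (QuotientGroup.mk c : C ⧸ D) ∈ N ↔ ∃ a, P a c)
    (hBD : ∀ a c, P a c → (a ∈ B ↔ c ∈ D)) (hD : ∀ c ∈ D, P 0 c) :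
    ∃ e : Multiplicative (A ⧸ B) ≃* N, ∀ a c,
      (e (Multiplicative.ofAdd (QuotientAddGroup.mk a)) : C ⧸ D) = QuotientGroup.mk c ↔ P a c := by
  have hwd : ∀ a a' c c', P a c → P a' c' →
      ((QuotientAddGroup.mk a : A ⧸ B) = QuotientAddGroup.mk a' ↔
        (QuotientGroup.mk c : C ⧸ D) = QuotientGroup.mk c') := fun a a' c c' h h' => by
    rw [QuotientAddGroup.eq, QuotientGroup.eq]
    exact hBD _ _ (hmul _ _ _ _ (hinv _ _ h) h')
  have hf : ∀ x : Multiplicative (A ⧸ B), ∃ y : N, ∃ a c,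
      Multiplicative.ofAdd (QuotientAddGroup.mk a) = x ∧ QuotientGroup.mk c = (y : C ⧸ D) ∧
        P a c := fun x => by
    obtain ⟨a, ha⟩ := QuotientAddGroup.mk_surjective (Multiplicative.toAdd x)
    obtain ⟨c, hc⟩ := hA a
    exact ⟨⟨_, (hN c).2 ⟨a, hc⟩⟩, a, c, congrArg Multiplicative.ofAdd ha, rfl, hc⟩
  choose f hf using hf
  have hf' : ∀ a c, P a c →
      (f (Multiplicative.ofAdd (QuotientAddGroup.mk a)) : C ⧸ D) = QuotientGroup.mk c := by
    intro a c h
    obtain ⟨a', c', ha, hc, h'⟩ := hf (Multiplicative.ofAdd (QuotientAddGroup.mk a))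
    rw [← hc]
    exact (hwd _ _ _ _ h' h).1 ha
  have hfmul : ∀ x y, f (x * y) = f x * f y := by
    intro x y
    obtain ⟨a, c, rfl, hc, h⟩ := hf x
    obtain ⟨a', c', rfl, hc', h'⟩ := hf y
    refine Subtype.ext ((hf' _ _ (hmul _ _ _ _ h h')).trans ?_)
    rw [Subgroup.coe_mul, ← hc, ← hc']
    rfl
  have hbij : Function.Bijective (MonoidHom.mk' f hfmul) := by
    constructor
    · intro x y hxy
      obtain ⟨a, c, rfl, hc, h⟩ := hf x
      obtain ⟨a', c', rfl, hc', h'⟩ := hf y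
      exact congrArg Multiplicative.ofAdd ((hwd _ _ _ _ h h').2
        (hc.trans ((congrArg Subtype.val hxy).trans hc'.symm)))
    · rintro ⟨y, hy⟩
      obtain ⟨c, rfl⟩ := QuotientGroup.mk_surjective y
      obtain ⟨a, ha⟩ := (hN c).1 hy
      exact ⟨_, Subtype.ext (hf' _ _ ha)⟩
  refine ⟨MulEquiv.ofBijective _ hbij, fun a c => ⟨fun h => ?_, hf' a c⟩⟩
  obtain ⟨c', hc'⟩ := hA a
  have h1 : (QuotientGroup.mk c' : C ⧸ D) = QuotientGroup.mk c := (hf' a c' hc').symm.trans h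
  have := hmul _ _ _ _ hc' (hD _ (QuotientGroup.eq.1 h1))
  rwa [add_zero, mul_inv_cancel_left] at this

section Kummer

variable {k kbar : Type*} [Field k] [Field kbar] [Algebra k kbar]

theorem pow_val_add {ζ : kbar} (hζ : ζ ^ 3 = 1) (a b : ZMod 3) :
    ζ ^ (a + b).val = ζ ^ a.val * ζ ^ b.val := by
  rw [← pow_add, ZMod.val_add]
  exact (pow_eq_pow_mod _ hζ).symm

theorem pow_val_neg {ζ : kbar} (hζ : ζ ^ 3 = 1) (a : ZMod 3) :
    ζ ^ (-a).val = (ζ ^ a.val)⁻¹ := by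
  refine eq_inv_of_mul_eq_one_left ?_
  rw [← pow_val_add hζ, neg_add_cancel, ZMod.val_zero, pow_zero]

theorem pow_val_injective {ζ : kbar} (hζ : IsPrimitiveRoot ζ 3) {a b : ZMod 3}
    (h : ζ ^ a.val = ζ ^ b.val) : a = b :=
  ZMod.val_injective 3 (hζ.pow_inj a.val_lt b.val_lt h)

theorem exists_eq_pow_val_mul {ζ : kbar} (hζ : IsPrimitiveRoot ζ 3) {x y : kbar}
    (hy : y ≠ 0) (h : x ^ 3 = y ^ 3) : ∃ n : ZMod 3, x = ζ ^ n.val * y := by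
  obtain ⟨i, hi, hx⟩ := hζ.eq_pow_of_pow_eq_one (ξ := x / y) (by
    rw [div_pow, h, div_self (pow_ne_zero _ hy)])
  refine ⟨i, ?_⟩
  rw [ZMod.val_natCast_of_lt hi, hx, div_mul_cancel₀ _ hy]

theorem galSign_eq_one {r : IntermediateField k kbar} {σ : Gal(kbar/k)}
    (h : σ ∈ r.fixingSubgroup) : galSign r σ = 1 :=
  if_pos ((IntermediateField.mem_fixingSubgroup_iff _ _).1 h)

theorem galSign_eq_neg_one {r : IntermediateField k kbar} {σ : Gal(kbar/k)}
    (h : σ ∉ r.fixingSubgroup) : galSign r σ = -1 :=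
  if_neg (mt (IntermediateField.mem_fixingSubgroup_iff _ _).2 h)

theorem mem_fixingSubgroup_adjoin_simple {x : kbar} {σ : Gal(kbar/k)} :
    σ ∈ (k⟮x⟯).fixingSubgroup ↔ σ x = x := by
  rw [IntermediateField.mem_fixingSubgroup_iff]
  refine ⟨fun h => h x (mem_adjoin_simple_self k x), fun h y hy => ?_⟩
  have : k⟮x⟯ ≤ fixedField (Subgroup.zpowers σ) := by
    rw [adjoin_simple_le_iff, mem_fixedField_iff]
    exact fun f hf => (Subgroup.zpowers_le (H := MulAction.stabilizer Gal(kbar/k) x)).2 h hf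
  exact (mem_fixedField_iff _ _).1 (this hy) σ (Subgroup.mem_zpowers σ)

theorem map_pow_val {ζ : kbar} (hζ : IsPrimitiveRoot ζ 3) (σ : Gal(kbar/k)) (a : ZMod 3) :
    σ (ζ ^ a.val) = ζ ^ (galSign k⟮ζ⟯ σ * a).val := by
  by_cases h : σ ∈ (k⟮ζ⟯).fixingSubgroup
  · rw [galSign_eq_one h, one_mul, map_pow, mem_fixingSubgroup_adjoin_simple.1 h]
  · rw [galSign_eq_neg_one h, neg_one_mul, pow_val_neg hζ.pow_eq_one, map_pow, ← inv_pow]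
    congr 1
    rw [mem_fixingSubgroup_adjoin_simple] at h
    obtain ⟨i, hi, hx⟩ := hζ.eq_pow_of_pow_eq_one (ξ := σ ζ) (by
      rw [← map_pow, hζ.pow_eq_one, map_one])
    refine eq_inv_of_mul_eq_one_left ?_
    rw [← hx]
    interval_cases i
    · rw [pow_zero] at hx
      have := hζ.ne_one (by norm_num)
      exact absurd (σ.injective (hx.symm.trans (map_one σ).symm)) this
    · exact absurd (by rw [← hx, pow_one]) h
    · rw [← pow_succ, hζ.pow_eq_one]

/-- The condition that relates the value `n` at `σ` of a cocycle to a cube root `γ` and to a cube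
root `d` of the norm of `γ³`. -/
def KummerAt (q : IntermediateField k kbar) (ζ γ : kbar) (d : k) (σ : Gal(kbar/k))
    (n : ZMod 3) : Prop :=
  ((∀ x ∈ q, σ x = x) → σ γ = ζ ^ n.val * γ) ∧
    (¬ (∀ x ∈ q, σ x = x) → ζ ^ n.val * σ γ * γ = algebraMap k kbar d)

theorem kummerAt_iff_of_mem {q : IntermediateField k kbar} {ζ γ : kbar} {d : k} {σ : Gal(kbar/k)}
    {n : ZMod 3} (h : σ ∈ q.fixingSubgroup) : KummerAt q ζ γ d σ n ↔ σ γ = ζ ^ n.val * γ := by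
  rw [IntermediateField.mem_fixingSubgroup_iff] at h
  simp only [KummerAt]
  tauto

theorem kummerAt_iff_of_notMem {q : IntermediateField k kbar} {ζ γ : kbar} {d : k}
    {σ : Gal(kbar/k)} {n : ZMod 3} (h : σ ∉ q.fixingSubgroup) :
    KummerAt q ζ γ d σ n ↔ ζ ^ n.val * σ γ * γ = algebraMap k kbar d := by
  rw [IntermediateField.mem_fixingSubgroup_iff] at h
  simp only [KummerAt]
  tauto

variable {q : IntermediateField k kbar} {ζ γ γ' : kbar} {d d' : k} {σ τ : Gal(kbar/k)}
  {m n : ZMod 3}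

theorem KummerAt.add (hζ : ζ ^ 3 = 1) (h : KummerAt q ζ γ d σ m) (h' : KummerAt q ζ γ' d' σ n) :
    KummerAt q ζ (γ * γ') (d * d') σ (m + n) := by
  by_cases hσ : σ ∈ q.fixingSubgroup
  · rw [kummerAt_iff_of_mem hσ] at *
    rw [map_mul, h, h', pow_val_add hζ]
    ring
  · rw [kummerAt_iff_of_notMem hσ] at *
    rw [map_mul, map_mul, ← h, ← h', pow_val_add hζ]
    ring

theorem KummerAt.neg (hζ : ζ ^ 3 = 1) (h : KummerAt q ζ γ d σ m) :
    KummerAt q ζ γ⁻¹ d⁻¹ σ (-m) := by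
  by_cases hσ : σ ∈ q.fixingSubgroup
  · rw [kummerAt_iff_of_mem hσ] at *
    rw [map_inv₀, h, pow_val_neg hζ, mul_inv]
  · rw [kummerAt_iff_of_notMem hσ] at *
    rw [map_inv₀, map_inv₀, ← h, pow_val_neg hζ, mul_inv, mul_inv]

theorem KummerAt.unique (hζ : IsPrimitiveRoot ζ 3) (hγ : γ ≠ 0) (h : KummerAt q ζ γ d σ m)
    (h' : KummerAt q ζ γ d σ n) : m = n := by
  by_cases hσ : σ ∈ q.fixingSubgroup
  · rw [kummerAt_iff_of_mem hσ] at *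
    exact pow_val_injective hζ (mul_right_cancel₀ hγ (h.symm.trans h'))
  · rw [kummerAt_iff_of_notMem hσ, mul_assoc] at *
    exact pow_val_injective hζ (mul_right_cancel₀
      (mul_ne_zero ((map_ne_zero σ).2 hγ) hγ) (h.trans h'.symm))

/-- The values determined by `γ` and `d` satisfy the cocycle relation. -/
theorem KummerAt.mul [IsGalois k kbar] (hq : Module.finrank k q = 2) (hζ : IsPrimitiveRoot ζ 3)
    (hγ : γ ≠ 0) (h : KummerAt q ζ γ d σ m) (h' : KummerAt q ζ γ d τ n) :
    KummerAt q ζ γ d (σ * τ) (m + galSign q σ * galSign k⟮ζ⟯ σ * n) := by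
  have hsγ : σ γ ≠ 0 := (map_ne_zero σ).2 hγ
  have hmem := mul_mem_fixingSubgroup_iff hq σ τ
  by_cases hσ : σ ∈ q.fixingSubgroup <;> by_cases hτ : τ ∈ q.fixingSubgroup
  · rw [kummerAt_iff_of_mem (by tauto)] at *
    rw [AlgEquiv.mul_apply, h', map_mul, map_pow_val hζ, h, pow_val_add hζ.pow_eq_one,
      galSign_eq_one hσ, one_mul]
    ring
  · rw [kummerAt_iff_of_mem hσ] at h
    rw [kummerAt_iff_of_notMem hτ] at h'
    rw [kummerAt_iff_of_notMem (by tauto)]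
    have := congrArg σ h'
    rw [map_mul, map_mul, map_pow_val hζ, AlgEquiv.commutes, h] at this
    rw [← this, pow_val_add hζ.pow_eq_one, galSign_eq_one hσ, one_mul, AlgEquiv.mul_apply]
    ring
  · rw [kummerAt_iff_of_notMem hσ] at h
    rw [kummerAt_iff_of_mem hτ] at h'
    rw [kummerAt_iff_of_notMem (by tauto), AlgEquiv.mul_apply, h', map_mul, map_pow_val hζ,
      pow_val_add hζ.pow_eq_one, galSign_eq_neg_one hσ, neg_one_mul, neg_mul,
      pow_val_neg hζ.pow_eq_one, ← h]
    have : ζ ^ (galSign k⟮ζ⟯ σ * n).val ≠ 0 := pow_ne_zero _ (hζ.ne_zero (by norm_num))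
    field_simp
  · rw [kummerAt_iff_of_notMem (by tauto)] at h h'
    rw [kummerAt_iff_of_mem (by tauto)]
    have := congrArg σ h'
    rw [map_mul, map_mul, map_pow_val hζ, AlgEquiv.commutes, ← h] at this
    rw [pow_val_add hζ.pow_eq_one, galSign_eq_neg_one hσ, neg_one_mul, neg_mul,
      pow_val_neg hζ.pow_eq_one, AlgEquiv.mul_apply]
    have h0 : ζ ^ (galSign k⟮ζ⟯ σ * n).val ≠ 0 := pow_ne_zero _ (hζ.ne_zero (by norm_num))
    field_simp
    refine mul_right_cancel₀ hsγ ?_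
    linear_combination this

theorem norm_eq_mul_apply [IsGalois k kbar] (hq : Module.finrank k q = 2)
    (hσ : σ ∉ q.fixingSubgroup) (x : q) :
    algebraMap k kbar (Algebra.norm k x) = x * σ x := by
  have : FiniteDimensional k q := Module.finite_of_finrank_pos (by omega)
  have : Algebra.IsQuadraticExtension k q := ⟨hq⟩
  have hs : σ.restrictNormal q ≠ AlgEquiv.refl := by
    intro h
    refine hσ ((IntermediateField.mem_fixingSubgroup_iff _ _).2 fun x hx => ?_)
    have h1 := AlgEquiv.restrictNormal_commutes σ q ⟨x, hx⟩
    rw [h] at h1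
    exact h1.symm
  rw [IsScalarTower.algebraMap_apply k q kbar, algebraMap_norm_of_finrank_two hq hs, map_mul,
    AlgEquiv.restrictNormal_commutes]
  rfl

theorem exists_notMem_fixingSubgroup [IsGalois k kbar] (hq : Module.finrank k q = 2) :
    ∃ σ : Gal(kbar/k), σ ∉ q.fixingSubgroup := by
  by_contra! h
  rw [finrank_eq_fixingSubgroup_index, (Subgroup.eq_top_iff' _).2 h, Subgroup.index_top] at hq
  omega

theorem mem_of_forall_mem_fixingSubgroup [IsGalois k kbar] {x : kbar}
    (h : ∀ σ ∈ q.fixingSubgroup, σ x = x) : x ∈ q := by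
  rw [← InfiniteGalois.fixedField_fixingSubgroup q, mem_fixedField_iff]
  exact h

theorem exists_algebraMap_eq_of_forall_fixed [IsGalois k kbar] {x : kbar}
    (h : ∀ σ : Gal(kbar/k), σ x = x) : ∃ y, algebraMap k kbar y = x :=
  (InfiniteGalois.mem_range_algebraMap_iff_fixed x).2 h

theorem mem_cocycles_iff [IsGalois k kbar] (hq : Module.finrank k q = 2)
    (hζ : IsPrimitiveRoot ζ 3) {a : Gal(kbar/k) → ZMod 3} :
    a ∈ cocycles (complementaryExtension q k⟮ζ⟯) ↔ IsLocallyConstant a ∧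
      ∀ σ τ, a (σ * τ) = a σ + galSign q σ * galSign k⟮ζ⟯ σ * a τ := by
  simp only [← galSign_complementaryExtension hq (adjoin_primitiveRoot_eq_bot_or_finrank hζ)]
  exact Iff.rfl

theorem mem_coboundaries_iff [IsGalois k kbar] (hq : Module.finrank k q = 2)
    (hζ : IsPrimitiveRoot ζ 3) {a : Gal(kbar/k) → ZMod 3} :
    a ∈ coboundaries (complementaryExtension q k⟮ζ⟯) ↔
      ∃ b, ∀ σ, a σ = galSign q σ * galSign k⟮ζ⟯ σ * b - b := by
  simp only [← galSign_complementaryExtension hq (adjoin_primitiveRoot_eq_bot_or_finrank hζ)]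
  exact Iff.rfl

/-- A cube root of an element whose norm is a cube determines a cocycle. -/
theorem exists_cocycle_of_pow_three [IsGalois k kbar] (hq : Module.finrank k q = 2)
    (hζ : IsPrimitiveRoot ζ 3) {c : q} (hc : c ≠ 0) (hγ : γ ^ 3 = c)
    (hd : Algebra.norm k c = d ^ 3) :
    ∃ a ∈ cocycles (complementaryExtension q k⟮ζ⟯), ∀ σ, KummerAt q ζ γ d σ (a σ) := by
  have hγ0 : γ ≠ 0 := by
    rintro rfl
    rw [zero_pow (by norm_num)] at hγ
    exact hc (Subtype.ext hγ.symm)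
  have hex : ∀ σ, ∃ n, KummerAt q ζ γ d σ n := fun σ => by
    have hσγ : σ γ ≠ 0 := (map_ne_zero σ).2 hγ0
    by_cases hσ : σ ∈ q.fixingSubgroup
    · simp only [kummerAt_iff_of_mem hσ]
      refine exists_eq_pow_val_mul hζ hγ0 ?_
      rw [← map_pow, hγ, (IntermediateField.mem_fixingSubgroup_iff _ _).1 hσ _ c.2]
    · simp only [kummerAt_iff_of_notMem hσ, mul_assoc]
      obtain ⟨n, hn⟩ := exists_eq_pow_val_mul (x := algebraMap k kbar d) hζ
        (mul_ne_zero hσγ hγ0) (by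
          rw [← map_pow, ← hd, norm_eq_mul_apply hq hσ, mul_pow, ← map_pow, hγ, mul_comm])
      exact ⟨n, hn.symm⟩
  choose a ha using hex
  have hmul : ∀ σ τ, a (σ * τ) = a σ + galSign q σ * galSign k⟮ζ⟯ σ * a τ := fun σ τ =>
    (ha _).unique hζ hγ0 ((ha σ).mul hq hζ hγ0 (ha τ))
  refine ⟨a, (mem_cocycles_iff hq hζ).2 ⟨?_, hmul⟩, ha⟩
  -- `a` vanishes on the open subgroup of automorphisms that fix `q` and `γ`
  have : FiniteDimensional k q := Module.finite_of_finrank_pos (by omega)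
  have : FiniteDimensional k k⟮γ⟯ := adjoin.finiteDimensional (Algebra.IsIntegral.isIntegral γ)
  rw [IsLocallyConstant.iff_eventually_eq]
  intro σ
  have hopen : IsOpen {τ : Gal(kbar/k) | σ⁻¹ * τ ∈ (q ⊔ k⟮γ⟯).fixingSubgroup} :=
    (fixingSubgroup_isOpen (q ⊔ k⟮γ⟯)).preimage (continuous_const.mul continuous_id)
  refine Filter.mem_of_superset (hopen.mem_nhds (by simp)) fun τ hτ => ?_
  have hτ' : σ⁻¹ * τ ∈ (q ⊔ k⟮γ⟯).fixingSubgroup := hτ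
  rw [fixingSubgroup_sup, Subgroup.mem_inf, mem_fixingSubgroup_adjoin_simple] at hτ'
  have h0 : a (σ⁻¹ * τ) = 0 := (ha _).unique hζ hγ0 <| by
    rw [kummerAt_iff_of_mem hτ'.1, hτ'.2, ZMod.val_zero, pow_zero, one_mul]
  have := hmul σ (σ⁻¹ * τ)
  rwa [h0, mul_zero, add_zero, mul_inv_cancel_left] at this

theorem kummerAt_zero_of_mem [IsGalois k kbar] (hq : Module.finrank k q = 2) (x : q) :
    KummerAt q ζ x (Algebra.norm k x) σ 0 := by
  by_cases hσ : σ ∈ q.fixingSubgroup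
  · rw [kummerAt_iff_of_mem hσ, ZMod.val_zero, pow_zero, one_mul]
    exact (IntermediateField.mem_fixingSubgroup_iff _ _).1 hσ _ x.2
  · rw [kummerAt_iff_of_notMem hσ, ZMod.val_zero, pow_zero, one_mul,
      norm_eq_mul_apply hq hσ, mul_comm]

/-- Every cocycle comes from a cube root: the restriction of the cocycle to the Galois group of `q`
is a Kummer cocycle `σ ↦ σ(γ) / γ` by Hilbert's Theorem 90, and the cocycle relation for the
remaining automorphisms shows that `ζ ^ a(τ) τ(γ) γ` is one and the same element of `k`, for all
`τ` that are nontrivial on `q`. -/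
theorem exists_kummerAt_of_cocycle [IsAlgClosed kbar] [IsGalois k kbar]
    (hq : Module.finrank k q = 2) (hζ : IsPrimitiveRoot ζ 3) {a : Gal(kbar/k) → ZMod 3}
    (ha : a ∈ cocycles (complementaryExtension q k⟮ζ⟯)) :
    ∃ (γ : kbar) (d : k), γ ≠ 0 ∧ ∀ σ, KummerAt q ζ γ d σ (a σ) := by
  obtain ⟨hloc, hmul⟩ := (mem_cocycles_iff hq hζ).1 ha
  have hζ0 : ζ ≠ 0 := hζ.ne_zero (by norm_num)
  have h1 : a 1 = 0 := by
    have := hmul 1 1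
    rw [one_mul, galSign_eq_one (one_mem _), galSign_eq_one (one_mem _)] at this
    linear_combination -this
  obtain ⟨E, hE, hEa⟩ := (krullTopology_mem_nhds_one_iff k kbar _).1
    ((hloc.isOpen_fiber 0).mem_nhds h1)
  have : FiniteDimensional k q := Module.finite_of_finrank_pos (by omega)
  have hres : ∀ σ : Gal(kbar/q), (σ.restrictScalars k) ∈ q.fixingSubgroup := fun σ => by
    rw [IntermediateField.mem_fixingSubgroup_iff]
    exact fun x hx => σ.commutes ⟨x, hx⟩
  let E' : IntermediateField q kbar := extendScalars (le_sup_right : q ≤ E ⊔ q)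
  have : FiniteDimensional k E' :=
    inferInstanceAs (FiniteDimensional k (E ⊔ q : IntermediateField k kbar))
  have : FiniteDimensional q E' := FiniteDimensional.right k q E'
  obtain ⟨γ, hγ0, hγ⟩ := exists_apply_eq_mul_of_cocycle (k := q)
    (fun σ => ζ ^ (a (σ.restrictScalars k)).val) (fun σ => pow_ne_zero _ hζ0) (fun σ τ => by
      have h2 := hmul (σ.restrictScalars k) (τ.restrictScalars k)
      rw [galSign_eq_one (hres σ), one_mul] at h2
      have h3 : (σ * τ).restrictScalars k = σ.restrictScalars k * τ.restrictScalars k := rfl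
      rw [h3, h2, pow_val_add hζ.pow_eq_one, ← map_pow_val hζ]
      rfl) E' (fun σ hσ => by
      have h2 : σ.restrictScalars k ∈ E.fixingSubgroup := by
        rw [IntermediateField.mem_fixingSubgroup_iff] at hσ ⊢
        exact fun x hx => hσ x ((mem_extendScalars _).2 ((le_sup_left : E ≤ E ⊔ q) hx))
      have h3 : a (σ.restrictScalars k) = 0 := hEa h2
      rw [h3, ZMod.val_zero, pow_zero])
  have hγ' : ∀ σ ∈ q.fixingSubgroup, σ γ = ζ ^ (a σ).val * γ := fun σ hσ =>
    hγ (fixingSubgroupEquiv q ⟨σ, hσ⟩)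
  obtain ⟨τ, hτ⟩ := exists_notMem_fixingSubgroup hq
  have hind : ∀ τ' ∉ q.fixingSubgroup,
      ζ ^ (a τ').val * τ' γ * γ = ζ ^ (a τ).val * τ γ * γ := by
    intro τ' hτ'
    have hσ : τ⁻¹ * τ' ∈ q.fixingSubgroup := by
      rw [mul_mem_fixingSubgroup_iff hq, inv_mem_iff]
      tauto
    have h2 := hmul τ (τ⁻¹ * τ')
    have h3 := congrArg τ (hγ' _ hσ)
    rw [map_mul, map_pow_val hζ, ← AlgEquiv.mul_apply, mul_inv_cancel_left] at h3
    rw [mul_inv_cancel_left, galSign_eq_neg_one hτ] at h2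
    rw [h3, ← mul_assoc, ← pow_val_add hζ.pow_eq_one]
    congr 4
    linear_combination h2
  obtain ⟨d, hd⟩ := exists_algebraMap_eq_of_forall_fixed (k := k)
    (x := ζ ^ (a τ).val * τ γ * γ) (fun σ => by
      by_cases hσ : σ ∈ q.fixingSubgroup
      · rw [map_mul, map_mul, map_pow_val hζ, hγ' σ hσ,
          ← hind (σ * τ) (by rw [mul_mem_fixingSubgroup_iff hq]; tauto), hmul, galSign_eq_one hσ,
          one_mul, pow_val_add hζ.pow_eq_one, AlgEquiv.mul_apply]
        ring
      · have hσσ := hγ' (σ * σ) (by rw [mul_mem_fixingSubgroup_iff hq])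
        rw [AlgEquiv.mul_apply] at hσσ
        rw [← hind σ hσ, map_mul, map_mul, map_pow_val hζ, hσσ, ← mul_assoc,
          ← pow_val_add hζ.pow_eq_one, hmul, galSign_eq_neg_one hσ, mul_right_comm]
        congr 4
        ring)
  refine ⟨γ, d, hγ0, fun σ => ?_⟩
  by_cases hσ : σ ∈ q.fixingSubgroup
  · exact (kummerAt_iff_of_mem hσ).2 (hγ' σ hσ)
  · exact (kummerAt_iff_of_notMem hσ).2 ((hind σ hσ).trans hd.symm)

theorem pow_three_mem_of_kummerAt [IsGalois k kbar] (hζ : ζ ^ 3 = 1)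
    (h : ∀ σ, ∃ n, KummerAt q ζ γ d σ n) : γ ^ 3 ∈ q := by
  refine mem_of_forall_mem_fixingSubgroup fun σ hσ => ?_
  obtain ⟨n, hn⟩ := h σ
  rw [map_pow, (kummerAt_iff_of_mem hσ).1 hn, mul_pow, pow_right_comm, hζ, one_pow, one_mul]

theorem norm_eq_pow_three_of_kummerAt [IsGalois k kbar] (hq : Module.finrank k q = 2)
    (hζ : ζ ^ 3 = 1) (h : ∀ σ, ∃ n, KummerAt q ζ γ d σ n) {c : q} (hc : γ ^ 3 = c) :
    Algebra.norm k c = d ^ 3 := by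
  obtain ⟨τ, hτ⟩ := exists_notMem_fixingSubgroup hq
  obtain ⟨n, hn⟩ := h τ
  rw [kummerAt_iff_of_notMem hτ] at hn
  refine (algebraMap k kbar).injective ?_
  rw [norm_eq_mul_apply hq hτ, map_pow, ← hn, ← hc, map_pow, mul_pow, mul_pow, pow_right_comm, hζ,
    one_pow, one_mul, mul_comm]

/-- If `γ³` is a cube in `q`, then the cocycle is a coboundary. The correction `e` accounts for the
cube roots of unity in `k`, which change the choice of `d`. -/
theorem mem_coboundaries_of_pow_three_eq [IsGalois k kbar] (hq : Module.finrank k q = 2)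
    (hζ : IsPrimitiveRoot ζ 3) {a : Gal(kbar/k) → ZMod 3} (hγ : γ ≠ 0)
    (h : ∀ σ, KummerAt q ζ γ d σ (a σ)) {x : q} (hx : γ ^ 3 = (x : kbar) ^ 3) :
    a ∈ coboundaries (complementaryExtension q k⟮ζ⟯) := by
  have hx0 : (x : kbar) ≠ 0 := by
    intro h0
    rw [h0, zero_pow (by norm_num)] at hx
    exact hγ (pow_eq_zero_iff (by norm_num) |>.1 hx)
  obtain ⟨b, hb⟩ := exists_eq_pow_val_mul hζ hx0 hx
  have hN : d ^ 3 = Algebra.norm k x ^ 3 := by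
    rw [← map_pow, ← norm_eq_pow_three_of_kummerAt hq hζ.pow_eq_one (fun σ => ⟨_, h σ⟩)
      (c := x ^ 3) (by simpa using hx)]
  have hN0 : algebraMap k kbar (Algebra.norm k x) ≠ 0 := by
    obtain ⟨τ, hτ⟩ := exists_notMem_fixingSubgroup hq
    rw [norm_eq_mul_apply hq hτ]
    exact mul_ne_zero hx0 ((map_ne_zero τ).2 hx0)
  obtain ⟨e, he⟩ := exists_eq_pow_val_mul (x := algebraMap k kbar d) hζ hN0 (by
    rw [← map_pow, ← map_pow, hN])
  have heσ : ∀ σ : Gal(kbar/k), galSign k⟮ζ⟯ σ * e = e := fun σ => by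
    refine pow_val_injective hζ ?_
    rw [← map_pow_val hζ, ← mul_div_cancel_right₀ (ζ ^ e.val) hN0, ← he, map_div₀,
      AlgEquiv.commutes, AlgEquiv.commutes]
  have h3 : (3 : ZMod 3) = 0 := rfl
  refine (mem_coboundaries_iff hq hζ).2 ⟨b + e, fun σ => ?_⟩
  have h0 : KummerAt q ζ γ d σ (galSign q σ * galSign k⟮ζ⟯ σ * (b + e) - (b + e)) := by
    by_cases hσ : σ ∈ q.fixingSubgroup
    · rw [kummerAt_iff_of_mem hσ, galSign_eq_one hσ, one_mul, mul_add, heσ, hb, map_mul,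
        map_pow_val hζ, (IntermediateField.mem_fixingSubgroup_iff _ _).1 hσ _ x.2, ← mul_assoc,
        ← pow_val_add hζ.pow_eq_one]
      congr 3
      ring
    · rw [kummerAt_iff_of_notMem hσ, galSign_eq_neg_one hσ, neg_one_mul, neg_mul, mul_add, heσ, hb,
        map_mul, map_pow_val hζ, he, norm_eq_mul_apply hq hσ]
      have : ∀ u v w X Y : kbar, u * (v * X) * (w * Y) = (u * v * w) * (Y * X) := by
        intros; ring
      rw [this, ← pow_val_add hζ.pow_eq_one, ← pow_val_add hζ.pow_eq_one]
      congr 3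
      linear_combination -e * h3
  exact (h σ).unique hζ hγ h0

theorem exists_pow_three_eq_of_mem_coboundaries [IsGalois k kbar] (hq : Module.finrank k q = 2)
    (hζ : IsPrimitiveRoot ζ 3) {a : Gal(kbar/k) → ZMod 3}
    (h : ∀ σ, KummerAt q ζ γ d σ (a σ))
    (ha : a ∈ coboundaries (complementaryExtension q k⟮ζ⟯)) :
    ∃ x : q, γ ^ 3 = (x : kbar) ^ 3 := by
  obtain ⟨b, hb⟩ := (mem_coboundaries_iff hq hζ).1 ha
  refine ⟨⟨ζ ^ (-b).val * γ, mem_of_forall_mem_fixingSubgroup fun σ hσ => ?_⟩, ?_⟩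
  · rw [map_mul, map_pow_val hζ, (kummerAt_iff_of_mem hσ).1 (h σ), hb, galSign_eq_one hσ,
      ← mul_assoc, ← pow_val_add hζ.pow_eq_one]
    congr 3
    ring
  · rw [mul_pow, pow_right_comm, hζ.pow_eq_one, one_pow, one_mul]

/-- Kummer theory for the first cohomology group of the twisted module. -/
theorem galH1_equiv_ker [IsAlgClosed kbar] [IsGalois k kbar] (hq : Module.finrank k q = 2)
    (hζ : IsPrimitiveRoot ζ 3) :
    ∃ e : Multiplicative (galH1 (complementaryExtension q k⟮ζ⟯)) ≃* (normModCubes k q).ker,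
      ∀ (a : cocycles (complementaryExtension q k⟮ζ⟯)) (c : qˣ),
        (e (Multiplicative.ofAdd (QuotientAddGroup.mk a)) : qˣ ⧸ cubes qˣ)
            = QuotientGroup.mk c ↔
          ∃ (γ : kbar) (d : k), γ ^ 3 = ((c : q) : kbar) ∧ Algebra.norm k (c : q) = d ^ 3 ∧
            ∀ σ, KummerAt q ζ γ d σ (a.1 σ) := by
  have hne : ∀ {γ : kbar} {c : qˣ}, γ ^ 3 = ((c : q) : kbar) → γ ≠ 0 := by
    rintro _ c hc rfl
    rw [zero_pow (by norm_num)] at hc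
    exact c.ne_zero (Subtype.ext hc.symm)
  refine exists_mulEquiv_of_relation _ _ _ (fun (a : cocycles (complementaryExtension q k⟮ζ⟯))
    (c : qˣ) => ∃ (γ : kbar) (d : k), γ ^ 3 = ((c : q) : kbar) ∧
      Algebra.norm k (c : q) = d ^ 3 ∧ ∀ σ, KummerAt q ζ γ d σ (a.1 σ)) ?_ ?_ ?_ ?_ ?_ ?_
  · rintro a a' c c' ⟨γ, d, hγ, hd, h⟩ ⟨γ', d', hγ', hd', h'⟩
    refine ⟨γ * γ', d * d', ?_, ?_, fun σ => (h σ).add hζ.pow_eq_one (h' σ)⟩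
    · rw [mul_pow, hγ, hγ']; rfl
    · rw [Units.val_mul, map_mul, hd, hd', mul_pow]
  · rintro a c ⟨γ, d, hγ, hd, h⟩
    refine ⟨γ⁻¹, d⁻¹, ?_, ?_, fun σ => (h σ).neg hζ.pow_eq_one⟩
    · rw [inv_pow, hγ, Units.val_inv_eq_inv_val]; rfl
    · rw [inv_pow, ← hd]
      refine eq_inv_of_mul_eq_one_left ?_
      rw [← map_mul, Units.inv_mul, map_one]
  · rintro ⟨a, ha⟩
    obtain ⟨γ, d, hγ, h⟩ := exists_kummerAt_of_cocycle hq hζ ha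
    have hmem : γ ^ 3 ∈ q := pow_three_mem_of_kummerAt hζ.pow_eq_one fun σ => ⟨_, h σ⟩
    refine ⟨Units.mk0 ⟨γ ^ 3, hmem⟩ fun h0 => pow_ne_zero 3 hγ (congrArg Subtype.val h0), γ, d,
      rfl, norm_eq_pow_three_of_kummerAt hq hζ.pow_eq_one (fun σ => ⟨_, h σ⟩) rfl, h⟩
  · intro c
    rw [mk_mem_ker_normModCubes]
    constructor
    · rintro ⟨d, hd⟩
      obtain ⟨γ, hγ⟩ := IsAlgClosed.exists_pow_nat_eq ((c : q) : kbar) (n := 3) (by norm_num)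
      obtain ⟨a, ha, h⟩ := exists_cocycle_of_pow_three hq hζ c.ne_zero hγ hd
      exact ⟨⟨a, ha⟩, γ, d, hγ, hd, h⟩
    · rintro ⟨a, γ, d, hγ, hd, h⟩
      have : FiniteDimensional k q := Module.finite_of_finrank_pos (by omega)
      have hd0 : d ≠ 0 := by
        rintro rfl
        rw [zero_pow (by norm_num), Algebra.norm_eq_zero_iff] at hd
        exact c.ne_zero hd
      exact ⟨Units.mk0 d hd0, hd⟩
  · rintro a c ⟨γ, d, hγ, hd, h⟩
    rw [AddSubgroup.mem_addSubgroupOf]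
    constructor
    · intro ha
      obtain ⟨x, hx⟩ := exists_pow_three_eq_of_mem_coboundaries hq hζ h ha
      have hx0 : x ≠ 0 := by
        rintro rfl
        rw [ZeroMemClass.coe_zero, zero_pow (by norm_num)] at hx
        exact pow_ne_zero 3 (hne hγ) hx
      exact ⟨Units.mk0 x hx0, Units.ext (Subtype.ext (hx.symm.trans hγ))⟩
    · rintro ⟨x, rfl⟩
      exact mem_coboundaries_of_pow_three_eq hq hζ (hne hγ) h (x := (x : q)) (by simpa using hγ)
  · rintro _ ⟨x, rfl⟩
    exact ⟨(x : q), Algebra.norm k (x : q), by simp, by simp,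
      fun σ => kummerAt_zero_of_mem hq (x : q)⟩

end Kummer

/-! ### Extensions generated by a cube root -/

section PureCubic

variable {K Ω : Type*} [Field K] [Field Ω] [Algebra K Ω]

/-- `y` is a cube root of an element of `F` that is not a cube in `F`; equivalently, the minimal
polynomial of `y` over `F` is `X³ - y³`. -/
structure IsProperCubeRoot (F : IntermediateField K Ω) (y : Ω) : Prop where
  cube_mem : y ^ 3 ∈ F
  cube_ne : ∀ x ∈ F, x ^ 3 ≠ y ^ 3

theorem restrictScalars_adjoin_simple (F : IntermediateField K Ω) (y : Ω) :
    restrictScalars K F⟮y⟯ = F ⊔ K⟮y⟯ := by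
  rw [restrictScalars_adjoin, adjoin_union, adjoin_self]

theorem exists_aeval_eq_of_mem_sup {F : IntermediateField K Ω} {x y : Ω} {p : F[X]} (hp : p.Monic)
    (hy : aeval y p = 0) (hx : x ∈ F ⊔ K⟮y⟯) :
    ∃ r : F[X], r.natDegree < p.natDegree ∧ aeval y r = x := by
  rw [← restrictScalars_adjoin_simple] at hx
  change x ∈ F⟮y⟯ at hx
  rw [← mem_toSubalgebra, adjoin_simple_toSubalgebra_of_isAlgebraic ⟨p, hp.ne_zero, hy⟩,
    Algebra.adjoin_singleton_eq_range_aeval] at hx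
  obtain ⟨r, rfl⟩ := hx
  refine ⟨r %ₘ p, natDegree_modByMonic_lt r hp ?_, aeval_modByMonic_eq_self_of_root hy⟩
  rintro rfl
  exact one_ne_zero ((map_one (aeval (R := F) y)).symm.trans hy)

theorem compositum_eq_adjoin_simple_iff {M F : IntermediateField K Ω} {y : Ω} :
    compositum M F = F⟮y⟯ ↔ M ⊔ F = F ⊔ K⟮y⟯ := by
  rw [← restrictScalars_adjoin_simple, ← (restrictScalars_injective K).eq_iff]
  rfl

theorem minpoly_eq_X_pow_three_sub_C_iff {F : IntermediateField K Ω} {y : Ω} {g : F} :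
    minpoly F y = X ^ 3 - C g ↔ IsProperCubeRoot F y ∧ y ^ 3 = g := by
  constructor
  · intro h
    have hy : y ^ 3 = g := by
      have := minpoly.aeval F y
      rw [h] at this
      simpa [sub_eq_zero] using this
    have hint : IsIntegral F y := by
      by_contra hn
      rw [minpoly.eq_zero hn] at h
      exact (monic_X_pow_sub_C g (by norm_num : 3 ≠ 0)).ne_zero h.symm
    have hirr := minpoly.irreducible hint
    rw [h, X_pow_sub_C_irreducible_iff_of_prime Nat.prime_three] at hirr
    exact ⟨⟨hy ▸ g.2, fun x hx hxy => hirr ⟨x, hx⟩ (Subtype.ext (hxy.trans hy))⟩, hy⟩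
  · rintro ⟨hp, hy⟩
    refine (minpoly.eq_of_irreducible_of_monic ?_ (by simp [hy])
      (monic_X_pow_sub_C g (by norm_num))).symm
    rw [X_pow_sub_C_irreducible_iff_of_prime Nat.prime_three]
    exact fun b hb => hp.cube_ne b b.2 (by rw [hy, ← hb]; rfl)

theorem isDefinedByCubeRoot_iff {F : IntermediateField K Ω} {L : IntermediateField F Ω} {g : F} :
    IsDefinedByCubeRoot F L g ↔ ∃ y : Ω, IsProperCubeRoot F y ∧ y ^ 3 = g ∧ L = F⟮y⟯ := by
  constructor
  · rintro ⟨y, hy, hmin⟩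
    rw [← minpoly.algebraMap_eq (algebraMap L Ω).injective,
      minpoly_eq_X_pow_three_sub_C_iff] at hmin
    refine ⟨y, hmin.1, hmin.2, ?_⟩
    have := congrArg lift hy
    rw [lift_adjoin_simple, lift_top] at this
    exact this.symm
  · rintro ⟨y, hy, hyg, rfl⟩
    refine ⟨AdjoinSimple.gen F y, ?_, ?_⟩
    · refine lift_injective _ ?_
      rw [lift_adjoin_simple, lift_top, AdjoinSimple.coe_gen]
    · rw [← minpoly.algebraMap_eq (algebraMap F⟮y⟯ Ω).injective, AdjoinSimple.algebraMap_gen]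
      exact minpoly_eq_X_pow_three_sub_C_iff.2 ⟨hy, hyg⟩

namespace IsProperCubeRoot

variable {F : IntermediateField K Ω} {y z : Ω}

theorem minpoly_eq (hy : IsProperCubeRoot F y) : minpoly F y = X ^ 3 - C ⟨y ^ 3, hy.cube_mem⟩ :=
  minpoly_eq_X_pow_three_sub_C_iff.2 ⟨hy, rfl⟩

theorem notMem (hy : IsProperCubeRoot F y) : y ∉ F := fun h => hy.cube_ne y h rfl

theorem ne_zero (hy : IsProperCubeRoot F y) : y ≠ 0 := fun h => hy.notMem (h ▸ zero_mem F)

theorem eq_zero_of_add_eq_zero (hy : IsProperCubeRoot F y) {a b c : Ω} (ha : a ∈ F) (hb : b ∈ F)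
    (hc : c ∈ F) (h : a + b * y + c * y ^ 2 = 0) : a = 0 ∧ b = 0 ∧ c = 0 := by
  let p : F[X] := C ⟨a, ha⟩ + C ⟨b, hb⟩ * X + C ⟨c, hc⟩ * X ^ 2
  have hp : p = 0 := by
    by_contra hp
    have h1 := natDegree_le_of_dvd (minpoly.dvd F y (p := p) (by simpa [p] using h)) hp
    have h2 : p.natDegree ≤ 2 := by unfold p; compute_degree
    rw [hy.minpoly_eq, natDegree_X_pow_sub_C] at h1
    omega
  have h0 := congrArg (coeff · 0) hp
  have h1 := congrArg (coeff · 1) hp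
  have h2 := congrArg (coeff · 2) hp
  simp [p, coeff_X, coeff_C] at h0 h1 h2
  exact ⟨congrArg Subtype.val h0, congrArg Subtype.val h1, congrArg Subtype.val h2⟩

theorem mem_sup_iff (hy : IsProperCubeRoot F y) {x : Ω} :
    x ∈ F ⊔ K⟮y⟯ ↔ ∃ a ∈ F, ∃ b ∈ F, ∃ c ∈ F, x = a + b * y + c * y ^ 2 := by
  constructor
  · intro hx
    obtain ⟨r, hr, rfl⟩ := exists_aeval_eq_of_mem_sup
      (monic_X_pow_sub_C (⟨y ^ 3, hy.cube_mem⟩ : F) (by norm_num : 3 ≠ 0)) (by simp) hx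
    rw [natDegree_X_pow_sub_C] at hr
    refine ⟨r.coeff 0, SetLike.coe_mem _, r.coeff 1, SetLike.coe_mem _, r.coeff 2,
      SetLike.coe_mem _, ?_⟩
    rw [aeval_eq_sum_range' hr]
    simp only [Finset.sum_range_succ, Finset.sum_range_zero, Algebra.smul_def, zero_add, pow_zero,
      mul_one, pow_one]
    rfl
  · rintro ⟨a, ha, b, hb, c, hc, rfl⟩
    have hF : F ≤ F ⊔ K⟮y⟯ := le_sup_left
    have hy' : y ∈ F ⊔ K⟮y⟯ := (le_sup_right : K⟮y⟯ ≤ _) (mem_adjoin_simple_self K y)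
    exact add_mem (add_mem (hF ha) (mul_mem (hF hb) hy')) (mul_mem (hF hc) (pow_mem hy' 2))

/-- An element of `F(z)` whose cube is in `F` is a multiple of `1`, `z` or `z²`. No cube root of
unity in `F` is needed for this. -/
theorem eq_mul_or_eq_mul_sq (h3 : (3 : Ω) ≠ 0) (hz : IsProperCubeRoot F z) (hy3 : y ^ 3 ∈ F)
    (hy : y ∉ F) (hyz : y ∈ F ⊔ K⟮z⟯) : ∃ b ∈ F, b ≠ 0 ∧ (y = b * z ∨ y = b * z ^ 2) := by
  obtain ⟨a, ha, b, hb, c, hc, rfl⟩ := hz.mem_sup_iff.1 hyz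
  have h3F : (3 : Ω) ∈ F := by exact_mod_cast _root_.natCast_mem F 3
  have hzF := hz.cube_mem
  set w := z ^ 3 with hw
  have h6F : (6 : Ω) ∈ F := by exact_mod_cast _root_.natCast_mem F 6
  obtain ⟨-, h1, h2⟩ := hz.eq_zero_of_add_eq_zero
    (a := a ^ 3 + b ^ 3 * w + c ^ 3 * w ^ 2 + 6 * a * b * c * w - (a + b * z + c * z ^ 2) ^ 3)
    (b := 3 * (a ^ 2 * b + b ^ 2 * c * w + a * c ^ 2 * w))
    (c := 3 * (a ^ 2 * c + a * b ^ 2 + b * c ^ 2 * w))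
    (by
      refine sub_mem ?_ hy3
      apply_rules [add_mem, mul_mem, pow_mem])
    (by apply_rules [add_mem, mul_mem, pow_mem])
    (by apply_rules [add_mem, mul_mem, pow_mem])
    (by rw [hw]; ring)
  replace h1 := (mul_eq_zero.1 h1).resolve_left h3
  replace h2 := (mul_eq_zero.1 h2).resolve_left h3
  have hprod : a * (c ^ 3 * w - b ^ 3) = 0 := by linear_combination c * h1 - b * h2
  have ha0 : a = 0 := by
    rcases mul_eq_zero.1 hprod with h | h
    · exact h
    · by_cases hc0 : c = 0
      · have hb0 : b = 0 := by
          subst hc0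
          exact pow_eq_zero_iff (n := 3) (by norm_num) |>.1 (by linear_combination -h)
        exact absurd (by simpa [hb0, hc0] using ha) hy
      · refine absurd ?_ (hz.cube_ne (b / c) (div_mem hb hc))
        rw [← hw, div_pow, div_eq_iff (pow_ne_zero 3 hc0)]
        linear_combination -h
  subst ha0
  have hz0 : w ≠ 0 := pow_ne_zero 3 hz.ne_zero
  have hbc : b * c = 0 := by
    have : b ^ 2 * c * w = 0 := by linear_combination h1
    have := (mul_eq_zero.1 this).resolve_right hz0
    rcases mul_eq_zero.1 this with h | h
    · rw [pow_eq_zero_iff (by norm_num) |>.1 h, zero_mul]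
    · rw [h, mul_zero]
  rcases mul_eq_zero.1 hbc with rfl | rfl
  · refine ⟨c, hc, ?_, Or.inr (by ring)⟩
    rintro rfl
    exact hy (by simp)
  · refine ⟨b, hb, ?_, Or.inl (by ring)⟩
    rintro rfl
    exact hy (by simp)

/-- The degenerate equation `(y + h / y)² = h` forces `y ^ 6 = h ^ 3`, so that `y³` is the cube of
`y³ / h`. -/
theorem add_div_sq_ne (hy : IsProperCubeRoot F y) {h : Ω} (hh : h ∈ F) : (y + h / y) ^ 2 ≠ h := by
  intro heq
  have hy0 := hy.ne_zero
  by_cases hh0 : h = 0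
  · rw [hh0, zero_div, add_zero] at heq
    exact hy0 (pow_eq_zero_iff (by norm_num) |>.1 heq)
  refine hy.cube_ne (y ^ 3 / h) (div_mem hy.cube_mem hh) ?_
  have h1 : y ^ 4 + h * y ^ 2 + h ^ 2 = 0 := by
    field_simp at heq
    linear_combination heq
  field_simp
  linear_combination (y ^ 2 - h) * h1

theorem sup_adjoin_add_div (hy : IsProperCubeRoot F y) {h : Ω} (hh : h ∈ F) :
    F ⊔ K⟮y + h / y⟯ = F ⊔ K⟮y⟯ := by
  have hy0 := hy.ne_zero
  have hsub : (y + h / y) ^ 2 - h ≠ 0 := sub_ne_zero.2 (hy.add_div_sq_ne hh)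
  refine le_antisymm (sup_le le_sup_left ?_) (sup_le le_sup_left ?_)
  · rw [adjoin_simple_le_iff]
    have hy' : y ∈ F ⊔ K⟮y⟯ := (le_sup_right : K⟮y⟯ ≤ _) (mem_adjoin_simple_self K y)
    exact add_mem hy' (div_mem ((le_sup_left : F ≤ _) hh) hy')
  · rw [adjoin_simple_le_iff]
    have ht : y + h / y ∈ F ⊔ K⟮y + h / y⟯ :=
      (le_sup_right : K⟮y + h / y⟯ ≤ _) (mem_adjoin_simple_self K _)
    have hF : F ≤ F ⊔ K⟮y + h / y⟯ := le_sup_left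
    have hyt : y = (y ^ 3 + (y + h / y) * h) / ((y + h / y) ^ 2 - h) := by
      rw [eq_div_iff hsub]
      field_simp
      ring
    have := div_mem (add_mem (hF hy.cube_mem) (mul_mem ht (hF hh)))
      (sub_mem (pow_mem ht 2) (hF hh))
    rwa [← hyt] at this

end IsProperCubeRoot

end PureCubic

/-! ### Quadratic conjugation and the descent equation -/

section Descent

variable {K Ω : Type*} [Field K] [Field Ω] [Algebra K Ω]

theorem eq_adjoin_simple_of_finrank_three {M : IntermediateField K Ω}
    (hM : Module.finrank K M = 3) {z : Ω} (hz : z ∈ M) (hz' : z ∉ (⊥ : IntermediateField K Ω)) :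
    M = K⟮z⟯ := by
  have hle : K⟮z⟯ ≤ M := (adjoin_simple_le_iff).2 hz
  have : FiniteDimensional K M := Module.finite_of_finrank_pos (by omega)
  have hdvd := finrank_dvd_of_le_right hle
  rw [hM, Nat.dvd_prime Nat.prime_three] at hdvd
  rcases hdvd with h | h
  · rw [IntermediateField.finrank_eq_one_iff, adjoin_simple_eq_bot_iff] at h
    exact absurd h hz'
  · exact (eq_of_le_of_finrank_eq hle (h.trans hM.symm)).symm

theorem map_eq_of_mem_adjoin_simple {α x : Ω} {σ τ : Ω ≃ₐ[K] Ω} (h : σ α = τ α) (hx : x ∈ K⟮α⟯) :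
    σ x = τ x := by
  have h1 : τ⁻¹ * σ ∈ (K⟮α⟯).fixingSubgroup := by
    rw [mem_fixingSubgroup_adjoin_simple, AlgEquiv.mul_apply, h]
    exact τ.symm_apply_apply α
  have h2 := congrArg τ ((IntermediateField.mem_fixingSubgroup_iff _ _).1 h1 x hx)
  rw [AlgEquiv.mul_apply] at h2
  exact (τ.apply_symm_apply (σ x)).symm.trans h2

/-- A separable element that is fixed by all automorphisms over `F` lies in `F`. -/
theorem mem_of_isSeparable_of_forall_fixed [Normal K Ω] {F : IntermediateField K Ω} {x : Ω}
    (hx : IsSeparable K x) (h : ∀ σ : Ω ≃ₐ[K] Ω, (∀ y ∈ F, σ y = y) → σ x = x) : x ∈ F := by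
  have hsep : (minpoly F x).Separable := IsSeparable.tower_top F hx
  have hint : IsIntegral F x := hx.isIntegral.tower_top
  have hroots : ∀ y ∈ (minpoly F x).aroots Ω, y = x := fun y hy => by
    rw [mem_aroots] at hy
    obtain ⟨σ, rfl⟩ := minpoly.exists_algEquiv_of_root' hint.isAlgebraic hy.2
    exact h (σ.restrictScalars K) fun z hz => σ.commutes ⟨z, hz⟩
  have hsplit := (inferInstance : Normal F Ω).splits x
  have hnd := (nodup_aroots_iff_of_splits (minpoly.ne_zero hint) hsplit).2 hsep
  have hcard : Multiset.card ((minpoly F x).aroots Ω) ≤ 1 := by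
    classical
    rw [← Multiset.toFinset_card_of_nodup hnd, Finset.card_le_one]
    exact fun y hy z hz =>
      (hroots y (Multiset.mem_toFinset.1 hy)).trans (hroots z (Multiset.mem_toFinset.1 hz)).symm
  have hdeg : (minpoly F x).natDegree = Multiset.card ((minpoly F x).aroots Ω) := by
    rw [← natDegree_map (algebraMap F Ω), hsplit.natDegree_eq_card_roots]
  have h1 : (minpoly F x).natDegree = 1 := by
    have := minpoly.natDegree_pos hint
    omega
  obtain ⟨y, rfl⟩ := minpoly.natDegree_eq_one_iff.1 h1
  exact y.2

/-- `α` and `α'` are the two conjugates of a generator of a separable quadratic extension. -/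
structure IsQuadraticPair (F : IntermediateField K Ω) (α α' : Ω) : Prop where
  ne : α ≠ α'
  sum_mem : α + α' ∈ F
  prod_mem : α * α' ∈ F
  notMem : α ∉ F

/-- `σ` induces on `F'` an involution with fixed field `F`. -/
structure IsConjugation (F F' : IntermediateField K Ω) (σ : Ω ≃ₐ[K] Ω) : Prop where
  fixes : ∀ x ∈ F, σ x = x
  map_mem : ∀ x ∈ F', σ x ∈ F'
  involutive : ∀ x ∈ F', σ (σ x) = x
  mem_of_fixed : ∀ x ∈ F', σ x = x → x ∈ F

theorem IsConjugation.mul_map_mem {F F' : IntermediateField K Ω} {σ : Ω ≃ₐ[K] Ω}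
    (h : IsConjugation F F' σ) {x : Ω} (hx : x ∈ F') : x * σ x ∈ F :=
  h.mem_of_fixed _ (mul_mem hx (h.map_mem x hx)) (by
    rw [map_mul, h.involutive x hx, mul_comm])

namespace IsQuadraticPair

variable {F : IntermediateField K Ω} {α α' : Ω}

theorem mono {F₁ : IntermediateField K Ω} (h : IsQuadraticPair F α α') (hle : F ≤ F₁)
    (hα : α ∉ F₁) : IsQuadraticPair F₁ α α' :=
  ⟨h.ne, hle h.sum_mem, hle h.prod_mem, hα⟩

/-- The quadratic polynomial with roots `α` and `α'`. -/
def poly (h : IsQuadraticPair F α α') : F[X] :=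
  X ^ 2 - C ⟨α + α', h.sum_mem⟩ * X + C ⟨α * α', h.prod_mem⟩

theorem poly_monic (h : IsQuadraticPair F α α') : h.poly.Monic := by
  unfold poly; monicity!

theorem poly_natDegree (h : IsQuadraticPair F α α') : h.poly.natDegree = 2 := by
  unfold poly; compute_degree!

theorem aeval_poly (h : IsQuadraticPair F α α') (x : Ω) :
    aeval x h.poly = (x - α) * (x - α') := by
  simp [poly]
  ring

theorem isIntegral (h : IsQuadraticPair F α α') : IsIntegral F α :=
  ⟨h.poly, h.poly_monic, by
    have := h.aeval_poly α
    rwa [sub_self, zero_mul] at this⟩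

theorem minpoly_eq (h : IsQuadraticPair F α α') : minpoly F α = h.poly := by
  refine (eq_of_monic_of_dvd_of_natDegree_le (minpoly.monic h.isIntegral) h.poly_monic
    (minpoly.dvd _ _ (by rw [aeval_poly, sub_self, zero_mul])) ?_).symm
  rw [poly_natDegree, minpoly.two_le_natDegree_iff h.isIntegral]
  rintro ⟨x, rfl⟩
  exact h.notMem x.2

theorem exists_conj [Normal K Ω] (h : IsQuadraticPair F α α') :
    ∃ σ : Ω ≃ₐ[K] Ω, (∀ x ∈ F, σ x = x) ∧ σ α = α' := by
  obtain ⟨σ, hσ⟩ := minpoly.exists_algEquiv_of_root' (K := F) (x := α') (y := α)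
    h.isIntegral.isAlgebraic (by rw [h.minpoly_eq, aeval_poly, sub_self, mul_zero])
  exact ⟨σ.restrictScalars K, fun x hx => σ.commutes ⟨x, hx⟩, hσ⟩

theorem exists_eq_of_mem_sup (h : IsQuadraticPair F α α') {x : Ω} (hx : x ∈ F ⊔ K⟮α⟯) :
    ∃ a ∈ F, ∃ b ∈ F, x = a + b * α := by
  obtain ⟨r, hr, rfl⟩ := exists_aeval_eq_of_mem_sup h.poly_monic
    (by rw [h.aeval_poly, sub_self, zero_mul]) hx
  rw [h.poly_natDegree] at hr
  refine ⟨r.coeff 0, SetLike.coe_mem _, r.coeff 1, SetLike.coe_mem _, ?_⟩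
  rw [aeval_eq_sum_range' hr]
  simp only [Finset.sum_range_succ, Finset.sum_range_zero, Algebra.smul_def, zero_add, pow_zero,
    mul_one, pow_one]
  rfl

theorem isConjugation (h : IsQuadraticPair F α α') {σ : Ω ≃ₐ[K] Ω} (hσ : ∀ x ∈ F, σ x = x)
    (hα : σ α = α') : IsConjugation F (F ⊔ K⟮α⟯) σ := by
  have hα' : σ α' = α := by
    have := hσ _ h.sum_mem
    rw [map_add, hα] at this
    linear_combination this
  have hmem : α ∈ F ⊔ K⟮α⟯ := (le_sup_right : K⟮α⟯ ≤ _) (mem_adjoin_simple_self K α)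
  have hF : F ≤ F ⊔ K⟮α⟯ := le_sup_left
  have hmem' : α' ∈ F ⊔ K⟮α⟯ := by
    have := sub_mem (hF h.sum_mem) hmem
    rwa [add_sub_cancel_left] at this
  refine ⟨hσ, fun x hx => ?_, fun x hx => ?_, fun x hx hfix => ?_⟩ <;>
    obtain ⟨a, ha, b, hb, rfl⟩ := h.exists_eq_of_mem_sup hx
  · rw [map_add, map_mul, hσ a ha, hσ b hb, hα]
    exact add_mem (hF ha) (mul_mem (hF hb) hmem')
  · simp only [map_add, map_mul, hσ a ha, hσ b hb, hα, hα']
  · rw [map_add, map_mul, hσ a ha, hσ b hb, hα] at hfix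
    have : b * (α' - α) = 0 := by linear_combination hfix
    rcases mul_eq_zero.1 this with rfl | h0
    · simpa using ha
    · exact absurd (sub_eq_zero.1 h0).symm h.ne

theorem finrank_eq (h : IsQuadraticPair (⊥ : IntermediateField K Ω) α α') :
    Module.finrank K K⟮α⟯ = 2 := by
  obtain ⟨T, hT⟩ := mem_bot.1 h.sum_mem
  obtain ⟨N, hN⟩ := mem_bot.1 h.prod_mem
  have hmon : (X ^ 2 - C T * X + C N : K[X]).Monic := by monicity!
  have hroot : aeval α (X ^ 2 - C T * X + C N : K[X]) = 0 := by
    simp [hT, hN]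
    ring
  have hint : IsIntegral K α := ⟨_, hmon, hroot⟩
  rw [adjoin.finrank hint]
  refine le_antisymm ?_ ((minpoly.two_le_natDegree_iff hint).2 fun h0 => h.notMem (mem_bot.2 h0))
  refine (natDegree_le_of_dvd (minpoly.dvd _ _ hroot) hmon.ne_zero).trans ?_
  compute_degree

theorem notMem_of_finrank_three (h : IsQuadraticPair (⊥ : IntermediateField K Ω) α α')
    {M : IntermediateField K Ω} (hM : Module.finrank K M = 3) : α ∉ M := by
  intro hα
  have := finrank_dvd_of_le_right (adjoin_simple_le_iff.2 hα)
  rw [hM, h.finrank_eq] at this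
  omega

end IsQuadraticPair

/-- The roots of the cubic polynomial `X³ - 3vwX - (v³ + w³)`. -/
theorem exists_eq_mul_add_of_cubic_eq {ζ : Ω} (hζ : ζ ^ 2 + ζ + 1 = 0) {v w r : Ω}
    (hr : r ^ 3 - 3 * (v * w) * r = v ^ 3 + w ^ 3) :
    ∃ ω, ω ^ 3 = 1 ∧ r = ω * v + ω ^ 2 * w := by
  have hζ3 : ζ ^ 3 = 1 := by linear_combination (ζ - 1) * hζ
  have hprod : (r - (v + w)) * ((r - (ζ * v + ζ ^ 2 * w)) * (r - (ζ ^ 2 * v + ζ * w))) = 0 := by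
    have h1 : (r - (ζ * v + ζ ^ 2 * w)) * (r - (ζ ^ 2 * v + ζ * w)) =
        r ^ 2 + r * (v + w) + v ^ 2 + w ^ 2 - v * w := by
      linear_combination (-r * (v + w) + (ζ - 1) * (v ^ 2 + w ^ 2) + v * w * (ζ ^ 2 - ζ + 1)) * hζ
    rw [h1]
    linear_combination hr
  rcases mul_eq_zero.1 hprod with h1 | h1
  · exact ⟨1, one_pow 3, by linear_combination h1⟩
  rcases mul_eq_zero.1 h1 with h1 | h1
  · exact ⟨ζ, hζ3, by linear_combination h1⟩
  · refine ⟨ζ ^ 2, by rw [pow_right_comm, hζ3, one_pow], ?_⟩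
    linear_combination h1 - ζ * w * hζ3

theorem exists_cube_eq_of_cubic_eq {ζ : Ω} (hζ : ζ ^ 2 + ζ + 1 = 0) {y h r : Ω} (hy : y ≠ 0)
    (hr : r ^ 3 - 3 * h * r = y ^ 3 + h ^ 3 / y ^ 3) : ∃ u, u ^ 3 = y ^ 3 ∧ r = u + h / u := by
  obtain ⟨ω, hω, rfl⟩ := exists_eq_mul_add_of_cubic_eq hζ (v := y) (w := h / y) (r := r) (by
    rw [mul_div_cancel₀ _ hy, hr, div_pow])
  have hω0 : ω ≠ 0 := by rintro rfl; norm_num at hω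
  refine ⟨ω * y, by rw [mul_pow, hω, one_mul], ?_⟩
  field_simp
  linear_combination h * hω

theorem IsProperCubeRoot.of_cube_eq {F : IntermediateField K Ω} {y u : Ω}
    (hy : IsProperCubeRoot F y) (h : u ^ 3 = y ^ 3) : IsProperCubeRoot F u :=
  ⟨h ▸ hy.cube_mem, h ▸ hy.cube_ne⟩

section Equation

variable {α α' : Ω} (hα : IsQuadraticPair (⊥ : IntermediateField K Ω) α α') {s : Ω ≃ₐ[K] Ω}
  (hs : s α = α') {y h : Ω} (hy : IsProperCubeRoot K⟮α⟯ y) (hh : h ∈ (⊥ : IntermediateField K Ω))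
  (hyh : y ^ 3 * s (y ^ 3) = h ^ 3)
include hα hs

theorem isConjugation_adjoin : IsConjugation ⊥ K⟮α⟯ s := by
  have := hα.isConjugation (σ := s) (fun x hx => by
    obtain ⟨x, rfl⟩ := mem_bot.1 hx
    exact s.commutes x) hs
  rwa [bot_sup_eq] at this

include hy hh hyh

/-- The minimal polynomial of `y + h / y` over the base field. -/
theorem exists_minpoly_add_div {ζ : Ω} (hζ : ζ ^ 2 + ζ + 1 = 0) :
    ∃ H S : K, algebraMap K Ω H = h ∧ algebraMap K Ω S = y ^ 3 + h ^ 3 / y ^ 3 ∧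
      minpoly K (y + h / y) = X ^ 3 - C (3 * H) * X - C S := by
  have hconj := isConjugation_adjoin hα hs
  have hy0 := hy.ne_zero
  obtain ⟨H, hH⟩ := mem_bot.1 hh
  have hsy : h ^ 3 / y ^ 3 = s (y ^ 3) := by
    rw [← hyh, mul_div_cancel_left₀ _ (pow_ne_zero 3 hy0)]
  obtain ⟨S, hS⟩ : ∃ S, algebraMap K Ω S = y ^ 3 + h ^ 3 / y ^ 3 := by
    refine mem_bot.1 (hconj.mem_of_fixed _ ?_ ?_) <;> rw [hsy]
    · exact add_mem hy.cube_mem (hconj.map_mem _ hy.cube_mem)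
    · rw [map_add, hconj.involutive _ hy.cube_mem, add_comm]
  refine ⟨H, S, hH, hS, ?_⟩
  have hdeg : (X ^ 3 - C (3 * H) * X - C S : K[X]).natDegree = 3 := by compute_degree!
  have hmon : (X ^ 3 - C (3 * H) * X - C S : K[X]).Monic := by monicity!
  have hroot : aeval (y + h / y) (X ^ 3 - C (3 * H) * X - C S : K[X]) = 0 := by
    simp [hH, hS, map_ofNat]
    field_simp
    ring
  refine (minpoly.eq_of_irreducible_of_monic ?_ hroot hmon).symm
  refine irreducible_of_degree_le_three_of_not_isRoot (by rw [hdeg]; decide) fun r hr => ?_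
  -- a root in `K` would make the extension generated by `y` trivial
  have hr' : (algebraMap K Ω r) ^ 3 - 3 * h * algebraMap K Ω r = y ^ 3 + h ^ 3 / y ^ 3 := by
    have := congrArg (algebraMap K Ω) hr
    simp [hH, hS, map_ofNat] at this
    linear_combination this
  obtain ⟨u, hu, hru⟩ := exists_cube_eq_of_cubic_eq hζ hy0 hr'
  have hu' := hy.of_cube_eq hu
  have h1 := hu'.sup_adjoin_add_div ((bot_le : ⊥ ≤ K⟮α⟯) hh)
  rw [← hru] at h1
  have h2 : K⟮algebraMap K Ω r⟯ = ⊥ :=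
    adjoin_simple_eq_bot_iff.2 ((⊥ : IntermediateField K Ω).algebraMap_mem r)
  rw [h2, sup_bot_eq] at h1
  exact hu'.notMem (h1 ▸ (le_sup_right : K⟮u⟯ ≤ _) (mem_adjoin_simple_self K u))

theorem finrank_adjoin_add_div {ζ : Ω} (hζ : ζ ^ 2 + ζ + 1 = 0) :
    Module.finrank K K⟮y + h / y⟯ = 3 := by
  obtain ⟨H, S, -, -, hmin⟩ := exists_minpoly_add_div hα hs hy hh hyh hζ
  have hdeg : (X ^ 3 - C (3 * H) * X - C S : K[X]).natDegree = 3 := by compute_degree!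
  rw [adjoin.finrank, hmin, hdeg]
  by_contra hn
  rw [minpoly.eq_zero hn] at hmin
  rw [← hmin, natDegree_zero] at hdeg
  omega

theorem isSeparable_adjoin_add_div {ζ : Ω} (hζ : ζ ^ 2 + ζ + 1 = 0) (h3 : (3 : K) ≠ 0) :
    Algebra.IsSeparable K K⟮y + h / y⟯ := by
  have hfin := finrank_adjoin_add_div hα hs hy hh hyh hζ
  obtain ⟨H, S, -, -, hmin⟩ := exists_minpoly_add_div hα hs hy hh hyh hζ
  have : FiniteDimensional K K⟮y + h / y⟯ := Module.finite_of_finrank_pos (by omega)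
  have hint : IsIntegral K (y + h / y) :=
    (AdjoinSimple.isIntegral_gen K _).1 (IsIntegral.of_finite K _)
  rw [isSeparable_adjoin_simple_iff_isSeparable, IsSeparable,
    separable_iff_derivative_ne_zero (minpoly.irreducible hint), hmin]
  intro h0
  have := congrArg (coeff · 2) h0
  simp only [coeff_derivative] at this
  simp at this
  exact h3 (by linear_combination this)

/-- Every extension `F` of `K` over which the cubic extension generated by `y + h / y` becomes
purely cubic contains the quadratic extension. Otherwise, `y` is a multiple of `z` or `z²` for a
cube root `z` of an element of `F`, and taking norms down to `F` in the equation `y³ s(y³) = h³`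
shows that this element of `F` is a cube. -/
theorem adjoin_le_of_purelyCubic [Normal K Ω] (h3 : (3 : Ω) ≠ 0) {F : IntermediateField K Ω} {z : Ω}
    (hz : IsProperCubeRoot F z) (hFz : K⟮y + h / y⟯ ⊔ F = F ⊔ K⟮z⟯) : K⟮α⟯ ≤ F := by
  rw [adjoin_simple_le_iff]
  by_contra hαF
  have hpair := hα.mono bot_le hαF
  obtain ⟨σ, hσF, hσα⟩ := hpair.exists_conj
  have hconj := hpair.isConjugation hσF hσα
  have hF : F ≤ F ⊔ K⟮α⟯ := le_sup_left
  have hα' : K⟮α⟯ ≤ F ⊔ K⟮α⟯ := le_sup_right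
  have hσz := hσF _ hz.cube_mem
  have hz0 := hz.ne_zero
  have hy0 := hy.ne_zero
  have hσz' : σ z ^ 3 = z ^ 3 := by rw [← map_pow, hσz]
  have hhy : h ∈ F ⊔ K⟮α⟯ := hα' ((bot_le : ⊥ ≤ K⟮α⟯) hh)
  have hhF : h ∈ F := (bot_le : ⊥ ≤ F) hh
  have hh0 : h ≠ 0 := by
    rintro rfl
    rw [zero_pow (by norm_num)] at hyh
    rcases mul_eq_zero.1 hyh with h0 | h0
    · exact hy0 (pow_eq_zero_iff (by norm_num) |>.1 h0)
    · exact hy0 (pow_eq_zero_iff (by norm_num) |>.1 ((map_eq_zero s).1 h0))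
  have hz' : IsProperCubeRoot (F ⊔ K⟮α⟯) z := by
    refine ⟨hF hz.cube_mem, fun x hx hxz => ?_⟩
    have hN := hconj.mul_map_mem hx
    have hx0 : x ≠ 0 := by
      rintro rfl
      rw [zero_pow (by norm_num)] at hxz
      exact pow_ne_zero 3 hz0 hxz.symm
    have hN3 : (x * σ x) ^ 3 = (z ^ 3) ^ 2 := by
      rw [mul_pow, ← map_pow, hxz, hσz, sq]
    refine hz.cube_ne _ (div_mem hz.cube_mem hN) ?_
    rw [div_pow, hN3, div_eq_iff (pow_ne_zero 2 (pow_ne_zero 3 hz0))]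
    ring
  have hynotMem : y ∉ F ⊔ K⟮α⟯ := fun hyF => by
    have h1 : K⟮y + h / y⟯ ≤ F ⊔ K⟮α⟯ :=
      adjoin_simple_le_iff.2 (add_mem hyF (div_mem hhy hyF))
    have h2 : F ⊔ K⟮z⟯ ≤ F ⊔ K⟮α⟯ := hFz ▸ sup_le h1 hF
    exact hz'.notMem (h2 ((le_sup_right : K⟮z⟯ ≤ _) (mem_adjoin_simple_self K z)))
  have hymem : y ∈ (F ⊔ K⟮α⟯) ⊔ K⟮z⟯ := by
    have h1 : y ∈ K⟮α⟯ ⊔ K⟮y + h / y⟯ := by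
      rw [hy.sup_adjoin_add_div ((bot_le : ⊥ ≤ K⟮α⟯) hh)]
      exact (le_sup_right : K⟮y⟯ ≤ _) (mem_adjoin_simple_self K y)
    have h2 : K⟮y + h / y⟯ ≤ F ⊔ K⟮z⟯ := hFz ▸ le_sup_left
    exact (sup_le (hα'.trans le_sup_left) (h2.trans (sup_le_sup_right hF _)) :
      K⟮α⟯ ⊔ K⟮y + h / y⟯ ≤ _) h1
  obtain ⟨b, hb, hb0, hyb⟩ := hz'.eq_mul_or_eq_mul_sq h3 (hα' hy.cube_mem) hynotMem hymem
  have hNb := hconj.mul_map_mem hb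
  have hNb0 : b * σ b ≠ 0 := mul_ne_zero hb0 ((map_ne_zero σ).2 hb0)
  rw [← map_eq_of_mem_adjoin_simple (hσα.trans hs.symm) hy.cube_mem] at hyh
  rcases hyb with hyb | hyb
  · have h1 : (b * σ b) ^ 3 * (z ^ 3) ^ 2 = h ^ 3 := by
      rw [← hyh, hyb, map_pow, map_mul]
      linear_combination (-(b ^ 3 * σ b ^ 3 * z ^ 3)) * hσz'
    refine hz.cube_ne (z ^ 3 * (b * σ b) / h) (div_mem (mul_mem hz.cube_mem hNb) hhF) ?_
    rw [div_pow, div_eq_iff (pow_ne_zero 3 hh0), ← h1]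
    ring
  · have h1 : (b * σ b) ^ 3 * (z ^ 3) ^ 4 = h ^ 3 := by
      rw [← hyh, hyb, map_pow, map_mul, map_pow]
      linear_combination (-(b ^ 3 * σ b ^ 3 * z ^ 6) * (σ z ^ 3 + z ^ 3)) * hσz'
    refine hz.cube_ne (h / ((b * σ b) * z ^ 3)) (div_mem hhF (mul_mem hNb hz.cube_mem)) ?_
    rw [div_pow, ← h1, div_eq_iff (pow_ne_zero 3 (mul_ne_zero hNb0 (pow_ne_zero 3 hz0)))]
    ring

omit hh hyh in
/-- A cubic extension that becomes purely cubic over the quadratic extension, but is not purely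
cubic itself, is given by the descent equation: the conjugation `σ` over `M` maps `y` to `b y` or
to `b y²`. In the first case, `b` has norm `1` and a multiple of `y` is invariant under `σ`, so that
`M` is purely cubic. -/
theorem exists_eq_adjoin_add_div [Normal K Ω] (h3 : (3 : Ω) ≠ 0) {M : IntermediateField K Ω}
    (hM : Module.finrank K M = 3) (hMy : M ⊔ K⟮α⟯ = K⟮α⟯ ⊔ K⟮y⟯)
    (hnot : ∀ z, IsProperCubeRoot (⊥ : IntermediateField K Ω) z → M ≠ K⟮z⟯) :
    ∃ h ∈ (⊥ : IntermediateField K Ω), y ^ 3 * s (y ^ 3) = h ^ 3 ∧ M = K⟮y + h / y⟯ := by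
  have hpair := hα.mono bot_le (hα.notMem_of_finrank_three hM)
  obtain ⟨σ, hσM, hσα⟩ := hpair.exists_conj
  have hconj := hpair.isConjugation hσM hσα
  have hconj' := isConjugation_adjoin hα hσα
  have hy0 := hy.ne_zero
  have hα' : K⟮α⟯ ≤ M ⊔ K⟮α⟯ := le_sup_right
  have hyM : y ∈ M ⊔ K⟮α⟯ :=
    hMy ▸ (le_sup_right : K⟮y⟯ ≤ _) (mem_adjoin_simple_self K y)
  have hσσy := hconj.involutive y hyM
  have hσy : σ y ∉ K⟮α⟯ := fun h => hy.notMem (hσσy ▸ hconj'.map_mem _ h)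
  obtain ⟨b, hb, hb0, hyb⟩ := hy.eq_mul_or_eq_mul_sq h3
    (by rw [← map_pow]; exact hconj'.map_mem _ hy.cube_mem) hσy (hMy ▸ hconj.map_mem y hyM)
  rcases hyb with hyb | hyb
  · exfalso
    have hNb : b * σ b = 1 := by
      rw [hyb, map_mul, hyb] at hσσy
      exact mul_right_cancel₀ hy0 (by linear_combination hσσy)
    obtain ⟨e, he, he0, hσe⟩ : ∃ e ∈ K⟮α⟯, e ≠ 0 ∧ σ e * b = e := by
      have hαmem := mem_adjoin_simple_self K α
      have key : ∀ w ∈ K⟮α⟯, w + b * σ w ∈ K⟮α⟯ ∧ σ (w + b * σ w) * b = w + b * σ w := by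
        intro w hw
        refine ⟨add_mem hw (mul_mem hb (hconj'.map_mem w hw)), ?_⟩
        rw [map_add, map_mul, hconj'.involutive w hw]
        linear_combination w * hNb
      by_cases h1 : 1 + b * σ 1 = 0
      · refine ⟨α + b * σ α, (key α hαmem).1, ?_, (key α hαmem).2⟩
        have hb1 : b = -1 := by rw [map_one] at h1; linear_combination h1
        rw [hb1, hσα, neg_one_mul, ← sub_eq_add_neg]
        exact sub_ne_zero.2 hα.ne
      · exact ⟨_, (key 1 (one_mem _)).1, h1, (key 1 (one_mem _)).2⟩
    have hz : e * y ∈ M := hconj.mem_of_fixed _ (mul_mem (hα' he) hyM) (by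
      rw [map_mul, hyb]
      linear_combination y * hσe)
    have hz3 : (e * y) ^ 3 ∈ K⟮α⟯ := by
      rw [mul_pow]
      exact mul_mem (pow_mem he 3) hy.cube_mem
    have hzp : IsProperCubeRoot (⊥ : IntermediateField K Ω) (e * y) := by
      refine ⟨hconj'.mem_of_fixed _ hz3 (hσM _ (pow_mem hz 3)), fun x hx hxe => ?_⟩
      refine hy.cube_ne (x / e) (div_mem ((bot_le : ⊥ ≤ K⟮α⟯) hx) he) ?_
      rw [div_pow, hxe, mul_pow, mul_div_cancel_left₀ _ (pow_ne_zero 3 he0)]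
    exact hnot _ hzp (eq_adjoin_simple_of_finrank_three hM hz hzp.notMem)
  · have hσy : σ y = b * y ^ 3 / y := by
      rw [hyb]
      field_simp
    have hmem : b * y ^ 3 ∈ K⟮α⟯ := mul_mem hb hy.cube_mem
    have hprod : b * y ^ 3 = y * σ y := by rw [hyb]; ring
    have hσh : σ (b * y ^ 3) = b * y ^ 3 := by
      rw [hprod, map_mul, hσσy, mul_comm]
    have hbot := hconj'.mem_of_fixed _ hmem hσh
    refine ⟨b * y ^ 3, hbot, ?_, ?_⟩
    · rw [← map_eq_of_mem_adjoin_simple (hσα.trans hs.symm) hy.cube_mem, map_pow, hprod, mul_pow]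
    · refine eq_adjoin_simple_of_finrank_three hM (hconj.mem_of_fixed _ ?_ ?_) fun h0 => ?_
      · exact add_mem hyM (div_mem (hα' hmem) hyM)
      · rw [← hσy, map_add, hσσy, add_comm]
      · have h1 := hy.sup_adjoin_add_div hmem
        have h2 : K⟮y + b * y ^ 3 / y⟯ = ⊥ := adjoin_simple_eq_bot_iff.2 h0
        rw [h2, sup_bot_eq] at h1
        exact hy.notMem (h1 ▸ (le_sup_right : K⟮y⟯ ≤ _) (mem_adjoin_simple_self K y))

end Equation

end Descent

/-! ### Constant extensions of a function field -/

section ConstantExtension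

variable {k kbar K Ω : Type*} [Field k] [Field kbar] [Algebra k kbar] [Field K] [Algebra k K]
  [Field Ω] [Algebra K Ω] [Algebra kbar Ω]

section

omit [Algebra k K]

theorem algebraMap_mem_constExt {l : IntermediateField k kbar} {x : kbar} (hx : x ∈ l) :
    algebraMap kbar Ω x ∈ constExt K Ω l :=
  subset_adjoin K _ ⟨x, hx, rfl⟩

theorem constExt_mono {l m : IntermediateField k kbar} (h : l ≤ m) :
    constExt K Ω l ≤ constExt K Ω m :=
  adjoin.mono K _ _ (Set.image_mono h)

end

variable [Algebra k Ω] [IsScalarTower k K Ω] [IsScalarTower k kbar Ω]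

theorem constExt_adjoin_simple (x : kbar) :
    constExt K Ω k⟮x⟯ = K⟮algebraMap kbar Ω x⟯ := by
  refine le_antisymm (adjoin_le_iff.2 ?_) (adjoin_simple_le_iff.2
    (algebraMap_mem_constExt (mem_adjoin_simple_self k x)))
  rintro _ ⟨y, hy, rfl⟩
  have : k⟮x⟯ ≤ IntermediateField.comap (IsScalarTower.toAlgHom k kbar Ω)
      (restrictScalars k K⟮algebraMap kbar Ω x⟯) :=
    adjoin_simple_le_iff.2 (mem_adjoin_simple_self K (algebraMap kbar Ω x))
  exact this hy

/-- The restriction to `k̄` of an automorphism of `Ω / K`. -/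
def restrictConst (kbar : Type*) [Field kbar] [Algebra k kbar]
    [IsAlgClosure k kbar] [Algebra kbar Ω] [IsScalarTower k kbar Ω] (σ : Ω ≃ₐ[K] Ω) :
    Gal(kbar/k) :=
  (σ.restrictScalars k).restrictNormal kbar

variable [IsAlgClosure k kbar]

theorem algebraMap_restrictConst (σ : Ω ≃ₐ[K] Ω) (x : kbar) :
    algebraMap kbar Ω (restrictConst (k := k) kbar σ x) = σ (algebraMap kbar Ω x) :=
  AlgEquiv.restrictNormal_commutes (σ.restrictScalars k) kbar x

section ConstantField

theorem exists_algebraMap_eq_of_mem_bot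
    (hK : ∀ x : K, IsAlgebraic k x → x ∈ (algebraMap k K).range) {x : kbar}
    (hx : algebraMap kbar Ω x ∈ (⊥ : IntermediateField K Ω)) : ∃ y, algebraMap k kbar y = x := by
  obtain ⟨y, hy⟩ := mem_bot.1 hx
  have h1 : IsAlgebraic k (algebraMap K Ω y) := by
    rw [hy]
    exact (Algebra.IsAlgebraic.isAlgebraic x).algebraMap
  obtain ⟨z, rfl⟩ := hK y ((isAlgebraic_algebraMap_iff (algebraMap K Ω).injective).1 h1)
  refine ⟨z, (algebraMap kbar Ω).injective ?_⟩
  rw [← hy, ← IsScalarTower.algebraMap_apply, ← IsScalarTower.algebraMap_apply]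

theorem natDegree_minpoly_algebraMap
    (hK : ∀ x : K, IsAlgebraic k x → x ∈ (algebraMap k K).range) (x : kbar) :
    (minpoly K (algebraMap kbar Ω x)).natDegree = (minpoly k x).natDegree := by
  have hint : IsIntegral k (algebraMap kbar Ω x) :=
    (Algebra.IsIntegral.isIntegral (R := k) x).algebraMap
  have hlift : minpoly K (algebraMap kbar Ω x) ∈ lifts (algebraMap k K) := by
    rw [lifts_iff_coeff_lifts]
    intro n
    obtain ⟨y, hy⟩ := (lifts_iff_coeff_lifts _).1 (integralClosure.mem_lifts_of_monic_of_dvd_map K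
      (minpoly.monic hint) (minpoly.monic hint.tower_top)
      (minpoly.dvd_map_of_isScalarTower k K (algebraMap kbar Ω x))) n
    exact hK _ (hy ▸ y.2.isAlgebraic)
  rw [← minpoly.map_algebraMap hint hlift, natDegree_map,
    minpoly.algebraMap_eq (algebraMap kbar Ω).injective]

variable [PerfectField k]

variable (k K Ω) in
include k in
theorem isSeparable_const (x : kbar) : IsSeparable K (algebraMap kbar Ω x) := by
  have h1 : IsSeparable k x := Algebra.IsSeparable.isSeparable k x
  exact (h1.map (IsScalarTower.toAlgHom k kbar Ω) (algebraMap kbar Ω).injective).tower_top K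

theorem isSeparable_of_mem_constExt {l : IntermediateField k kbar} {x : Ω}
    (hx : x ∈ constExt K Ω l) : IsSeparable K x := by
  have h1 : constExt K Ω l ≤ separableClosure K Ω := adjoin_le_iff.2 <| by
    rintro _ ⟨z, -, rfl⟩
    exact mem_separableClosure_iff.2 (isSeparable_const k K Ω z)
  exact mem_separableClosure_iff.1 (h1 hx)

theorem mem_span_of_mem_constExt {l : IntermediateField k kbar} {x : Ω} (hx : x ∈ constExt K Ω l) :
    x ∈ Submodule.span kbar (Set.range (algebraMap K Ω)) := by
  have h1 : x ∈ Algebra.adjoin K (algebraMap kbar Ω '' (l : Set kbar)) := by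
    rw [← adjoin_toSubalgebra_of_isAlgebraic]
    · exact hx
    · rintro _ ⟨z, -, rfl⟩
      exact (isSeparable_const k K Ω z).isIntegral.isAlgebraic
  have h2 : x ∈ Algebra.adjoin kbar (Set.range (algebraMap K Ω)) := by
    clear hx
    induction h1 using Algebra.adjoin_induction with
    | mem y hy =>
      obtain ⟨z, -, rfl⟩ := hy
      exact Subalgebra.algebraMap_mem _ z
    | algebraMap r => exact Algebra.subset_adjoin ⟨r, rfl⟩
    | add y z _ _ hy hz => exact add_mem hy hz
    | mul y z _ _ hy hz => exact mul_mem hy hz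
  have h3 : Submonoid.closure (Set.range (algebraMap K Ω)) =
      MonoidHom.mrange (algebraMap K Ω : K →* Ω) :=
    Submonoid.closure_eq (MonoidHom.mrange (algebraMap K Ω : K →* Ω))
  rw [← Subalgebra.mem_toSubmodule, Algebra.adjoin_eq_span, h3] at h2
  exact h2

variable [Normal K Ω]

variable (hK : ∀ x : K, IsAlgebraic k x → x ∈ (algebraMap k K).range)
include hK

/-- A linear relation with coefficients in `k̄` between elements of `K` that are linearly
independent over `k` is trivial: in a relation of minimal length with one coefficient equal to
`1`, all coefficients are invariant under the automorphisms of `Ω / K`, hence in `k`. -/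
theorem linearIndependent_algebraMap {ι : Type*} {v : ι → K} (hv : LinearIndependent k v) :
    LinearIndependent kbar (fun i => algebraMap K Ω (v i)) := by
  classical
  rw [linearIndependent_iff']
  intro S
  induction S using Finset.induction_on with
  | empty => simp
  | insert j S hj ih =>
    have key : ∀ g : ι → kbar, g j = 1 →
        ∑ i ∈ insert j S, g i • algebraMap K Ω (v i) ≠ 0 := by
      intro g hgj hg
      have hfix : ∀ i ∈ insert j S, ∃ y, algebraMap k kbar y = g i := by
        intro i hi
        refine exists_algebraMap_eq_of_mem_bot (K := K) (Ω := Ω) hK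
          (mem_of_isSeparable_of_forall_fixed (isSeparable_const k K Ω _) fun σ _ => ?_)
        rw [← algebraMap_restrictConst (k := k)]
        congr 1
        rcases Finset.mem_insert.1 hi with rfl | hi
        · rw [hgj, map_one]
        · refine sub_eq_zero.1 (ih (fun i => restrictConst (k := k) kbar σ (g i) - g i) ?_ i hi)
          have h1 := congrArg σ hg
          rw [map_sum, map_zero] at h1
          have h2 : ∀ i, σ (g i • algebraMap K Ω (v i)) =
              restrictConst (k := k) kbar σ (g i) • algebraMap K Ω (v i) := fun i => by
            rw [Algebra.smul_def, Algebra.smul_def, map_mul, algebraMap_restrictConst, σ.commutes]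
          simp only [h2] at h1
          rw [Finset.sum_insert hj] at h1 hg
          rw [hgj, map_one] at *
          simp only [sub_smul, Finset.sum_sub_distrib]
          linear_combination h1 - hg
      choose! y hy using hfix
      have h1 : algebraMap K Ω (∑ i ∈ insert j S, y i • v i) = 0 := by
        rw [← hg, map_sum]
        refine Finset.sum_congr rfl fun i hi => ?_
        rw [← hy i hi, Algebra.smul_def, Algebra.smul_def, map_mul,
          ← IsScalarTower.algebraMap_apply, ← IsScalarTower.algebraMap_apply]
      have h2 := linearIndependent_iff'.1 hv _ _ ((map_eq_zero _).1 h1) j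
        (Finset.mem_insert_self j S)
      have h3 := hy j (Finset.mem_insert_self j S)
      rw [h2, hgj, map_zero] at h3
      exact zero_ne_one h3
    intro g hg
    have hgj : g j = 0 := by
      by_contra h0
      refine key (fun i => (g j)⁻¹ * g i) (inv_mul_cancel₀ h0) ?_
      simp only [mul_smul, ← Finset.smul_sum, hg, smul_zero]
    rw [Finset.sum_insert hj, hgj, zero_smul, zero_add] at hg
    intro i hi
    rcases Finset.mem_insert.1 hi with rfl | hi
    · exact hgj
    · exact ih g hg i hi

/-- An element of `K k̄` has coordinates in `k̄` with respect to a basis of `K` over `k`. They are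
multiplied by `c` by every automorphism over `K` that multiplies the element by `c ∈ k̄`. -/
theorem exists_coordinates {l : IntermediateField k kbar} {x : Ω} (hx : x ∈ constExt K Ω l) :
    ∃ (ι : Set K) (g : ι →₀ kbar), x = g.sum (fun i a => a • algebraMap K Ω i) ∧
      ∀ (σ : Ω ≃ₐ[K] Ω) (c : kbar), σ x = algebraMap kbar Ω c * x →
        ∀ i, σ (algebraMap kbar Ω (g i)) = algebraMap kbar Ω (c * g i) := by
  let B := Module.Basis.ofVectorSpace k K
  have hli := linearIndependent_algebraMap (kbar := kbar) (Ω := Ω) hK B.linearIndependent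
  have hspan : x ∈ Submodule.span kbar (Set.range fun i => algebraMap K Ω (B i)) := by
    refine Submodule.span_le.2 ?_ (mem_span_of_mem_constExt hx)
    rintro _ ⟨y, rfl⟩
    have h1 := B.linearCombination_repr y
    rw [Finsupp.linearCombination_apply, Finsupp.sum] at h1
    rw [← h1, map_sum]
    refine Submodule.sum_mem _ fun i _ => ?_
    rw [Algebra.smul_def, map_mul, ← IsScalarTower.algebraMap_apply,
      IsScalarTower.algebraMap_apply k kbar Ω, ← Algebra.smul_def]
    exact Submodule.smul_mem _ _ (Submodule.subset_span ⟨i, rfl⟩)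
  obtain ⟨g, rfl⟩ := Finsupp.mem_span_range_iff_exists_finsupp.1 hspan
  refine ⟨_, g, by simp only [B, Module.Basis.coe_ofVectorSpace], fun σ c hσ i => ?_⟩
  rw [← algebraMap_restrictConst (k := k)]
  congr 1
  have h1 : Finsupp.linearCombination kbar (fun i => algebraMap K Ω (B i))
      (g.mapRange (restrictConst (k := k) kbar σ) (map_zero _)) =
      Finsupp.linearCombination kbar (fun i => algebraMap K Ω (B i)) (c • g) := by
    rw [map_smul, Finsupp.linearCombination_apply, Finsupp.linearCombination_apply,
      Algebra.smul_def, ← hσ, Finsupp.sum_mapRange_index (by simp), Finsupp.sum, Finsupp.sum,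
      map_sum]
    refine Finset.sum_congr rfl fun i _ => ?_
    rw [Algebra.smul_def, Algebra.smul_def, map_mul, algebraMap_restrictConst, σ.commutes]
  have h2 := congr($(hli h1) i)
  simpa using h2

/-- An extension of prime degree three inside `K k̄` is a constant extension. -/
theorem exists_eq_constExt {L : IntermediateField K Ω} (hL : Module.finrank K L = 3)
    (hLE : L ≤ constExt K Ω (⊤ : IntermediateField k kbar)) :
    ∃ l : IntermediateField k kbar, Module.finrank k l = 3 ∧ L = constExt K Ω l := by
  obtain ⟨x, hxL, hx⟩ : ∃ x ∈ L, x ∉ (⊥ : IntermediateField K Ω) := by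
    by_contra! h
    have hbot : L = ⊥ := le_bot_iff.1 h
    rw [hbot, IntermediateField.finrank_bot] at hL
    omega
  obtain ⟨ι, g, hxg, hg⟩ := exists_coordinates hK (hLE hxL)
  have hgL : ∀ i, algebraMap kbar Ω (g i) ∈ L := fun i =>
    mem_of_isSeparable_of_forall_fixed (isSeparable_const k K Ω _) fun σ hσ => by
      rw [hg σ 1 (by rw [hσ x hxL, map_one, one_mul]) i, one_mul]
  obtain ⟨i, hi⟩ : ∃ i, algebraMap kbar Ω (g i) ∉ (⊥ : IntermediateField K Ω) := by
    by_contra! h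
    refine hx ?_
    rw [hxg]
    refine sum_mem fun i _ => ?_
    beta_reduce
    rw [Algebra.smul_def]
    exact mul_mem (h i) ((⊥ : IntermediateField K Ω).algebraMap_mem _)
  have hLK := eq_adjoin_simple_of_finrank_three hL (hgL i) hi
  refine ⟨k⟮g i⟯, ?_, by rw [constExt_adjoin_simple, hLK]⟩
  rw [hLK, adjoin.finrank (isSeparable_const k K Ω _).isIntegral,
    natDegree_minpoly_algebraMap hK] at hL
  rw [adjoin.finrank (Algebra.IsIntegral.isIntegral _), hL]

/-- If all automorphisms over `F` multiply `x ∈ K k̄` by constants, then `x` is the product of a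
constant and an element of `F`. -/
theorem exists_const_mul_of_forall_map {F : IntermediateField K Ω} {l : IntermediateField k kbar}
    {x : Ω} (hx : x ∈ constExt K Ω l)
    (h : ∀ σ : Ω ≃ₐ[K] Ω, (∀ y ∈ F, σ y = y) → ∃ c : kbar, σ x = algebraMap kbar Ω c * x) :
    ∃ (γ : kbar) (w : Ω), w ∈ F ∧ x = algebraMap kbar Ω γ * w := by
  by_cases hx0 : x = 0
  · exact ⟨0, 0, zero_mem F, by rw [hx0, mul_zero]⟩
  obtain ⟨ι, g, hxg, hg⟩ := exists_coordinates hK hx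
  obtain ⟨i, hi⟩ : ∃ i, g i ≠ 0 := by
    by_contra! h
    exact hx0 (by rw [hxg, Finsupp.ext (g := 0) h, Finsupp.sum_zero_index])
  have hi' : algebraMap kbar Ω (g i) ≠ 0 := (_root_.map_ne_zero _).2 hi
  refine ⟨g i, x / algebraMap kbar Ω (g i), ?_, by rw [mul_div_cancel₀ _ hi']⟩
  refine mem_of_isSeparable_of_forall_fixed (isSeparable_of_mem_constExt (k := k) (kbar := kbar)
    (l := ⊤) (div_mem (constExt_mono le_top hx) (algebraMap_mem_constExt trivial)))
    fun σ hσ => ?_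
  obtain ⟨c, hc⟩ := h σ hσ
  have h1 := hg σ c hc i
  rw [map_mul] at h1
  have hc0 : algebraMap kbar Ω c ≠ 0 := by
    intro h0
    rw [h0, zero_mul, map_eq_zero] at hc
    exact hx0 hc
  rw [map_div₀, hc, h1, mul_div_mul_left _ _ hc0]

end ConstantField

end ConstantExtension

/-! ### Descents of purely cubic extensions -/

section CubeRootExtension

variable {K Ω : Type*} [Field K] [Field Ω] [Algebra K Ω]

theorem IsDefinedByCubeRoot.of_algEquiv {K L L' : Type*} [Field K] [Field L] [Field L']
    [Algebra K L] [Algebra K L'] {β : K} (h : IsDefinedByCubeRoot K L β) (e : L ≃ₐ[K] L') :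
    IsDefinedByCubeRoot K L' β := by
  obtain ⟨y, hy, hmin⟩ := h
  refine ⟨e y, ?_, by rw [minpoly.algEquiv_eq, hmin]⟩
  have h1 : (K⟮y⟯).map (e : L →ₐ[K] L') = K⟮e y⟯ := by
    rw [adjoin_map, Set.image_singleton]
    rfl
  rw [← h1, hy, ← AlgHom.fieldRange_eq_map, AlgHom.fieldRange_eq_top]
  exact e.surjective

theorem isDefinedByCubeRoot_compositum_iff {M F : IntermediateField K Ω} {g : F} :
    IsDefinedByCubeRoot F (compositum M F) g ↔
      ∃ y : Ω, IsProperCubeRoot F y ∧ y ^ 3 = g ∧ M ⊔ F = F ⊔ K⟮y⟯ := by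
  simp only [isDefinedByCubeRoot_iff, compositum_eq_adjoin_simple_iff]

theorem isPurelyCubicClosure_iff {M K' : IntermediateField K Ω} :
    IsPurelyCubicClosure M K' ↔
      IsLeast {F | ∃ z : Ω, IsProperCubeRoot F z ∧ M ⊔ F = F ⊔ K⟮z⟯} K' := by
  have : {F : IntermediateField K Ω | IsPurelyCubic F (compositum M F)} =
      {F : IntermediateField K Ω | ∃ z : Ω, IsProperCubeRoot F z ∧ M ⊔ F = F ⊔ K⟮z⟯} := by
    ext F
    simp only [IsPurelyCubic, Set.mem_ofPred_eq, isDefinedByCubeRoot_compositum_iff]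
    constructor
    · rintro ⟨β, z, hz, -, h⟩
      exact ⟨z, hz, h⟩
    · rintro ⟨z, hz, h⟩
      exact ⟨⟨z ^ 3, hz.cube_mem⟩, z, hz, rfl, h⟩
  rw [IsPurelyCubicClosure, this]

theorem isDescentOfCubeRoot_iff {k kbar : Type*} [Field k] [Field kbar] [Algebra k kbar]
    [Algebra k K] [Algebra kbar Ω] {K' M : IntermediateField K Ω} {g : K'} :
    IsDescentOfCubeRoot k kbar g M ↔ IsCubicExt k kbar M ∧
      IsLeast {F | ∃ z : Ω, IsProperCubeRoot F z ∧ M ⊔ F = F ⊔ K⟮z⟯} K' ∧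
      ∃ y : Ω, IsProperCubeRoot K' y ∧ y ^ 3 = g ∧ M ⊔ K' = K' ⊔ K⟮y⟯ := by
  rw [← isPurelyCubicClosure_iff, ← isDefinedByCubeRoot_compositum_iff]
  constructor
  · rintro ⟨L', hL', h⟩
    exact ⟨h.isCubicExt, h.closure, hL'.of_algEquiv h.iso.some.symm⟩
  · rintro ⟨h1, h2, h3⟩
    exact ⟨_, h3, h1, h2, ⟨AlgEquiv.refl⟩⟩

theorem sup_adjoin_mul {F : IntermediateField K Ω} {w : Ω} (hw : w ∈ F) (hw0 : w ≠ 0) (y : Ω) :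
    F ⊔ K⟮w * y⟯ = F ⊔ K⟮y⟯ := by
  have key : ∀ {v : Ω}, v ∈ F → ∀ y, F ⊔ K⟮v * y⟯ ≤ F ⊔ K⟮y⟯ := fun hv y =>
    sup_le le_sup_left (adjoin_simple_le_iff.2 (mul_mem ((le_sup_left : F ≤ _) hv)
      ((le_sup_right : K⟮y⟯ ≤ _) (mem_adjoin_simple_self K y))))
  refine le_antisymm (key hw y) ?_
  have := key (inv_mem hw) (w * y)
  rwa [inv_mul_cancel_left₀ hw0] at this

theorem IsProperCubeRoot.mul {F : IntermediateField K Ω} {y w : Ω} (hy : IsProperCubeRoot F y)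
    (hw : w ∈ F) (hw0 : w ≠ 0) : IsProperCubeRoot F (w * y) := by
  refine ⟨by rw [mul_pow]; exact mul_mem (pow_mem hw 3) hy.cube_mem, fun x hx hxy => ?_⟩
  refine hy.cube_ne (x / w) (div_mem hx hw) ?_
  rw [div_pow, hxy, mul_pow, mul_div_cancel_left₀ _ (pow_ne_zero 3 hw0)]

theorem IsProperCubeRoot.of_le {F F' : IntermediateField K Ω} {y : Ω} (hy : IsProperCubeRoot F' y)
    (hle : F ≤ F') (h : y ^ 3 ∈ F) : IsProperCubeRoot F y :=
  ⟨h, fun x hx => hy.cube_ne x (hle hx)⟩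

/-- Whether an extension is a descent of `y³ = g` depends only on `g` modulo cubes. -/
theorem isDescentOfCubeRoot_mul_pow_three {k kbar : Type*} [Field k] [Field kbar]
    [Algebra k kbar] [Algebra k K] [Algebra kbar Ω] {K' M : IntermediateField K Ω} {g w : K'}
    (hw : w ≠ 0) (h : IsDescentOfCubeRoot k kbar g M) :
    IsDescentOfCubeRoot k kbar (w ^ 3 * g) M := by
  rw [isDescentOfCubeRoot_iff] at h ⊢
  obtain ⟨h1, h2, y, hy, hyg, hM⟩ := h
  have hw0 : (w : Ω) ≠ 0 := fun h0 => hw (Subtype.ext h0)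
  refine ⟨h1, h2, w * y, hy.mul w.2 hw0, ?_, ?_⟩
  · rw [mul_pow, hyg]
    rfl
  · rw [hM, sup_adjoin_mul w.2 hw0]

/-- A root in `F(y)` of a cubic polynomial without quadratic term has no component in `F`. -/
theorem IsProperCubeRoot.exists_eq_of_cubic_eq {F : IntermediateField K Ω} {y t p r : Ω}
    (h3 : (3 : Ω) ≠ 0) (hy : IsProperCubeRoot F y) (ht : t ∈ F ⊔ K⟮y⟯) (htF : t ∉ F) (hp : p ∈ F)
    (hr : r ∈ F) (h : t ^ 3 + p * t + r = 0) :
    ∃ b ∈ F, ∃ c ∈ F, t = b * y + c * y ^ 2 ∧ p = -(3 * ((b * y) * (c * y ^ 2))) ∧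
      r = -((b * y) ^ 3 + (c * y ^ 2) ^ 3) := by
  obtain ⟨a, ha, b, hb, c, hc, rfl⟩ := hy.mem_sup_iff.1 ht
  have h3F : (3 : Ω) ∈ F := by exact_mod_cast _root_.natCast_mem F 3
  have h6F : (6 : Ω) ∈ F := by exact_mod_cast _root_.natCast_mem F 6
  have hwF := hy.cube_mem
  set w := y ^ 3 with hw
  obtain ⟨h0, h1, h2⟩ := hy.eq_zero_of_add_eq_zero
    (a := a ^ 3 + 6 * a * b * c * w + b ^ 3 * w + c ^ 3 * w ^ 2 + p * a + r)
    (b := 3 * a ^ 2 * b + 3 * a * c ^ 2 * w + 3 * b ^ 2 * c * w + p * b)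
    (c := 3 * a ^ 2 * c + 3 * a * b ^ 2 + 3 * b * c ^ 2 * w + p * c)
    (by apply_rules [add_mem, mul_mem, pow_mem])
    (by apply_rules [add_mem, mul_mem, pow_mem])
    (by apply_rules [add_mem, mul_mem, pow_mem])
    (by rw [← h, hw]; ring)
  have hprod : a * (c ^ 3 * w - b ^ 3) = 0 := by
    refine mul_left_cancel₀ h3 ?_
    linear_combination c * h1 - b * h2
  have ha0 : a = 0 := by
    rcases mul_eq_zero.1 hprod with h | h
    · exact h
    · by_cases hc0 : c = 0
      · have hb0 : b = 0 := by
          subst hc0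
          exact pow_eq_zero_iff (n := 3) (by norm_num) |>.1 (by linear_combination -h)
        exact absurd (by simpa [hb0, hc0] using ha) htF
      · refine absurd ?_ (hy.cube_ne (b / c) (div_mem hb hc))
        rw [← hw, div_pow, div_eq_iff (pow_ne_zero 3 hc0)]
        linear_combination -h
  subst ha0
  refine ⟨b, hb, c, hc, by ring, ?_, ?_⟩
  · have h1' : (3 * b * c * w + p) * b = 0 := by linear_combination h1
    have h2' : (3 * b * c * w + p) * c = 0 := by linear_combination h2
    have : 3 * b * c * w + p = 0 := by
      rcases mul_eq_zero.1 h1' with h | rfl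
      · exact h
      · rcases mul_eq_zero.1 h2' with h | rfl
        · exact h
        · exact absurd (by simp) htF
    rw [hw] at this
    linear_combination this
  · rw [hw] at h0
    linear_combination h0

/-- A generator of a cubic extension can be chosen with trace zero. -/
theorem exists_generator_of_finrank_three (h3 : (3 : Ω) ≠ 0) {M : IntermediateField K Ω}
    (hM : Module.finrank K M = 3) :
    ∃ t : Ω, M = K⟮t⟯ ∧ t ∉ (⊥ : IntermediateField K Ω) ∧ ∃ p ∈ (⊥ : IntermediateField K Ω),
      ∃ r ∈ (⊥ : IntermediateField K Ω), t ^ 3 + p * t + r = 0 := by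
  obtain ⟨x, hxM, hx⟩ : ∃ x ∈ M, x ∉ (⊥ : IntermediateField K Ω) := by
    by_contra! h
    have hbot : M = ⊥ := le_bot_iff.1 h
    rw [hbot, IntermediateField.finrank_bot] at hM
    omega
  have : FiniteDimensional K M := Module.finite_of_finrank_pos (by omega)
  have hint : IsIntegral K x := (IsIntegral.of_finite K (⟨x, hxM⟩ : M)).map M.val
  have hdeg : (minpoly K x).natDegree = 3 := by
    rw [← adjoin.finrank hint, ← eq_adjoin_simple_of_finrank_three hM hxM hx, hM]
  have hroot := minpoly.aeval K x
  have hlead : (minpoly K x).coeff 3 = 1 := by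
    rw [← hdeg]; exact minpoly.monic hint
  rw [aeval_eq_sum_range, hdeg] at hroot
  simp only [Finset.sum_range_succ, Finset.sum_range_zero, Algebra.smul_def, zero_add, pow_zero,
    mul_one, pow_one, hlead, map_one, one_mul] at hroot
  have hmem : ∀ i, algebraMap K Ω ((minpoly K x).coeff i) ∈ (⊥ : IntermediateField K Ω) :=
    fun i => (⊥ : IntermediateField K Ω).algebraMap_mem _
  have hu := hmem 2
  have hv := hmem 1
  have hw := hmem 0
  set u := algebraMap K Ω ((minpoly K x).coeff 2)
  set v := algebraMap K Ω ((minpoly K x).coeff 1)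
  set w := algebraMap K Ω ((minpoly K x).coeff 0)
  have h3F : (3 : Ω) ∈ (⊥ : IntermediateField K Ω) := by
    exact_mod_cast _root_.natCast_mem (⊥ : IntermediateField K Ω) 3
  have h2F : (2 : Ω) ∈ (⊥ : IntermediateField K Ω) := by
    exact_mod_cast _root_.natCast_mem (⊥ : IntermediateField K Ω) 2
  have hu3 := div_mem hu h3F
  have htM : x + u / 3 ∈ M := add_mem hxM ((bot_le : ⊥ ≤ M) hu3)
  have ht : x + u / 3 ∉ (⊥ : IntermediateField K Ω) := fun h => hx (by
    have := sub_mem h hu3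
    rwa [add_sub_cancel_right] at this)
  refine ⟨x + u / 3, eq_adjoin_simple_of_finrank_three hM htM ht, ht, v - 3 * (u / 3) ^ 2,
    sub_mem hv (mul_mem h3F (pow_mem hu3 2)), 2 * (u / 3) ^ 3 - (u / 3) * v + w,
    add_mem (sub_mem (mul_mem h2F (pow_mem hu3 3)) (mul_mem hu3 hv)) hw, ?_⟩
  have e : u = 3 * (u / 3) := by field_simp
  linear_combination hroot - x ^ 2 * e

end CubeRootExtension

/-! ### The quadratic constant extension -/

theorem exists_algebraMap_eq_of_pow_three_eq {kbar Ω : Type*} [Field kbar]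
    [IsAlgClosed kbar] [Field Ω] [Algebra kbar Ω] {ζ : kbar} (hζ : IsPrimitiveRoot ζ 3) {x : Ω}
    {c : kbar} (h : x ^ 3 = algebraMap kbar Ω c) :
    ∃ y : kbar, y ^ 3 = c ∧ algebraMap kbar Ω y = x := by
  obtain ⟨y, rfl⟩ := IsAlgClosed.exists_pow_nat_eq c (by norm_num : 0 < 3)
  by_cases hy : y = 0
  · subst hy
    refine ⟨0, rfl, ?_⟩
    rw [map_zero]
    exact (pow_eq_zero_iff (n := 3) (by norm_num) |>.1 (by rw [h]; simp)).symm
  rw [map_pow] at h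
  obtain ⟨n, hn⟩ := exists_eq_pow_val_mul
    (hζ.map_of_injective (f := algebraMap kbar Ω) (algebraMap kbar Ω).injective)
    ((_root_.map_ne_zero _).2 hy) h
  refine ⟨ζ ^ n.val * y, ?_, by rw [hn, map_mul, map_pow]⟩
  rw [mul_pow, pow_right_comm, hζ.pow_eq_one, one_pow, one_mul]

section QuadraticConstants

variable {k kbar K Ω : Type*} [Field k] [PerfectField k] [Field kbar] [Algebra k kbar]
  [IsAlgClosure k kbar] [Field K] [Algebra k K] [Field Ω] [Algebra K Ω] [Algebra kbar Ω]
  [Algebra k Ω] [IsScalarTower k K Ω] [IsScalarTower k kbar Ω]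
  {q : IntermediateField k kbar}

theorem exists_isQuadraticPair (hK : ∀ x : K, IsAlgebraic k x → x ∈ (algebraMap k K).range)
    (hq : Module.finrank k q = 2) :
    ∃ a a' : kbar, q = k⟮a⟯ ∧ IsQuadraticPair (⊥ : IntermediateField K Ω)
      (algebraMap kbar Ω a) (algebraMap kbar Ω a') := by
  obtain ⟨τ, hτ⟩ := exists_notMem_fixingSubgroup hq
  obtain ⟨a, ha, hτa⟩ : ∃ a ∈ q, τ a ≠ a := by
    rw [IntermediateField.mem_fixingSubgroup_iff] at hτ
    push Not at hτ
    exact hτ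
  have hbot : ∀ x : k, algebraMap kbar Ω (algebraMap k kbar x) ∈ (⊥ : IntermediateField K Ω) :=
    fun x => by
      rw [← IsScalarTower.algebraMap_apply, IsScalarTower.algebraMap_apply k K Ω]
      exact (⊥ : IntermediateField K Ω).algebraMap_mem _
  have hN := norm_eq_mul_apply hq hτ ⟨a, ha⟩
  have hN1 := norm_eq_mul_apply hq hτ (1 + ⟨a, ha⟩)
  have haK : ∀ y, algebraMap k kbar y ≠ a := by
    rintro y rfl
    exact hτa (τ.commutes y)
  refine ⟨a, τ a, ?_, ?_, ?_, ?_, ?_⟩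
  · have hle : k⟮a⟯ ≤ q := adjoin_simple_le_iff.2 ha
    have : FiniteDimensional k q := Module.finite_of_finrank_pos (by omega)
    have hdvd := finrank_dvd_of_le_right hle
    rw [hq, Nat.dvd_prime Nat.prime_two] at hdvd
    rcases hdvd with h | h
    · rw [IntermediateField.finrank_eq_one_iff, adjoin_simple_eq_bot_iff] at h
      obtain ⟨y, hy⟩ := mem_bot.1 h
      exact absurd hy (haK y)
    · exact (eq_of_le_of_finrank_eq hle (h.trans hq.symm)).symm
  · exact fun h => hτa ((algebraMap kbar Ω).injective h).symm
  · have : algebraMap kbar Ω a + algebraMap kbar Ω (τ a) = algebraMap kbar Ω (algebraMap k kbar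
        (Algebra.norm k (1 + ⟨a, ha⟩ : q) - 1 - Algebra.norm k (⟨a, ha⟩ : q))) := by
      rw [← map_add]
      congr 1
      rw [map_sub, map_sub, hN, hN1, map_one]
      push_cast
      rw [map_add, map_one]
      ring
    rw [this]
    exact hbot _
  · rw [← map_mul, ← hN]
    exact hbot _
  · intro h
    obtain ⟨y, hy⟩ := exists_algebraMap_eq_of_mem_bot hK h
    exact haK y hy

variable {a a' : kbar} (hqa : q = k⟮a⟯) {s : Ω ≃ₐ[K] Ω}

include hqa in
theorem algebraMap_mul_apply_eq_norm (hq : Module.finrank k q = 2)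
    (hne : algebraMap kbar Ω a ≠ algebraMap kbar Ω a')
    (hs : s (algebraMap kbar Ω a) = algebraMap kbar Ω a') (c : q) :
    algebraMap kbar Ω c * s (algebraMap kbar Ω c) = algebraMap k Ω (Algebra.norm k c) := by
  have hσ : restrictConst (k := k) kbar s ∉ q.fixingSubgroup := fun h => by
    rw [hqa, mem_fixingSubgroup_adjoin_simple] at h
    rw [← (algebraMap kbar Ω).injective.eq_iff, algebraMap_restrictConst, hs] at h
    exact hne h.symm
  rw [← algebraMap_restrictConst (k := k), ← map_mul, ← norm_eq_mul_apply hq hσ,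
    ← IsScalarTower.algebraMap_apply]

omit [PerfectField k] in
include hqa in
/-- A constant in `K q` lies in `q`. -/
theorem mem_of_algebraMap_mem_constExt [Normal K Ω]
    (hK : ∀ x : K, IsAlgebraic k x → x ∈ (algebraMap k K).range)
    (hα : IsQuadraticPair (⊥ : IntermediateField K Ω) (algebraMap kbar Ω a) (algebraMap kbar Ω a'))
    {x : kbar} (hx : algebraMap kbar Ω x ∈ constExt K Ω q) : x ∈ q := by
  obtain ⟨s, hsbot, hs⟩ := hα.exists_conj
  rw [hqa, constExt_adjoin_simple, ← bot_sup_eq (K⟮algebraMap kbar Ω a⟯)] at hx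
  obtain ⟨u, hu, v, hv, hxuv⟩ := hα.exists_eq_of_mem_sup hx
  have hne : a - a' ≠ 0 := sub_ne_zero.2 fun h => hα.ne (congrArg _ h)
  have hv' : v = algebraMap kbar Ω ((x - restrictConst (k := k) kbar s x) / (a - a')) := by
    have h1 := congrArg s hxuv
    rw [map_add, map_mul, hsbot u hu, hsbot v hv, hs, ← algebraMap_restrictConst (k := k)] at h1
    rw [map_div₀, eq_div_iff ((_root_.map_ne_zero _).2 hne), map_sub, map_sub]
    linear_combination h1 - hxuv
  rw [hv'] at hv hxuv
  obtain ⟨v₀, hv₀⟩ := exists_algebraMap_eq_of_mem_bot hK hv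
  rw [← hv₀] at hxuv
  have hu' : u = algebraMap kbar Ω (x - algebraMap k kbar v₀ * a) := by
    rw [map_sub, map_mul]
    linear_combination -hxuv
  rw [hu'] at hu
  obtain ⟨u₀, hu₀⟩ := exists_algebraMap_eq_of_mem_bot hK hu
  have : x = algebraMap k kbar u₀ + algebraMap k kbar v₀ * a := by rw [hu₀]; ring
  rw [this, hqa]
  exact add_mem (k⟮a⟯.algebraMap_mem _)
    (mul_mem (k⟮a⟯.algebraMap_mem _) (mem_adjoin_simple_self k a))

end QuadraticConstants

/-! ### Descents and twists -/

section DescentTwist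

/-- `M` is generated by `y + h / y`, where `y` is a cube root of an element `g` that is not a cube
in `E`, and `h ∈ K` satisfies the descent equation `g s(g) = h³`. -/
structure IsDescentBy {K Ω : Type*} [Field K] [Field Ω] [Algebra K Ω] (s : Ω ≃ₐ[K] Ω)
    (E M : IntermediateField K Ω) (y h : Ω) : Prop where
  proper : IsProperCubeRoot E y
  mem_base : h ∈ (⊥ : IntermediateField K Ω)
  mul_map : y ^ 3 * s (y ^ 3) = h ^ 3
  eq_adjoin : M = K⟮y + h / y⟯

theorem IsDescentBy.sup_eq {K Ω : Type*} [Field K] [Field Ω] [Algebra K Ω] {s : Ω ≃ₐ[K] Ω}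
    {E M : IntermediateField K Ω} {y h : Ω} (H : IsDescentBy s E M y h) : M ⊔ E = E ⊔ K⟮y⟯ := by
  rw [H.eq_adjoin, sup_comm, H.proper.sup_adjoin_add_div ((bot_le : ⊥ ≤ E) H.mem_base)]

theorem IsDescentBy.ne_zero {K Ω : Type*} [Field K] [Field Ω] [Algebra K Ω] {s : Ω ≃ₐ[K] Ω}
    {E M : IntermediateField K Ω} {y h : Ω} (H : IsDescentBy s E M y h) : h ≠ 0 := by
  rintro rfl
  have hy0 := pow_ne_zero 3 H.proper.ne_zero
  exact mul_ne_zero hy0 ((_root_.map_ne_zero s).2 hy0) (H.mul_map.trans (zero_pow (by norm_num)))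

theorem IsPrimitiveRoot.sq_add_self_add_one {R : Type*} [CommRing R] [IsDomain R] {ζ : R}
    (hζ : IsPrimitiveRoot ζ 3) : ζ ^ 2 + ζ + 1 = 0 := by
  have := hζ.geom_sum_eq_zero (by norm_num)
  simp only [Finset.sum_range_succ, Finset.sum_range_zero] at this
  linear_combination this

theorem mem_of_pow_three_eq {K Ω : Type*} [Field K] [Field Ω] [Algebra K Ω]
    {E : IntermediateField K Ω} {ζ : Ω} (hζ : IsPrimitiveRoot ζ 3) (hζE : ζ ∈ E) {x y : Ω}
    (hx : x ∈ E) (h : y ^ 3 = x ^ 3) : y ∈ E := by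
  by_cases hx0 : x = 0
  · rw [hx0, zero_pow (by norm_num), pow_eq_zero_iff (by norm_num)] at h
    exact h ▸ zero_mem E
  · obtain ⟨n, rfl⟩ := exists_eq_pow_val_mul hζ hx0 h
    exact mul_mem (pow_mem hζE _) hx

variable {k kbar K Ω : Type*} [Field k] [PerfectField k] [Field kbar] [Algebra k kbar]
  [IsAlgClosure k kbar] [Field K] [Algebra k K] [Field Ω] [Algebra K Ω] [Algebra kbar Ω]
  [Algebra k Ω] [IsScalarTower k K Ω] [IsScalarTower k kbar Ω] [Normal K Ω]
  {q : IntermediateField k kbar}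

theorem IsCubicExt.not_le_constExt (hK : ∀ x : K, IsAlgebraic k x → x ∈ (algebraMap k K).range)
    {M : IntermediateField K Ω} (hM : IsCubicExt k kbar M) :
    ¬ M ≤ constExt K Ω (⊤ : IntermediateField k kbar) := fun hle => by
  obtain ⟨l, hl, h⟩ := exists_eq_constExt hK hM.finrank_eq hle
  exact hM.geometric l hl h

variable (hK : ∀ x : K, IsAlgebraic k x → x ∈ (algebraMap k K).range) (h3 : (3 : k) ≠ 0)
  {ζ : kbar} (hζ : IsPrimitiveRoot ζ 3) {a a' : kbar} (hqa : q = k⟮a⟯)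
  (hα : IsQuadraticPair (⊥ : IntermediateField K Ω) (algebraMap kbar Ω a) (algebraMap kbar Ω a'))
  {s : Ω ≃ₐ[K] Ω} (hs : s (algebraMap kbar Ω a) = algebraMap kbar Ω a')
  {E : IntermediateField K Ω} (hE : E = constExt K Ω (⊤ : IntermediateField k kbar))

include hK h3 hζ hqa hα hs hE

/-- The descents of the extension `y³ = g` are the extensions given by the descent equation. -/
theorem isDescentOfCubeRoot_iff_exists {g : constExt K Ω q} {M : IntermediateField K Ω} :
    IsDescentOfCubeRoot k kbar g M ↔ ∃ y h, IsDescentBy s E M y h ∧ y ^ 3 = g := by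
  subst hE
  have h3K : (3 : K) ≠ 0 := by
    rw [← map_ofNat (algebraMap k K) 3]
    exact (_root_.map_ne_zero _).2 h3
  have h3Ω : (3 : Ω) ≠ 0 := by
    rw [← map_ofNat (algebraMap K Ω) 3]
    exact (_root_.map_ne_zero _).2 h3K
  have hζΩ := hζ.map_of_injective (f := algebraMap kbar Ω) (algebraMap kbar Ω).injective
  have hle : constExt K Ω q ≤ constExt K Ω (⊤ : IntermediateField k kbar) := constExt_mono le_top
  have hq : constExt K Ω q = K⟮algebraMap kbar Ω a⟯ := by rw [hqa, constExt_adjoin_simple]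
  rw [isDescentOfCubeRoot_iff]
  constructor
  · rintro ⟨hcubic, hleast, y, hy, hyg, hM⟩
    have hy' := hy
    rw [hq] at hy hM
    obtain ⟨h, hh, hyh, hMy⟩ := exists_eq_adjoin_add_div hα hs hy h3Ω hcubic.finrank_eq hM
      fun z hz hMz => by
        have hmem := hleast.2 ⟨z, hz, show M ⊔ ⊥ = ⊥ ⊔ K⟮z⟯ by rw [hMz, sup_comm]⟩
        rw [hq, adjoin_simple_le_iff] at hmem
        exact hα.notMem hmem
    refine ⟨y, h, ⟨⟨hle hy'.cube_mem, fun x hx hxy => ?_⟩, hh, hyh, hMy⟩, hyg⟩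
    have hyE := mem_of_pow_three_eq hζΩ (algebraMap_mem_constExt (K := K) mem_top) hx hxy.symm
    refine hcubic.not_le_constExt hK ?_
    rw [hMy, adjoin_simple_le_iff]
    exact add_mem hyE (div_mem ((bot_le : ⊥ ≤ constExt K Ω _) hh) hyE)
  · rintro ⟨y, h, H, hyg⟩
    have hy' : IsProperCubeRoot (constExt K Ω q) y := H.proper.of_le hle (hyg ▸ g.2)
    have hy := hy'
    rw [hq] at hy
    have hfin := finrank_adjoin_add_div hα hs hy H.mem_base H.mul_map hζΩ.sq_add_self_add_one
    have hMy := H.eq_adjoin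
    have hsup : M ⊔ constExt K Ω q = constExt K Ω q ⊔ K⟮y⟯ := by
      rw [hMy, sup_comm, hy'.sup_adjoin_add_div ((bot_le : ⊥ ≤ constExt K Ω q) H.mem_base)]
    refine ⟨⟨hMy ▸ hfin, ?_, fun l _ hMl => ?_⟩, ⟨⟨y, hy', hsup⟩, ?_⟩, y, hy', hyg, hsup⟩
    · subst hMy
      exact isSeparable_adjoin_add_div hα hs hy H.mem_base H.mul_map hζΩ.sq_add_self_add_one h3K
    · have h1 := H.sup_eq
      rw [hMl, sup_eq_right.2 (constExt_mono le_top)] at h1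
      exact H.proper.notMem (h1 ▸ (le_sup_right : K⟮y⟯ ≤ _) (mem_adjoin_simple_self K y))
    · rintro F ⟨z, hz, hFz⟩
      rw [hq]
      exact adjoin_le_of_purelyCubic hα hs hy H.mem_base H.mul_map h3Ω hz (hMy ▸ hFz)

end DescentTwist

section DescentEquation

variable {K Ω : Type*} [Field K] [Field Ω] [Algebra K Ω]
  {α α' : Ω} (hα : IsQuadraticPair (⊥ : IntermediateField K Ω) α α') {s : Ω ≃ₐ[K] Ω}
  (hs : s α = α') {E M M' : IntermediateField K Ω} {y y' h h' : Ω}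

include hα hs

/-- A descent is determined up to isomorphism by `y³`: the choices of `y` and `h` are unique up to
cube roots of unity. -/
theorem IsDescentBy.nonempty_algEquiv (H : IsDescentBy s E M y h) (H' : IsDescentBy s E M' y' h')
    (hαE : K⟮α⟯ ≤ E) (hyα : y ^ 3 ∈ K⟮α⟯) {ζ : Ω} (hζ : ζ ^ 2 + ζ + 1 = 0)
    (hy : y' ^ 3 = y ^ 3) : Nonempty (M ≃ₐ[K] M') := by
  have hprop : IsProperCubeRoot K⟮α⟯ y := H.proper.of_le hαE hyα
  have hy0 := H.proper.ne_zero
  have hy0' := H'.proper.ne_zero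
  have hh : h' ^ 3 = h ^ 3 := by rw [← H.mul_map, ← H'.mul_map, hy]
  have hh0 := H.ne_zero
  -- `y' + h' / y'` is a multiple of `u + h / u` for the cube root `u = ω y'`
  set ω := h' / h with hω
  have hω3 : ω ^ 3 = 1 := by rw [hω, div_pow, hh, div_self (pow_ne_zero 3 hh0)]
  have hω0 : ω ≠ 0 := by rintro h0; rw [h0] at hω3; norm_num at hω3
  have hωmem : ω ∈ (⊥ : IntermediateField K Ω) := div_mem H'.mem_base H.mem_base
  have hu3 : (ω * y') ^ 3 = y ^ 3 := by rw [mul_pow, hω3, one_mul, hy]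
  have hM' : M' = K⟮ω * y' + h / (ω * y')⟯ := by
    have h1 : y' + h' / y' = ω ^ 2 * (ω * y' + h / (ω * y')) := by
      have : h' = ω * h := by rw [hω, div_mul_cancel₀ _ hh0]
      rw [this]
      field_simp
      linear_combination -y' ^ 2 * hω3
    have h2 := sup_adjoin_mul (pow_mem hωmem 2) (pow_ne_zero 2 hω0) (ω * y' + h / (ω * y'))
    rw [bot_sup_eq, bot_sup_eq, ← h1] at h2
    rw [H'.eq_adjoin, h2]
  obtain ⟨A, S, hA, hS, hmin⟩ := exists_minpoly_add_div hα hs hprop H.mem_base H.mul_map hζ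
  obtain ⟨A', S', hA', hS', hmin'⟩ := exists_minpoly_add_div hα hs (hprop.of_cube_eq hu3) H.mem_base
    (by rw [hu3]; exact H.mul_map) hζ
  have hAA : A = A' := (algebraMap K Ω).injective (hA.trans hA'.symm)
  have hSS : S = S' := (algebraMap K Ω).injective (by rw [hS, hS', hu3])
  have hfin := finrank_adjoin_add_div hα hs hprop H.mem_base H.mul_map hζ
  have : FiniteDimensional K K⟮y + h / y⟯ := Module.finite_of_finrank_pos (by omega)
  have hint : IsIntegral K (y + h / y) :=
    (AdjoinSimple.isIntegral_gen K _).1 (IsIntegral.of_finite K _)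
  rw [H.eq_adjoin, hM']
  exact ⟨minpoly.algEquiv hint.isAlgebraic (by rw [hmin, hmin', hAA, hSS])⟩

/-- An extension isomorphic to a descent is a descent: a conjugation over `K` that is not trivial
on the quadratic extension exchanges the terms of `y + h / y`. -/
theorem IsDescentBy.exists_of_algEquiv [Normal K Ω] (H : IsDescentBy s E M y h)
    (hyα : y ^ 3 ∈ K⟮α⟯) (e : M ≃ₐ[K] M') : ∃ u, u ^ 3 = y ^ 3 ∧ IsDescentBy s E M' u h := by
  let σ := e.liftNormal Ω
  have hy0 := H.proper.ne_zero
  have hsy0 : σ y ≠ 0 := (_root_.map_ne_zero σ).2 hy0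
  have hM' : M' = K⟮σ y + h / σ y⟯ := by
    obtain ⟨A, rfl⟩ := mem_bot.1 H.mem_base
    have h1 : M' = M.map (σ : Ω →ₐ[K] Ω) := by
      ext x
      constructor
      · intro hx
        refine ⟨e.symm ⟨x, hx⟩, (e.symm ⟨x, hx⟩).2, ?_⟩
        have := e.liftNormal_commutes Ω (e.symm ⟨x, hx⟩)
        rw [e.apply_symm_apply] at this
        exact this
      · rintro ⟨z, hz, rfl⟩
        have : σ z = e ⟨z, hz⟩ := e.liftNormal_commutes Ω ⟨z, hz⟩
        change σ z ∈ M'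
        rw [this]
        exact (e ⟨z, hz⟩).2
    rw [h1, H.eq_adjoin, adjoin_map, Set.image_singleton]
    simp
  have hmul : (σ y) ^ 3 = y ^ 3 ∨ (σ y) ^ 3 = s (y ^ 3) := by
    have hfix : ∀ x ∈ (⊥ : IntermediateField K Ω), σ x = x := fun x hx => by
      obtain ⟨x, rfl⟩ := mem_bot.1 hx
      exact σ.commutes x
    have h1 := hfix _ hα.sum_mem
    have h2 := hfix _ hα.prod_mem
    rw [map_add] at h1
    rw [map_mul] at h2
    have h3 : (σ α - α) * (σ α - α') = 0 := by linear_combination σ α * h1 - h2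
    rw [← map_pow]
    rcases mul_eq_zero.1 h3 with h3 | h3
    · exact Or.inl (map_eq_of_mem_adjoin_simple (τ := AlgEquiv.refl) (sub_eq_zero.1 h3) hyα)
    · exact Or.inr (map_eq_of_mem_adjoin_simple ((sub_eq_zero.1 h3).trans hs.symm) hyα)
  rcases hmul with h1 | h1
  · exact ⟨σ y, h1, H.proper.of_cube_eq h1, H.mem_base, by rw [h1]; exact H.mul_map, hM'⟩
  · have hh0 := H.ne_zero
    have hu : (h / σ y) ^ 3 = y ^ 3 := by
      rw [div_pow, h1, ← H.mul_map, mul_div_cancel_right₀ _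
        (by rw [← h1]; exact pow_ne_zero 3 hsy0)]
    refine ⟨h / σ y, hu, H.proper.of_cube_eq hu, H.mem_base, by rw [hu]; exact H.mul_map, ?_⟩
    rw [hM', div_div_cancel₀ hh0, add_comm]

end DescentEquation

/-! ### The classification of twists -/

section Summands

variable {K Ω : Type*} [Field K] [Field Ω] [Algebra K Ω]

theorem sup_adjoin_eq_of_pow_three_eq {E : IntermediateField K Ω} {ζ : Ω}
    (hζ : IsPrimitiveRoot ζ 3) (hζE : ζ ∈ E) {c y z : Ω} (hc : c ∈ E) (hc0 : c ≠ 0) (hy : y ≠ 0)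
    (h : z ^ 3 = (c * y) ^ 3) : E ⊔ K⟮z⟯ = E ⊔ K⟮y⟯ := by
  obtain ⟨n, rfl⟩ := exists_eq_pow_val_mul hζ (mul_ne_zero hc0 hy) h
  rw [sup_adjoin_mul (pow_mem hζE _) (pow_ne_zero _ (hζ.ne_zero (by norm_num))),
    sup_adjoin_mul hc hc0]

/-- Let `b y + c y²` be a root of a cubic polynomial over `K` without quadratic term. An
automorphism over `K` permutes the cubes of the two summands. As `y³` is not a cube in `E`, these cubes are fixed if the automorphism is trivial on the quadratic extension, and they are
exchanged by `s`. -/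
theorem map_summands_of_descentEquation {E : IntermediateField K Ω}
    (hE : ∀ τ : Ω ≃ₐ[K] Ω, ∀ x ∈ E, τ x ∈ E) {α : Ω} {s : Ω ≃ₐ[K] Ω} {y h b c : Ω}
    (hy : IsProperCubeRoot E y) (hyα : y ^ 3 ∈ K⟮α⟯) (hh : h ∈ (⊥ : IntermediateField K Ω))
    (hyh : y ^ 3 * s (y ^ 3) = h ^ 3) (hb : b ∈ E) (hc : c ∈ E) (ht : b * y + c * y ^ 2 ≠ 0)
    (hp : (b * y) ^ 3 * (c * y ^ 2) ^ 3 ∈ (⊥ : IntermediateField K Ω))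
    (hr : (b * y) ^ 3 + (c * y ^ 2) ^ 3 ∈ (⊥ : IntermediateField K Ω)) :
    b ≠ 0 ∧ (∀ τ : Ω ≃ₐ[K] Ω, (∀ x ∈ K⟮α⟯, τ x = x) → τ b ^ 3 = b ^ 3) ∧
      s ((b * y) ^ 3) = (c * y ^ 2) ^ 3 := by
  have hhE : h ∈ E := (bot_le : ⊥ ≤ E) hh
  have hy0 := hy.ne_zero
  have hyE := hy.cube_mem
  have hfix : ∀ τ : Ω ≃ₐ[K] Ω, ∀ x ∈ (⊥ : IntermediateField K Ω), τ x = x := fun τ x hx => by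
    obtain ⟨x, rfl⟩ := mem_bot.1 hx
    exact τ.commutes x
  have hpair : ∀ τ : Ω ≃ₐ[K] Ω,
      τ ((b * y) ^ 3) = (b * y) ^ 3 ∨ τ ((b * y) ^ 3) = (c * y ^ 2) ^ 3 := fun τ => by
    have h1 := hfix τ _ hp
    have h2 := hfix τ _ hr
    rw [map_mul] at h1
    rw [map_add] at h2
    have h3 : (τ ((b * y) ^ 3) - (b * y) ^ 3) * (τ ((b * y) ^ 3) - (c * y ^ 2) ^ 3) = 0 := by
      linear_combination τ ((b * y) ^ 3) * h2 - h1
    rcases mul_eq_zero.1 h3 with h3 | h3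
    · exact Or.inl (sub_eq_zero.1 h3)
    · exact Or.inr (sub_eq_zero.1 h3)
  have hs0 : s (y ^ 3) = h ^ 3 / y ^ 3 := by
    rw [← hyh, mul_div_cancel_left₀ _ (pow_ne_zero 3 hy0)]
  have hh0 : h ≠ 0 := by
    rintro rfl
    have hy0 := pow_ne_zero 3 hy0
    exact mul_ne_zero hy0 ((_root_.map_ne_zero s).2 hy0) (hyh.trans (zero_pow (by norm_num)))
  have hsb : s ((b * y) ^ 3) = (b * y) ^ 3 → b = 0 := fun h1 => by
    by_contra hb0
    have hsb0 : s b ≠ 0 := (_root_.map_ne_zero s).2 hb0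
    rw [mul_pow, map_mul, hs0, map_pow] at h1
    refine hy.cube_ne (y ^ 3 * b / (s b * h))
      (div_mem (mul_mem hyE hb) (mul_mem (hE s b hb) hhE)) ?_
    field_simp at h1 ⊢
    linear_combination -h1
  have hb0 : b ≠ 0 := by
    rintro rfl
    have hc0 : c ≠ 0 := by
      rintro rfl
      simp at ht
    have h1 := hfix s _ hr
    have h2 : ((0 : Ω) * y) ^ 3 + (c * y ^ 2) ^ 3 = c ^ 3 * (y ^ 3) ^ 2 := by ring
    rw [h2, map_mul, map_pow, map_pow s (y ^ 3), hs0] at h1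
    refine hy.cube_ne (s c * h ^ 2 / (c * y ^ 3))
      (div_mem (mul_mem (hE s c hc) (pow_mem hhE 2)) (mul_mem hc hyE)) ?_
    field_simp at h1 ⊢
    linear_combination h1
  refine ⟨hb0, fun τ hτ => ?_, (hpair s).resolve_left fun h1 => hb0 (hsb h1)⟩
  have hτy := hτ _ hyα
  rcases hpair τ with h1 | h1 <;> rw [mul_pow, map_mul, hτy, map_pow] at h1
  · exact mul_right_cancel₀ (pow_ne_zero 3 hy0) h1
  · exfalso
    have hc0 : c ≠ 0 := by
      rintro rfl
      rw [zero_mul, zero_pow (by norm_num)] at h1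
      exact mul_ne_zero (pow_ne_zero 3 ((_root_.map_ne_zero τ).2 hb0)) (pow_ne_zero 3 hy0) h1
    refine hy.cube_ne (τ b / c) (div_mem (hE τ b hb) hc) ?_
    field_simp
    refine mul_right_cancel₀ (pow_ne_zero 3 hy0) ?_
    linear_combination h1

end Summands

section Constants

variable {k kbar K Ω : Type*} [Field k] [PerfectField k] [Field kbar] [Algebra k kbar]
  [IsAlgClosure k kbar] [Field K] [Algebra k K] [Field Ω] [Algebra K Ω] [Algebra kbar Ω]
  [Algebra k Ω] [IsScalarTower k K Ω] [IsScalarTower k kbar Ω]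
  {q : IntermediateField k kbar}

omit [PerfectField k] in
theorem map_mem_constExt_top (τ : Ω ≃ₐ[K] Ω) {x : Ω}
    (hx : x ∈ constExt K Ω (⊤ : IntermediateField k kbar)) :
    τ x ∈ constExt K Ω (⊤ : IntermediateField k kbar) := by
  have : constExt K Ω (⊤ : IntermediateField k kbar) ≤
      (constExt K Ω (⊤ : IntermediateField k kbar)).comap (τ : Ω →ₐ[K] Ω) := adjoin_le_iff.2 <| by
    rintro _ ⟨y, -, rfl⟩
    change τ (algebraMap kbar Ω y) ∈ constExt K Ω (⊤ : IntermediateField k kbar)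
    rw [← algebraMap_restrictConst (k := k)]
    exact algebraMap_mem_constExt mem_top
  exact this hx

section Twist

variable [Normal K Ω]
variable (hK : ∀ x : K, IsAlgebraic k x → x ∈ (algebraMap k K).range) (h3 : (3 : k) ≠ 0)
  (hq : Module.finrank k q = 2)
  {ζ : kbar} (hζ : IsPrimitiveRoot ζ 3) {a a' : kbar} (hqa : q = k⟮a⟯)
  (hα : IsQuadraticPair (⊥ : IntermediateField K Ω) (algebraMap kbar Ω a) (algebraMap kbar Ω a'))
  {s : Ω ≃ₐ[K] Ω} (hs : s (algebraMap kbar Ω a) = algebraMap kbar Ω a')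
  {f : constExt K Ω q} {L M M' : IntermediateField K Ω}

include hK h3 hζ hqa hα hs

theorem IsDescentOfCubeRoot.nonempty_algEquiv (h : IsDescentOfCubeRoot k kbar f M)
    (h' : IsDescentOfCubeRoot k kbar f M') : Nonempty (M ≃ₐ[K] M') := by
  rw [isDescentOfCubeRoot_iff_exists hK h3 hζ hqa hα hs rfl] at h h'
  obtain ⟨y, h, H, hy⟩ := h
  obtain ⟨y', h', H', hy'⟩ := h'
  have hqK : constExt K Ω q = K⟮algebraMap kbar Ω a⟯ := by rw [hqa, constExt_adjoin_simple]
  exact H.nonempty_algEquiv hα hs H' (hqK ▸ constExt_mono le_top) (hqK ▸ hy ▸ f.2)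
    (hζ.map_of_injective (f := algebraMap kbar Ω) (algebraMap kbar Ω).injective).sq_add_self_add_one
    (hy'.trans hy.symm)

theorem IsDescentOfCubeRoot.of_algEquiv (h : IsDescentOfCubeRoot k kbar f M)
    (e : M ≃ₐ[K] M') : IsDescentOfCubeRoot k kbar f M' := by
  rw [isDescentOfCubeRoot_iff_exists hK h3 hζ hqa hα hs rfl] at h ⊢
  obtain ⟨y, h, H, hy⟩ := h
  have hqK : constExt K Ω q = K⟮algebraMap kbar Ω a⟯ := by rw [hqa, constExt_adjoin_simple]
  obtain ⟨u, hu, Hu⟩ := H.exists_of_algEquiv hα hs (hqK ▸ hy ▸ f.2) e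
  exact ⟨u, h, Hu, hu.trans hy⟩

include hq in
theorem exists_isDescentOfCubeRoot_constElt_mul (hL : IsDescentOfCubeRoot k kbar f L)
    (c : normOne k q) : ∃ M : IntermediateField K Ω,
      IsDescentOfCubeRoot k kbar (constElt K Ω q ((c : qˣ) : q) * f) M := by
  have := IsAlgClosure.isAlgClosed k (K := kbar)
  rw [isDescentOfCubeRoot_iff_exists hK h3 hζ hqa hα hs rfl] at hL
  obtain ⟨y, h, H, hy⟩ := hL
  obtain ⟨γ, hγ⟩ := IsAlgClosed.exists_pow_nat_eq (((c : qˣ) : q) : kbar) (by norm_num : 0 < 3)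
  have hγ0 : γ ≠ 0 := by
    rintro rfl
    rw [zero_pow (by norm_num)] at hγ
    exact (c : qˣ).ne_zero (Subtype.ext hγ.symm)
  have hγc : (algebraMap kbar Ω γ * y) ^ 3 = algebraMap kbar Ω (((c : qˣ) : q) : kbar) * y ^ 3 := by
    rw [mul_pow, ← map_pow, hγ]
  refine ⟨_, (isDescentOfCubeRoot_iff_exists hK h3 hζ hqa hα hs rfl).2
    ⟨algebraMap kbar Ω γ * y, h, ⟨H.proper.mul (algebraMap_mem_constExt mem_top)
      ((_root_.map_ne_zero _).2 hγ0), H.mem_base, ?_, rfl⟩, by rw [hγc, hy]; rfl⟩⟩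
  have hN := algebraMap_mul_apply_eq_norm hqa hq hα.ne hs ((c : qˣ) : q)
  rw [mem_normOne.1 c.2, map_one] at hN
  rw [hγc, map_mul]
  linear_combination (y ^ 3 * s (y ^ 3)) * hN + H.mul_map

theorem IsDescentOfCubeRoot.isTwist {c : q} (hc : c ≠ 0) (hL : IsDescentOfCubeRoot k kbar f L)
    (hM : IsDescentOfCubeRoot k kbar (constElt K Ω q c * f) M) : IsTwist k kbar L M := by
  have := IsAlgClosure.isAlgClosed k (K := kbar)
  have hcubic := (isDescentOfCubeRoot_iff.1 hM).1
  rw [isDescentOfCubeRoot_iff_exists hK h3 hζ hqa hα hs rfl] at hL hM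
  obtain ⟨y, h, H, hy⟩ := hL
  obtain ⟨z, h', H', hz⟩ := hM
  obtain ⟨γ, hγ⟩ := IsAlgClosed.exists_pow_nat_eq (c : kbar) (by norm_num : 0 < 3)
  have hγ0 : γ ≠ 0 := by
    rintro rfl
    rw [zero_pow (by norm_num)] at hγ
    exact hc (Subtype.ext hγ.symm)
  have h1 := sup_adjoin_eq_of_pow_three_eq
    (hζ.map_of_injective (f := algebraMap kbar Ω) (algebraMap kbar Ω).injective)
    (algebraMap_mem_constExt (K := K) (l := (⊤ : IntermediateField k kbar)) mem_top)
    (algebraMap_mem_constExt (K := K) (l := (⊤ : IntermediateField k kbar)) mem_top)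
    ((_root_.map_ne_zero (algebraMap kbar Ω)).2 hγ0) H.proper.ne_zero (z := z) (by
      rw [hz, mul_pow, ← map_pow, hγ, hy]
      rfl)
  refine ⟨hcubic, ⟨IntermediateField.equivOfEq ?_⟩⟩
  rw [compositum_eq_adjoin_simple_iff.2 (H.sup_eq.trans h1.symm),
    compositum_eq_adjoin_simple_iff.2 H'.sup_eq]

include hq in
/-- A descent of both `y³ = c f` and `y³ = c' f` determines the class of `c` modulo cubes. -/
theorem IsDescentOfCubeRoot.inv_mul_mem_cubes {c c' : normOne k q}
    (h : IsDescentOfCubeRoot k kbar (constElt K Ω q ((c : qˣ) : q) * f) M)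
    (h' : IsDescentOfCubeRoot k kbar (constElt K Ω q ((c' : qˣ) : q) * f) M) :
    c⁻¹ * c' ∈ cubes (normOne k q) := by
  have := IsAlgClosure.isAlgClosed k (K := kbar)
  have h3Ω : (3 : Ω) ≠ 0 := by
    rw [← map_ofNat (algebraMap k Ω) 3]
    exact (_root_.map_ne_zero _).2 h3
  obtain ⟨-, -, y, hy, hyg, hM⟩ := isDescentOfCubeRoot_iff.1 h
  obtain ⟨-, -, z, hz, hzg, hM'⟩ := isDescentOfCubeRoot_iff.1 h'
  obtain ⟨w, e, H, hw⟩ := (isDescentOfCubeRoot_iff_exists hK h3 hζ hqa hα hs rfl).1 h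
  have hy0 := hy.ne_zero
  obtain ⟨b, hb, hb0, hzb⟩ := hy.eq_mul_or_eq_mul_sq h3Ω hz.cube_mem hz.notMem
    (hM ▸ hM' ▸ (le_sup_right : K⟮z⟯ ≤ _) (mem_adjoin_simple_self K z))
  set C := algebraMap kbar Ω (((c : qˣ) : q) : kbar) with hC
  set C' := algebraMap kbar Ω (((c' : qˣ) : q) : kbar) with hC'
  have hC0 : C ≠ 0 := by simp [hC]
  have hyC : y ^ 3 = C * f := hyg
  have hzC : z ^ 3 = C' * f := hzg
  have hf0 : (f : Ω) ≠ 0 := by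
    intro h0
    rw [h0, mul_zero] at hyC
    exact pow_ne_zero 3 hy0 hyC
  have hquot : algebraMap kbar Ω (((c⁻¹ * c' : normOne k q) : qˣ) : q) = C' / C := by
    simp [hC, hC', div_eq_inv_mul]
  rcases hzb with hzb | hzb
  · obtain ⟨κ, hκ, rfl⟩ := exists_algebraMap_eq_of_pow_three_eq hζ (x := b)
      (c := (((c⁻¹ * c' : normOne k q) : qˣ) : q)) (by
        rw [hquot, eq_div_iff hC0]
        refine mul_right_cancel₀ hf0 ?_
        rw [← hzC, hzb, mul_pow, hyC]
        ring)
    have hκq := mem_of_algebraMap_mem_constExt hqa hK hα hb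
    have hκ0 : κ ≠ 0 := by
      rintro rfl
      exact hb0 (map_zero _)
    obtain ⟨n, hn, hn3⟩ := exists_normOne_pow_three_eq hq (c⁻¹ * c').2
      (x := Units.mk0 ⟨κ, hκq⟩ fun h0 => hκ0 (congrArg Subtype.val h0))
      (Units.ext (Subtype.ext hκ))
    exact ⟨⟨n, hn⟩, Subtype.ext hn3⟩
  · -- otherwise `f` would be the product of a constant and a cube, hence a cube in `K k̄`
    exfalso
    obtain ⟨γ, hγ⟩ := IsAlgClosed.exists_pow_nat_eq
      ((((c⁻¹ * c' : normOne k q) : qˣ) : q) : kbar) (by norm_num : 0 < 3)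
    have hγ' : algebraMap kbar Ω γ ^ 3 = C' / C := by rw [← hquot, ← hγ, map_pow]
    refine H.proper.cube_ne (algebraMap kbar Ω γ / b)
      (div_mem (algebraMap_mem_constExt mem_top) (constExt_mono le_top hb)) ?_
    rw [hw, ← hyg, hyC, div_pow, hγ']
    have h1 : C' * f = b ^ 3 * (C * f) ^ 2 := by
      rw [← hzC, ← hyC, hzb]
      ring
    field_simp
    refine mul_right_cancel₀ hf0 ?_
    linear_combination h1

include hq in
/-- Every twist of a descent of `y³ = f` is a descent of `y³ = c f` for some `c` of norm `1`. -/
theorem IsTwist.exists_isDescentOfCubeRoot (hL : IsDescentOfCubeRoot k kbar f L)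
    (h : IsTwist k kbar L M) : ∃ c : normOne k q,
      IsDescentOfCubeRoot k kbar (constElt K Ω q ((c : qˣ) : q) * f) M := by
  have := IsAlgClosure.isAlgClosed k (K := kbar)
  have h3Ω : (3 : Ω) ≠ 0 := by
    rw [← map_ofNat (algebraMap k Ω) 3]
    exact (_root_.map_ne_zero _).2 h3
  have hqK : constExt K Ω q = K⟮algebraMap kbar Ω a⟯ := by rw [hqa, constExt_adjoin_simple]
  have hζΩ := hζ.map_of_injective (f := algebraMap kbar Ω) (algebraMap kbar Ω).injective
  obtain ⟨y₀, h₀, H, hy₀⟩ := (isDescentOfCubeRoot_iff_exists hK h3 hζ hqa hα hs rfl).1 hL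
  obtain ⟨y, hy, hy3, hMy⟩ := isDefinedByCubeRoot_compositum_iff.1
    ((isDefinedByCubeRoot_compositum_iff (g := ⟨y₀ ^ 3, H.proper.cube_mem⟩)).2
      ⟨y₀, H.proper, rfl, H.sup_eq⟩ |>.of_algEquiv h.iso.some)
  replace hy3 : y ^ 3 = f := hy3.trans hy₀
  have hyh : y ^ 3 * s (y ^ 3) = h₀ ^ 3 := by rw [hy3, ← hy₀, H.mul_map]
  have hyq : y ^ 3 ∈ constExt K Ω q := hy3 ▸ f.2
  have hyα := hyq
  rw [hqK] at hyα
  have hy0 := hy.ne_zero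
  -- a generator of `M` of trace zero
  obtain ⟨t, hMt, htbot, p, hp, r, hr, htpr⟩ :=
    exists_generator_of_finrank_three h3Ω h.isCubicExt.finrank_eq
  have htE : t ∉ constExt K Ω (⊤ : IntermediateField k kbar) := fun ht =>
    h.isCubicExt.not_le_constExt hK (hMt ▸ adjoin_simple_le_iff.2 ht)
  obtain ⟨b, hb, c, hc, rfl, rfl, rfl⟩ := hy.exists_eq_of_cubic_eq h3Ω
    (hMy ▸ (le_sup_left : M ≤ _) (hMt ▸ mem_adjoin_simple_self K t)) htE
    ((bot_le : ⊥ ≤ constExt K Ω _) hp) ((bot_le : ⊥ ≤ constExt K Ω _) hr) htpr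
  set z := b * y with hz
  set z' := c * y ^ 2 with hz'
  have hconj := isConjugation_adjoin hα hs
  have h3bot : (3 : Ω) ∈ (⊥ : IntermediateField K Ω) := by
    exact_mod_cast _root_.natCast_mem (⊥ : IntermediateField K Ω) 3
  have hzz : z * z' ∈ (⊥ : IntermediateField K Ω) := by
    have := div_mem (neg_mem hp) h3bot
    rwa [neg_neg, mul_div_cancel_left₀ _ h3Ω] at this
  have ht0 : z + z' ≠ 0 := fun h0 => htbot (h0 ▸ zero_mem _)
  obtain ⟨hb0, hbfix, hsz⟩ := map_summands_of_descentEquation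
    (fun τ x hx => map_mem_constExt_top τ hx) hy hyα H.mem_base hyh hb hc ht0
    (by rw [← mul_pow]; exact pow_mem hzz 3) (by simpa using neg_mem hr)
  replace hsz : s (z ^ 3) = z' ^ 3 := hsz
  have hz0 : z ≠ 0 := mul_ne_zero hb0 hy0
  -- the coefficient `b` is the product of a constant `γ` and of an element of `K q`
  obtain ⟨γ, w, hw, hbγ⟩ := exists_const_mul_of_forall_map hK
    (F := K⟮algebraMap kbar Ω a⟯) hb fun τ hτ => by
      obtain ⟨n, hn⟩ := exists_eq_pow_val_mul hζΩ hb0 (hbfix τ hτ)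
      exact ⟨ζ ^ n.val, by rw [hn, map_pow]⟩
  have hγ0 : algebraMap kbar Ω γ ≠ 0 := left_ne_zero_of_mul (hbγ ▸ hb0)
  have hw0 : w ≠ 0 := right_ne_zero_of_mul (hbγ ▸ hb0)
  have hγq : γ ^ 3 ∈ q := by
    refine mem_of_algebraMap_mem_constExt hqa hK hα ?_
    rw [hqK]
    refine mem_of_isSeparable_of_forall_fixed (isSeparable_const k K Ω _) fun τ hτ => ?_
    have h1 := hbfix τ hτ
    rw [hbγ, map_mul, hτ w hw, mul_pow, mul_pow] at h1
    rw [map_pow, map_pow]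
    exact mul_right_cancel₀ (pow_ne_zero 3 hw0) h1
  obtain ⟨c₀, hc₀⟩ : ∃ c₀ : q, (c₀ : kbar) = γ ^ 3 := ⟨⟨γ ^ 3, hγq⟩, rfl⟩
  have hc₀Ω : algebraMap kbar Ω c₀ = algebraMap kbar Ω γ ^ 3 := by rw [hc₀, map_pow]
  have hc₀0 : algebraMap kbar Ω c₀ ≠ 0 := hc₀Ω ▸ pow_ne_zero 3 hγ0
  have hz3 : z ^ 3 = algebraMap kbar Ω c₀ * w ^ 3 * f := by
    rw [hz, hbγ, hc₀Ω, ← hy3]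
    ring
  have hwq : w ∈ constExt K Ω q := hqK ▸ hw
  have hz3q : z ^ 3 ∈ constExt K Ω q := hz3 ▸ mul_mem
    (mul_mem (algebraMap_mem_constExt c₀.2) (pow_mem hwq 3)) f.2
  have hzs : z ^ 3 * s (z ^ 3) = (z * z') ^ 3 := by rw [hsz, ← mul_pow]
  have hdesc : IsDescentOfCubeRoot k kbar (⟨z ^ 3, hz3q⟩ : constExt K Ω q) M :=
    (isDescentOfCubeRoot_iff_exists hK h3 hζ hqa hα hs rfl).2 ⟨z, z * z',
      ⟨hy.mul hb hb0, hzz, hzs, by rw [mul_div_cancel_left₀ _ hz0]; exact hMt⟩, rfl⟩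
  -- the norm of `γ³` is a cube in `k`
  have hsw0 : s w ≠ 0 := (_root_.map_ne_zero s).2 hw0
  have hδ : (z * z' / (w * s w * h₀)) ^ 3 = algebraMap kbar Ω (algebraMap k kbar
      (Algebra.norm k c₀)) := by
    rw [← IsScalarTower.algebraMap_apply, ← algebraMap_mul_apply_eq_norm hqa hq hα.ne hs, div_pow,
      div_eq_iff (pow_ne_zero 3 (mul_ne_zero (mul_ne_zero hw0 hsw0) H.ne_zero)), ← hzs, hz3,
      map_mul, map_mul, map_pow s w, mul_pow _ h₀, ← hyh, hy3]
    ring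
  obtain ⟨d', hd', hd'Ω⟩ := exists_algebraMap_eq_of_pow_three_eq hζ hδ
  obtain ⟨d, rfl⟩ := exists_algebraMap_eq_of_mem_bot (K := K) (Ω := Ω) hK (hd'Ω ▸
    div_mem hzz (mul_mem (hconj.mul_map_mem hw) H.mem_base))
  have hd3 : Algebra.norm k c₀ = d ^ 3 :=
    (algebraMap k kbar).injective (by rw [map_pow, hd'])
  have hc₀q : c₀ ≠ 0 := fun h0 => hc₀0 (by rw [h0]; simp)
  have : FiniteDimensional k q := Module.finite_of_finrank_pos (by omega)
  have hd0 : d ≠ 0 := by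
    rintro rfl
    rw [zero_pow (by norm_num)] at hd3
    exact hc₀q (Algebra.norm_eq_zero_iff.1 hd3)
  have hn := exists_mul_pow_three_mem_normOne hq (c := Units.mk0 c₀ hc₀q) (d := Units.mk0 d hd0) hd3
  refine ⟨⟨_, hn⟩, ?_⟩
  have hdΩ : algebraMap kbar Ω (algebraMap k kbar d) ≠ 0 := by simpa using hd0
  have hemem : algebraMap kbar Ω (algebraMap k kbar d) / (algebraMap kbar Ω c₀ * w) ∈
      constExt K Ω q :=
    div_mem (algebraMap_mem_constExt (q.algebraMap_mem d))
      (mul_mem (algebraMap_mem_constExt c₀.2) hwq)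
  have he0 : (⟨_, hemem⟩ : constExt K Ω q) ≠ 0 := fun h0 =>
    div_ne_zero hdΩ (mul_ne_zero hc₀0 hw0) (congrArg Subtype.val h0)
  convert isDescentOfCubeRoot_mul_pow_three he0 hdesc using 1
  refine Subtype.ext ?_
  change algebraMap kbar Ω (c₀ * (algebraMap k kbar d * (c₀ : kbar)⁻¹) ^ 3) * f =
    (algebraMap kbar Ω (algebraMap k kbar d) / (algebraMap kbar Ω c₀ * w)) ^ 3 * z ^ 3
  rw [hz3, map_mul, map_pow, map_mul (algebraMap kbar Ω), map_inv₀]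
  field_simp

end Twist

end Constants

/-- A relation between a commutative group and a set with an equivalence relation induces a
bijection between a quotient of the group and the set of equivalence classes, provided that it
relates every element on either side to precisely one class on the other. -/
theorem exists_quotient_equiv_of_relation {G T : Type*} [CommGroup G] (H : Subgroup G)
    (r : Setoid T) (R : G → T → Prop) (hG : ∀ c, ∃ t, R c t) (hT : ∀ t, ∃ c, R c t)
    (hr : ∀ {c t t'}, R c t → R c t' → r t t') (hr' : ∀ {c t t'}, R c t → r t t' → R c t')
    (hH : ∀ {c c' t}, R c t → R c' t → c⁻¹ * c' ∈ H)
    (hH' : ∀ {c c' t}, R c t → c⁻¹ * c' ∈ H → R c' t) :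
    ∃ Φ : (G ⧸ H) ≃ Quotient r, ∀ c t, R c t ↔ Φ (QuotientGroup.mk c) = Quotient.mk r t := by
  choose m hm using hG
  let φ : G ⧸ H → Quotient r := Quotient.lift (fun c => Quotient.mk r (m c)) fun c c' h =>
    Quotient.sound (hr (hH' (hm c) (QuotientGroup.leftRel_apply.1 h)) (hm c'))
  have hφ : ∀ c t, R c t ↔ φ (QuotientGroup.mk c) = Quotient.mk r t := fun c t =>
    ⟨fun h => Quotient.sound (hr (hm c) h), fun h => hr' (hm c) (Quotient.exact h)⟩
  refine ⟨Equiv.ofBijective φ ⟨?_, ?_⟩, hφ⟩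
  · rintro ⟨c⟩ ⟨c'⟩ h
    exact QuotientGroup.eq.2 (hH ((hφ c (m c')).2 h) (hm c'))
  · rintro ⟨t⟩
    obtain ⟨c, hc⟩ := hT t
    exact ⟨QuotientGroup.mk c, (hφ c t).1 hc⟩

/-- The elements of norm `1` modulo cubes parametrize the isomorphism classes of twists of a
descent. -/
theorem exists_equiv_twistClasses {k kbar K Ω : Type*} [Field k] [PerfectField k] [Field kbar]
    [Algebra k kbar] [IsAlgClosure k kbar] [Field K] [Algebra k K] [Field Ω] [Algebra K Ω]
    [Algebra kbar Ω] [Algebra k Ω] [IsScalarTower k K Ω] [IsScalarTower k kbar Ω] [Normal K Ω]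
    (hK : ∀ x : K, IsAlgebraic k x → x ∈ (algebraMap k K).range) (h3 : (3 : k) ≠ 0)
    {q : IntermediateField k kbar} (hq : Module.finrank k q = 2) {f : constExt K Ω q}
    {L : IntermediateField K Ω} (hL : IsDescentOfCubeRoot k kbar f L) :
    ∃ Φ : (normOne k q ⧸ cubes (normOne k q)) ≃ TwistClasses k kbar L,
      ∀ (c : normOne k q) (M : IntermediateField K Ω),
        IsDescentOfCubeRoot k kbar (constElt K Ω q ((c : qˣ) : q) * f) M ↔
          ∃ h : IsTwist k kbar L M, Φ (QuotientGroup.mk c) = twistClass k kbar L M h := by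
  have := IsAlgClosure.isAlgClosed k (K := kbar)
  have : NeZero (3 : kbar) := ⟨by
    rw [← map_ofNat (algebraMap k kbar) 3]
    exact (_root_.map_ne_zero _).2 h3⟩
  have : NeZero ((3 : ℕ) : kbar) := ⟨by exact_mod_cast this.out⟩
  obtain ⟨ζ, hζ⟩ := HasEnoughRootsOfUnity.exists_primitiveRoot kbar 3
  obtain ⟨a, a', hqa, hα⟩ := exists_isQuadraticPair (K := K) (Ω := Ω) hK hq
  obtain ⟨s, -, hs⟩ := hα.exists_conj
  have htwist : ∀ {c : normOne k q} {M : IntermediateField K Ω},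
      IsDescentOfCubeRoot k kbar (constElt K Ω q ((c : qˣ) : q) * f) M → IsTwist k kbar L M :=
    fun {c} _ h => hL.isTwist hK h3 hζ hqa hα hs (c : qˣ).ne_zero h
  obtain ⟨Φ, hΦ⟩ := exists_quotient_equiv_of_relation (cubes (normOne k q)) (twistSetoid k kbar L)
    (fun c M => IsDescentOfCubeRoot k kbar (constElt K Ω q ((c : qˣ) : q) * f) M.1)
    (fun c => by
      obtain ⟨M, hM⟩ := exists_isDescentOfCubeRoot_constElt_mul hK h3 hq hζ hqa hα hs hL c
      exact ⟨⟨M, htwist hM⟩, hM⟩)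
    (fun M => M.2.exists_isDescentOfCubeRoot hK h3 hq hζ hqa hα hs hL)
    (fun h h' => h.nonempty_algEquiv hK h3 hζ hqa hα hs h')
    (fun h ⟨e⟩ => h.of_algEquiv hK h3 hζ hqa hα hs e)
    (fun h h' => h.inv_mul_mem_cubes hK h3 hq hζ hqa hα hs h')
    (fun {c c' M} h ⟨n, hn⟩ => by
      have hc' : c' = n ^ 3 * c := by
        rw [show n ^ 3 = c⁻¹ * c' from hn, mul_comm, mul_inv_cancel_left]
      have hn0 : constElt K Ω q ((n : qˣ) : q) ≠ 0 := fun h0 => by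
        have := congrArg Subtype.val h0
        change algebraMap kbar Ω (((n : qˣ) : q) : kbar) = 0 at this
        simp at this
      convert isDescentOfCubeRoot_mul_pow_three hn0 h using 1
      refine Subtype.ext ?_
      simp [hc', constElt, mul_assoc])
  exact ⟨Φ, fun c M => ⟨fun h => ⟨htwist h, (hΦ c ⟨M, htwist h⟩).1 h⟩,
    fun ⟨h, hc⟩ => (hΦ c ⟨M, h⟩).2 hc⟩⟩

theorem mainTheorem5 {k kbar : Type*} [Field k] [PerfectField k] (hchar : (3 : k) ≠ 0)
    [Field kbar] [Algebra k kbar] [IsAlgClosure k kbar]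
    (q : IntermediateField k kbar) (hq : Module.finrank k q = 2) :
    -- `H¹(Γ_k, (ℤ/3)_r) ≅ ker (q*/(q*)³ → k*/(k*)³)`, given by Kummer theory
    (∀ ζ : kbar, IsPrimitiveRoot ζ 3 →
      ∃ e : Multiplicative (galH1 (complementaryExtension q k⟮ζ⟯)) ≃* (normModCubes k q).ker,
        ∀ (a : cocycles (complementaryExtension q k⟮ζ⟯)) (c : qˣ),
          (e (Multiplicative.ofAdd (QuotientAddGroup.mk a)) : qˣ ⧸ cubes qˣ)
              = QuotientGroup.mk c ↔
            ∃ (γ : kbar) (d : k), γ ^ 3 = ((c : q) : kbar) ∧ Algebra.norm k (c : q) = d ^ 3 ∧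
              ∀ σ : Gal(kbar/k),
                ((∀ x ∈ q, σ x = x) → σ γ = ζ ^ (a.1 σ).val * γ) ∧
                (¬ (∀ x ∈ q, σ x = x) → ζ ^ (a.1 σ).val * σ γ * γ = algebraMap k kbar d)) ∧
    -- `N₁ / N₁³ ≅ ker (q*/(q*)³ → k*/(k*)³)`, induced by the inclusion of `N₁` in `q*`
    (∃ e : (normOne k q ⧸ cubes (normOne k q)) ≃* (normModCubes k q).ker,
      ∀ n : normOne k q,
        (e (QuotientGroup.mk n) : qˣ ⧸ cubes qˣ) = QuotientGroup.mk (n : qˣ)) ∧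
    -- `q* / k* ≅ N₁`, by sending the class of `u` to `s(u) / u`
    (∀ s : q ≃ₐ[k] q, s ≠ AlgEquiv.refl →
      ∃ e : (qˣ ⧸ baseUnits k q) ≃* normOne k q,
        ∀ u : qˣ, (((e (QuotientGroup.mk u) : normOne k q) : qˣ) : q) = s (u : q) / (u : q)) ∧
    -- the isomorphism classes of twists of the descent `L` of `y³ = f` are parametrized by
    -- `N₁ / N₁³`, the class of `c` corresponding to the descent of `y³ = c f`
    (∀ (K Ω : Type*) [Field K] [Algebra k K] [Field Ω] [Algebra K Ω] [IsAlgClosure K Ω]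
      [Algebra k Ω] [IsScalarTower k K Ω] [Algebra kbar Ω] [IsScalarTower k kbar Ω],
      IsFunctionFieldOver k K →
      ∀ (f : constExt K Ω q) (L : IntermediateField K Ω), IsDescentOfCubeRoot k kbar f L →
        ∃ Φ : (normOne k q ⧸ cubes (normOne k q)) ≃ TwistClasses k kbar L,
          ∀ (c : normOne k q) (M : IntermediateField K Ω),
            IsDescentOfCubeRoot k kbar (constElt K Ω q ((c : qˣ) : q) * f) M ↔
              ∃ h : IsTwist k kbar L M, Φ (QuotientGroup.mk c) = twistClass k kbar L M h) := by
  have := IsAlgClosure.isAlgClosed k (K := kbar)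
  have : Algebra.IsQuadraticExtension k q := ⟨hq⟩
  refine ⟨fun ζ hζ => galH1_equiv_ker hq hζ, normOne_quotient_equiv_ker hq,
    fun s hs => quotient_baseUnits_equiv_normOne hq hs, ?_⟩
  intro K Ω _ _ _ _ _ _ _ _ _ hK f L hL
  exact exists_equiv_twistClasses hK.isAlgebraic_mem hchar hq hL

end
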